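/- Let $3\le k\le n$, let $(M^n,g_0)$ be a smooth closed Riemannian manifold, and let $\tau<1$. All derivatives, norms and traces are taken with respect to $g_0$ and its Levi-Civita connection $\nabla$. Let $$A^\tau_{g_0}=\frac1{n-2}\Big(\mathrm{Ric}_{g_0}-\frac{\tau R_{g_0}}{2(n-1)}g_0\Big).$$ For $t\in[0,1]$ and $u:M\to\mathbb R$ put $$U^t=\nabla^2u+\frac{1-\tau}{n-2}\,\Delta u\,g_0+\frac{2-\tau}{2}|\nabla u|^2g_0-du\otimes du-tA^\tau_{g_0}+(1-t)g_0,$$ and let $\lambda(U^t)$ be the eigenvalues of $g_0^{-1}U^t$, listed with multiplicity. Let $\sigma_j$ be the $j$-th elementary symmetric polynomial, $\sigma_0=1$, $\sigma_j(U^t)=\sigma_j(\lambda(U^t))$, $\Gamma_{k-1}=\{\lambda\in\mathbb R^n:\sigma_j(\lambda)>0,\ 1\le j\le k-1\}$, and $c=\sigma_k(1,\dots,1)\big/\sum_{l=0}^{k-2}\sigma_l(1,\dots,1)$. Let $\alpha$ and $\alpha_l$ ($0\le l\le k-2$) be smooth functions on $M$ with $\alpha_l>0$, let $t\in[0,1]$,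 and let $u\in C^4(M)$ (in particular, any smooth $u$) be a solution of $$\frac{\sigma_k(U^t)}{\sigma_{k-1}(U^t)}-\frac{\sum_{l=0}^{k-2}[(1-t)c+t\alpha_l]\,e^{2(k-l)u}\,\sigma_l(U^t)}{\sigma_{k-1}(U^t)}=-t\,\alpha\, e^{2u}\quad\text{on }M$$ with $\lambda(U^t)\in\Gamma_{k-1}$ everywhere on $M$. Then $$\sup_M|\nabla^2u|\le C,$$ where $C$ depends only on $(M,g_0)$, $k$, $\tau$, upper bounds for $\|\alpha\|_{C^2(M)}$, $\|u\|_{C^1(M)}$ and $\|\alpha_l\|_{C^2(M)}$, and positive lower bounds for $\inf_M\alpha_l$ ($0\le l\le k-2$). In particular, $C$ does not depend on $t$. -/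

import Mathlib

open scoped Manifold ContDiff ENNReal NNReal

noncomputable section

namespace KrylovEq

/-- `σ_j` applied to a tuple of real numbers listed with multiplicity
(`σ_0 = 1`, and `σ_j = 0` when `j` exceeds the number of entries). -/
def sigma (j : ℕ) (s : Multiset ℝ) : ℝ := s.esymm j

/-- Membership in the Garding cone `Γ_m`: `σ_j > 0` for `1 ≤ j ≤ m`. -/
def InGamma (m : ℕ) (s : Multiset ℝ) : Prop := ∀ j, 1 ≤ j → j ≤ m → 0 < sigma j s

variable {n : ℕ}

/-- The real eigenvalues of a matrix, with algebraic multiplicity. -/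
def eigenvals (A : Matrix (Fin n) (Fin n) ℝ) : Multiset ℝ := A.charpoly.roots

/-- The partial derivative `∂_i f` on `ℝⁿ`. -/
def pd (i : Fin n) (f : EuclideanSpace ℝ (Fin n) → ℝ) (y : EuclideanSpace ℝ (Fin n)) : ℝ :=
  fderiv ℝ f y (EuclideanSpace.single i 1)

variable {M : Type*} [TopologicalSpace M] [ChartedSpace (EuclideanSpace ℝ (Fin n)) M]
  [IsManifold (𝓡 n) ∞ M]

variable (n M) in
/-- Smooth Riemannian metrics on `M`. -/
abbrev Metric := Bundle.ContMDiffRiemannianMetric (𝓡 n) ∞ (EuclideanSpace ℝ (Fin n))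
  (fun x : M => TangentSpace (𝓡 n) x)

/-! ### Tensors in the coordinates of a chart `e`

Functions of `y` are functions on the image of `e` in `ℝⁿ`; they are meaningful for
`y ∈ e.target` when `e` is a chart of `M`. -/

/-- The coordinate vector field `∂_i` of the chart `e`, at the point with coordinates `y`. -/
def frame (e : OpenPartialHomeomorph M (EuclideanSpace ℝ (Fin n))) (i : Fin n)
    (y : EuclideanSpace ℝ (Fin n)) : TangentSpace (𝓡 n) (e.symm y) :=
  mfderiv (𝓡 n) (𝓡 n) e.symm y
    (EuclideanSpace.single i (1 : ℝ) : EuclideanSpace ℝ (Fin n))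

/-- The metric coefficients `g_ij`. -/
def gMat (g : Metric n M) (e : OpenPartialHomeomorph M (EuclideanSpace ℝ (Fin n)))
    (y : EuclideanSpace ℝ (Fin n)) : Matrix (Fin n) (Fin n) ℝ :=
  Matrix.of fun i j => g.inner (e.symm y) (frame e i y) (frame e j y)

/-- The Christoffel symbols
`Γ^k_ij = ½ g^{kl} (∂_i g_jl + ∂_j g_il - ∂_l g_ij)` of the Levi-Civita connection. -/
def christoffel (g : Metric n M) (e : OpenPartialHomeomorph M (EuclideanSpace ℝ (Fin n)))
    (k i j : Fin n) (y : EuclideanSpace ℝ (Fin n)) : ℝ :=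
  (1 / 2) * ∑ l, (gMat g e y)⁻¹ k l *
    (pd i (fun z => gMat g e z j l) y + pd j (fun z => gMat g e z i l) y
      - pd l (fun z => gMat g e z i j) y)

/-- The Ricci tensor
`R_ij = ∂_k Γ^k_ij - ∂_j Γ^k_ik + Γ^k_kl Γ^l_ij - Γ^k_jl Γ^l_ik`
(positive on round spheres). -/
def ricMat (g : Metric n M) (e : OpenPartialHomeomorph M (EuclideanSpace ℝ (Fin n)))
    (y : EuclideanSpace ℝ (Fin n)) : Matrix (Fin n) (Fin n) ℝ :=
  Matrix.of fun i j =>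
    (∑ k, (pd k (christoffel g e k i j) y - pd j (christoffel g e k i k) y))
      + ∑ k, ∑ l, (christoffel g e k k l y * christoffel g e l i j y
          - christoffel g e k j l y * christoffel g e l i k y)

/-- The trace `g^{ij} T_ij` of a symmetric 2-tensor. -/
def trg (g : Metric n M) (e : OpenPartialHomeomorph M (EuclideanSpace ℝ (Fin n)))
    (y : EuclideanSpace ℝ (Fin n)) (T : Matrix (Fin n) (Fin n) ℝ) : ℝ :=
  ∑ i, ∑ j, (gMat g e y)⁻¹ i j * T i j

/-- The modified Schouten tensor `A^τ = (Ric - τ R g / (2 (n - 1))) / (n - 2)`. -/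
def schoutenMat (g : Metric n M) (τ : ℝ)
    (e : OpenPartialHomeomorph M (EuclideanSpace ℝ (Fin n)))
    (y : EuclideanSpace ℝ (Fin n)) : Matrix (Fin n) (Fin n) ℝ :=
  (1 / ((n : ℝ) - 2)) •
    (ricMat g e y - (τ * trg g e y (ricMat g e y) / (2 * ((n : ℝ) - 1))) • gMat g e y)

/-- The components `u_i` of `du`. -/
def gradVec (e : OpenPartialHomeomorph M (EuclideanSpace ℝ (Fin n))) (u : M → ℝ)
    (y : EuclideanSpace ℝ (Fin n)) (i : Fin n) : ℝ :=
  pd i (u ∘ e.symm) y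

/-- The Hessian `∇²u`, with components `∂_i ∂_j u - Γ^k_ij ∂_k u`. -/
def hessMat (g : Metric n M) (e : OpenPartialHomeomorph M (EuclideanSpace ℝ (Fin n)))
    (u : M → ℝ) (y : EuclideanSpace ℝ (Fin n)) : Matrix (Fin n) (Fin n) ℝ :=
  Matrix.of fun i j =>
    pd i (pd j (u ∘ e.symm)) y - ∑ k, christoffel g e k i j y * gradVec e u y k

/-- `|∇u|² = g^{ij} u_i u_j`. -/
def gradSq (g : Metric n M) (e : OpenPartialHomeomorph M (EuclideanSpace ℝ (Fin n)))
    (u : M → ℝ) (y : EuclideanSpace ℝ (Fin n)) : ℝ :=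
  ∑ i, ∑ j, (gMat g e y)⁻¹ i j * gradVec e u y i * gradVec e u y j

/-- `|∇²u|² = g^{ij} g^{ab} u_ia u_jb`. -/
def hessSq (g : Metric n M) (e : OpenPartialHomeomorph M (EuclideanSpace ℝ (Fin n)))
    (u : M → ℝ) (y : EuclideanSpace ℝ (Fin n)) : ℝ :=
  ∑ i, ∑ j, ∑ a, ∑ b, (gMat g e y)⁻¹ i j * (gMat g e y)⁻¹ a b *
    hessMat g e u y i a * hessMat g e u y j b

/-- The tensor
`U^t = ∇²u + (1-τ)/(n-2) Δu g + (2-τ)/2 |∇u|² g - du ⊗ du - t A^τ + (1-t) g`. -/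
def UMat (g : Metric n M) (τ t : ℝ) (e : OpenPartialHomeomorph M (EuclideanSpace ℝ (Fin n)))
    (u : M → ℝ) (y : EuclideanSpace ℝ (Fin n)) : Matrix (Fin n) (Fin n) ℝ :=
  hessMat g e u y
    + ((1 - τ) / ((n : ℝ) - 2) * trg g e y (hessMat g e u y)) • gMat g e y
    + ((2 - τ) / 2 * gradSq g e u y) • gMat g e y
    - Matrix.vecMulVec (gradVec e u y) (gradVec e u y)
    - t • schoutenMat g τ e y
    + (1 - t) • gMat g e y

/-! ### Scalar quantities at a point `p` of `M`, computed in the preferred chart at `p` -/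

/-- `|∇u|(p)`, the norm being that of the metric. -/
def gradNorm (g : Metric n M) (u : M → ℝ) (p : M) : ℝ :=
  √(gradSq g (chartAt (EuclideanSpace ℝ (Fin n)) p) u (chartAt (EuclideanSpace ℝ (Fin n)) p p))

/-- `|∇²u|(p)`, the norm being that of the metric. -/
def hessNorm (g : Metric n M) (u : M → ℝ) (p : M) : ℝ :=
  √(hessSq g (chartAt (EuclideanSpace ℝ (Fin n)) p) u (chartAt (EuclideanSpace ℝ (Fin n)) p p))

/-- `λ(U^t)(p)`, the eigenvalues of `g⁻¹ U^t` at `p`. -/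
def lamU (g : Metric n M) (τ t : ℝ) (u : M → ℝ) (p : M) : Multiset ℝ :=
  let e := chartAt (EuclideanSpace ℝ (Fin n)) p
  eigenvals ((gMat g e (e p))⁻¹ * UMat g τ t e u (e p))

/-- `‖u‖_{C¹} = sup |u| + sup |∇u|`. -/
def c1Norm (g : Metric n M) (u : M → ℝ) : ℝ≥0∞ :=
  (⨆ p, ENNReal.ofReal |u p|) + ⨆ p, ENNReal.ofReal (gradNorm g u p)

/-- `‖u‖_{C²} = sup |u| + sup |∇u| + sup |∇²u|`. -/
def c2Norm (g : Metric n M) (u : M → ℝ) : ℝ≥0∞ :=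
  c1Norm g u + ⨆ p, ENNReal.ofReal (hessNorm g u p)

/-- The constant `c = σ_k(1,…,1) / ∑_{l=0}^{k-2} σ_l(1,…,1)` (with `n` ones). -/
def cConst (n k : ℕ) : ℝ :=
  sigma k (Multiset.replicate n 1) / ∑ l ∈ Finset.range (k - 1), sigma l (Multiset.replicate n 1)

/-- `u` solves the equation of parameter `t` of the continuity family:
`σ_k(U^t)/σ_{k-1}(U^t) - (∑_{l=0}^{k-2} [(1-t)c + t α_l] e^{2(k-l)u} σ_l(U^t)) / σ_{k-1}(U^t)
  = - t α e^{2u}` at every point. -/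
def Solves (g : Metric n M) (k : ℕ) (τ t : ℝ) (α : M → ℝ) (αs : ℕ → M → ℝ) (u : M → ℝ) : Prop :=
  ∀ p, sigma k (lamU g τ t u p) / sigma (k - 1) (lamU g τ t u p)
      - (∑ l ∈ Finset.range (k - 1), ((1 - t) * cConst n k + t * αs l p)
          * Real.exp (2 * ((k : ℝ) - l) * u p) * sigma l (lamU g τ t u p))
        / sigma (k - 1) (lamU g τ t u p)
    = -t * α p * Real.exp (2 * u p)

end KrylovEq

end

/-!
The Hessian bound comes from the maximum principle, applied to the test function
`Δu + K |∇u|²` with `K κ = μ + 1`, where `κ = (1 - τ)/(n - 2) > 0` and `μ = (2 - τ)/2 ≥ 0` are the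
coefficients of `Δu g` and `|∇u|² g` in `U`.

*Structure of the equation.* On the Gårding cone `Γ_{k-1}` the quotient `σ_k/σ_{k-1}` is concave
(`concaveOn_es_quotient`, by the recursion of Huisken and Sinestrari), and so is
`log (σ_{k-1}/σ_l)`. A symmetric matrix passes to its diagonal by a doubly stochastic average of
its eigenvalues, so that at a diagonal matrix these functions have linear upper bounds in the
diagonal entries with nonnegative coefficients (`exists_charSigma_quotient_support`,
`exists_log_charSigma_quotient_support`). Writing the equation as
`σ_k/σ_{k-1} = ∑ β_l exp (-log (σ_{k-1}/σ_l)) - ρ` with `β_l > 0` and differentiating twice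
(`exists_linearization`), one obtains weights `p_i ≥ 0`, with `∑ p_i` bounded below, for which
`∑ p_i ∂_a U_ii` and the negative part of `∑ p_i ∂_a² U_ii` are controlled; the mixed terms in the
derivatives of `β_l` and `σ_l/σ_{k-1}` are absorbed by completing a square. The quotients
`σ_l/σ_{k-1}` are bounded by the equation itself and Newton's inequalities (`es_div_le_of_eq`):
this is where the positive lower bound of the coefficients enters.

*The maximum point.* In normal coordinates at a maximum point of the test function, which
diagonalize `g⁻¹ U`, commuting derivatives turns `∑_a ∑_i p_i ∂_a² U_ii` into
`(∑ p_i) (-2 |∇²u|² + O(1 + |∇²u|))`: the choice of `K` makes the contribution of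
`κ Δ²u + μ Δ|∇u|²` equal to `-Δ|∇u|²` at most, and the terms with third derivatives are controlled
by the first-order conditions (`hessian_bound_of_jets`, `exists_hessSize_bound`). This bounds
`∇²u` at the maximum point, and hence `Δu` from above on all of `M`. Since `k ≥ 3`, the eigenvalues
of `g⁻¹ U` lie in `Γ_2`, where each is bounded by the trace; this bounds the whole Hessian
(`NormalAt.hess_le_of_lapl_le`).

*Uniformity.* Instead of the exponential map, the coordinates `y₀ + L z - ½ Γ(y₀)(L z, L z)` are
used, with `L` an orthonormal frame at `y₀`. They are explicit in `(y₀, L)`, which ranges over a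
compact set, so the jets of the metric in these coordinates are bounded uniformly
(`exists_normalAt`, `exists_isNormalParam`). The scalar quantities of the statement are computed in
the preferred chart at each point; the tensor laws of the section on changes of coordinates
identify them with those in normal coordinates (`IsNormalParam.eventually_invariance`).
-/

noncomputable section

namespace KrylovEq

/-! ### Elementary symmetric functions of real tuples -/

section Symmetric

open Polynomial in
/-- If `p` is real-rooted, then so is `p'` (Rolle). -/
theorem splits_derivative {p : ℝ[X]} (hp : p.Splits) : (derivative p).Splits := by
  rw [splits_iff_card_roots] at hp ⊢
  refine le_antisymm (card_roots' _) ?_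
  have h1 := card_roots_le_derivative p
  have h2 := natDegree_derivative_le p
  omega

open Polynomial in
/-- Laguerre's inequality `p p'' ≤ p'²` for real-rooted polynomials. -/
theorem laguerre_inequality {p : ℝ[X]} (hp : p.Splits) (x : ℝ) :
    p.eval x * (derivative (derivative p)).eval x ≤ (derivative p).eval x ^ 2 := by
  have key : ∀ s : Multiset ℝ, ∀ q : ℝ[X], q = (s.map fun r => X - C r).prod →
      q.eval x * (derivative (derivative q)).eval x ≤ (derivative q).eval x ^ 2 := by
    intro s
    induction s using Multiset.induction_on with
    | empty => rintro q rfl; simp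
    | cons a s ih =>
      rintro q rfl
      have := ih _ rfl
      simp only [Multiset.map_cons, Multiset.prod_cons, derivative_mul, derivative_add,
        derivative_sub, derivative_X, derivative_C, sub_zero, one_mul, eval_add, eval_mul,
        eval_sub, eval_X, eval_C]
      generalize (Multiset.map (fun r => X - C r) s).prod = h at *
      nlinarith [sq_nonneg (h.eval x), mul_nonneg (sq_nonneg (x - a)) (sub_nonneg.2 this)]
  rw [hp.eq_prod_roots]
  have := key p.roots _ rfl
  simp only [derivative_C_mul, eval_mul, eval_C]
  nlinarith [mul_nonneg (sq_nonneg p.leadingCoeff) (sub_nonneg.2 this)]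

open Polynomial in
/-- Newton's inequality for the coefficients of a real-rooted polynomial: Laguerre's inequality at
`0` for its iterated derivatives. -/
theorem coeff_mul_coeff_le_sq {p : ℝ[X]} (hp : p.Splits) (i : ℕ) :
    p.coeff i * p.coeff (i + 2) ≤ p.coeff (i + 1) ^ 2 := by
  have hs : (derivative^[i] p).Splits := by
    induction i with
    | zero => simpa
    | succ m ih => rw [Function.iterate_succ_apply']; exact splits_derivative ih
  have h := laguerre_inequality hs 0
  simp only [← Polynomial.coeff_zero_eq_eval_zero, ← Function.iterate_succ_apply',
    coeff_iterate_derivative, zero_add, Nat.descFactorial_self, nsmul_eq_mul,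
    Nat.factorial_succ, Nat.cast_mul] at h
  have hf : (0 : ℝ) < i.factorial := by positivity
  have h' : (i + 2 : ℝ) * (p.coeff i * p.coeff (i + 2)) ≤ (i + 1 : ℝ) * p.coeff (i + 1) ^ 2 := by
    have : (i.factorial : ℝ) ^ 2 * (i + 1) * ((i + 2 : ℝ) * (p.coeff i * p.coeff (i + 2)))
        ≤ (i.factorial : ℝ) ^ 2 * (i + 1) * ((i + 1 : ℝ) * p.coeff (i + 1) ^ 2) := by
      push_cast [Nat.succ_eq_add_one] at h
      rw [show i + 1 + 1 = i + 2 from rfl] at h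
      linarith
    exact le_of_mul_le_mul_left this (by positivity)
  have hi : (0 : ℝ) ≤ i := i.cast_nonneg
  rcases le_or_gt (p.coeff i * p.coeff (i + 2)) 0 with h0 | h0
  · exact h0.trans (sq_nonneg _)
  · have : (i + 1 : ℝ) * (p.coeff i * p.coeff (i + 2)) ≤ (i + 1 : ℝ) * p.coeff (i + 1) ^ 2 := by
      nlinarith
    exact le_of_mul_le_mul_left this (by positivity)

variable {ι : Type*}

/-- `σ_j` of the entries of `x` indexed by the finite set `s`. -/
def es (s : Finset ι) (j : ℕ) (x : ι → ℝ) : ℝ := ∑ t ∈ s.powersetCard j, ∏ i ∈ t, x i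

theorem sigma_map_eq_es (s : Finset ι) (j : ℕ) (x : ι → ℝ) :
    sigma j (s.val.map x) = es s j x := Finset.esymm_map_val _ _ _

@[simp] theorem es_zero (s : Finset ι) (x : ι → ℝ) : es s 0 x = 1 := by simp [es]

theorem es_smul (s : Finset ι) (j : ℕ) (c : ℝ) (x : ι → ℝ) : es s j (c • x) = c ^ j * es s j x := by
  simp only [es, Pi.smul_apply, smul_eq_mul, Finset.prod_mul_distrib, Finset.mul_sum]
  refine Finset.sum_congr rfl fun t ht => ?_
  rw [Finset.prod_const, (Finset.mem_powersetCard.1 ht).2]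

theorem contDiff_es [Fintype ι] (s : Finset ι) (j : ℕ) {m : WithTop ℕ∞} :
    ContDiff ℝ m (es s j) := by
  unfold es
  fun_prop

theorem es_insert [DecidableEq ι] {s : Finset ι} {i : ι} (hi : i ∉ s) (j : ℕ) (x : ι → ℝ) :
    es (insert i s) (j + 1) x = es s (j + 1) x + x i * es s j x := by
  unfold es
  rw [Finset.powersetCard_succ_insert hi, Finset.sum_union, Finset.sum_image, Finset.mul_sum]
  · congr 1
    refine Finset.sum_congr rfl fun t ht => ?_
    rw [Finset.prod_insert fun h => hi ((Finset.mem_powersetCard.1 ht).1 h)]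
  · intro t ht t' ht' h
    have h1 : i ∉ t := fun h => hi ((Finset.mem_powersetCard.1 ht).1 h)
    have h2 : i ∉ t' := fun h => hi ((Finset.mem_powersetCard.1 ht').1 h)
    rw [← Finset.erase_insert h1, ← Finset.erase_insert h2, h]
  · rw [Finset.disjoint_left]
    intro t ht ht'
    obtain ⟨t', -, rfl⟩ := Finset.mem_image.1 ht'
    exact hi ((Finset.mem_powersetCard.1 ht).1 (Finset.mem_insert_self _ _))

theorem es_erase [DecidableEq ι] {s : Finset ι} {i : ι} (hi : i ∈ s) (j : ℕ) (x : ι → ℝ) :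
    es s (j + 1) x = es (s.erase i) (j + 1) x + x i * es (s.erase i) j x := by
  conv_lhs => rw [← Finset.insert_erase hi]
  exact es_insert (Finset.notMem_erase i s) j x

theorem sum_mul_es_erase [DecidableEq ι] (s : Finset ι) (j : ℕ) (x : ι → ℝ) :
    ∑ i ∈ s, x i * es (s.erase i) j x = (j + 1) * es s (j + 1) x := by
  induction s using Finset.induction_on generalizing j with
  | empty => simp [es, Finset.powersetCard_eq_empty.2 (show (∅ : Finset ι).card < j + 1 by simp)]
  | insert a s ha ih =>
    rw [Finset.sum_insert ha, Finset.erase_insert ha, es_insert ha]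
    have hne : ∀ i ∈ s, (insert a s).erase i = insert a (s.erase i) := fun i hi =>
      Finset.erase_insert_of_ne (fun h => ha (h ▸ hi))
    have hni : ∀ i ∈ s, a ∉ s.erase i := fun i _ h => ha (Finset.mem_of_mem_erase h)
    cases j with
    | zero =>
      simp only [es_zero, mul_one] at ih ⊢
      have := ih 0
      simp only [es_zero, mul_one, Nat.cast_zero, zero_add, one_mul] at this ⊢
      rw [this]; ring
    | succ j =>
      have : ∑ i ∈ s, x i * es ((insert a s).erase i) (j + 1) x
          = ∑ i ∈ s, x i * es (s.erase i) (j + 1) x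
            + x a * ∑ i ∈ s, x i * es (s.erase i) j x := by
        rw [Finset.mul_sum, ← Finset.sum_add_distrib]
        refine Finset.sum_congr rfl fun i hi => ?_
        rw [hne i hi, es_insert (hni i hi)]; ring
      rw [this, ih, ih]; push_cast; ring

/-- Newton's inequality, without its optimal constant, for real tuples of arbitrary signs. -/
theorem es_mul_es_le_sq (s : Finset ι) (j : ℕ) (x : ι → ℝ) :
    es s j x * es s (j + 2) x ≤ es s (j + 1) x ^ 2 := by
  rcases lt_or_ge s.card (j + 2) with h | h
  · have : es s (j + 2) x = 0 := by simp [es, Finset.powersetCard_eq_empty.2 h]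
    rw [this, mul_zero]; positivity
  · have hp : (∏ i ∈ s, (Polynomial.X + Polynomial.C (x i))).Splits :=
      Polynomial.Splits.prod fun i _ => Polynomial.Splits.X_add_C _
    have := coeff_mul_coeff_le_sq hp (s.card - (j + 2))
    rw [Finset.prod_X_add_C_coeff s x (by omega), Finset.prod_X_add_C_coeff s x (by omega),
      Finset.prod_X_add_C_coeff s x (by omega)] at this
    have e1 : s.card - (s.card - (j + 2)) = j + 2 := by omega
    have e2 : s.card - (s.card - (j + 2) + 2) = j := by omega
    have e3 : s.card - (s.card - (j + 2) + 1) = j + 1 := by omega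
    rw [e1, e2, e3] at this
    unfold es; linarith

/-- The Gårding cone `Γ_m` of tuples, formed with the entries indexed by `s`. -/
def gam (s : Finset ι) (m : ℕ) : Set (ι → ℝ) := {x | ∀ j ≤ m, 0 < es s j x}

theorem gam_anti (s : Finset ι) {m m' : ℕ} (h : m ≤ m') : gam s m' ⊆ gam s m :=
  fun _ hx j hj => hx j (hj.trans h)

theorem mem_gam_erase [DecidableEq ι] {s : Finset ι} {i : ι} (hi : i ∈ s) {m : ℕ} {x : ι → ℝ}
    (hx : x ∈ gam s (m + 1)) : x ∈ gam (s.erase i) m := by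
  induction m with
  | zero => intro j hj; obtain rfl : j = 0 := by omega
            simp
  | succ m ih =>
    have ih := ih (gam_anti s (by omega) hx)
    intro j hj
    rcases Nat.lt_or_ge j (m + 1) with h | h
    · exact ih j (by omega)
    obtain rfl : j = m + 1 := by omega
    by_contra hneg
    push Not at hneg
    have h1 := hx (m + 1) (by omega)
    have h2 := hx (m + 2) (by omega)
    rw [es_erase hi] at h1 h2
    have h0 := ih m le_rfl
    have hN := es_mul_es_le_sq (s.erase i) m x
    generalize es (s.erase i) m x = a at *
    generalize es (s.erase i) (m + 1) x = b at *
    generalize es (s.erase i) (m + 2) x = c at *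
    have hxi : 0 < x i := by
      by_contra hc; push Not at hc
      nlinarith
    -- Newton's inequality `a c ≤ b²` fails: `x i * a > -b ≥ 0` and `c > -x i * b`.
    nlinarith [mul_lt_mul_of_pos_left h2 h0, mul_nonneg (neg_nonneg.2 hneg) h1.le]

theorem gam_erase_add_pos [DecidableEq ι] {s : Finset ι} {i : ι} (hi : i ∈ s) {m : ℕ} {x : ι → ℝ}
    (hx : x ∈ gam s (m + 1)) :
    0 < x i + es (s.erase i) (m + 1) x / es (s.erase i) m x := by
  have h0 := mem_gam_erase hi hx m le_rfl
  have h1 := hx (m + 1) le_rfl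
  rw [es_erase hi] at h1
  have : x i + es (s.erase i) (m + 1) x / es (s.erase i) m x
      = (es (s.erase i) (m + 1) x + x i * es (s.erase i) m x) / es (s.erase i) m x := by
    field_simp; ring
  rw [this]; positivity

/-- The recursion of Huisken and Sinestrari for the quotients `σ_{m+2}/σ_{m+1}`. -/
theorem es_quotient_recursion [DecidableEq ι] {s : Finset ι} {m : ℕ} {x : ι → ℝ}
    (hx : x ∈ gam s (m + 1)) :
    es s (m + 2) x / es s (m + 1) x = (m + 2 : ℝ)⁻¹ * ∑ i ∈ s,
      x i * (es (s.erase i) (m + 1) x / es (s.erase i) m x)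
        / (x i + es (s.erase i) (m + 1) x / es (s.erase i) m x) := by
  have h := sum_mul_es_erase s (m + 1) x
  have hpos := hx (m + 1) le_rfl
  have : ∑ i ∈ s, x i * (es (s.erase i) (m + 1) x / es (s.erase i) m x)
        / (x i + es (s.erase i) (m + 1) x / es (s.erase i) m x)
      = (∑ i ∈ s, x i * es (s.erase i) (m + 1) x) / es s (m + 1) x := by
    rw [Finset.sum_div]
    refine Finset.sum_congr rfl fun i hi => ?_
    have h0 := mem_gam_erase hi hx m le_rfl
    have h1 := gam_erase_add_pos hi hx
    rw [es_erase hi] at hpos ⊢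
    rw [div_eq_div_iff h1.ne' hpos.ne']
    field_simp
    ring
  rw [this, h]
  push_cast
  field_simp
  ring

theorem mul_div_add_superadditive {x y r s : ℝ} (h1 : 0 < x + r) (h2 : 0 < y + s) :
    x * r / (x + r) + y * s / (y + s) ≤ (x + y) * (r + s) / (x + y + (r + s)) := by
  have h3 : 0 < x + y + (r + s) := by linarith
  rw [div_add_div _ _ h1.ne' h2.ne', div_le_div_iff₀ (mul_pos h1 h2) h3]
  nlinarith [sq_nonneg (x * s - y * r)]

theorem mul_div_add_mono {x r s : ℝ} (h1 : 0 < x + r) (h : r ≤ s) :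
    x * r / (x + r) ≤ x * s / (x + s) := by
  rw [div_le_div_iff₀ h1 (by linarith)]
  nlinarith [mul_nonneg (sq_nonneg x) (sub_nonneg.2 h)]

/-- `σ_{m+1}/σ_m` is concave on `Γ_m`. -/
theorem concaveOn_es_quotient (m : ℕ) (s : Finset ι) :
    ConcaveOn ℝ (gam s m) fun x => es s (m + 1) x / es s m x := by
  classical
  induction m generalizing s with
  | zero =>
    have hg : gam s 0 = Set.univ := by
      ext x; simp [gam]
    have hl : ∀ x : ι → ℝ, es s (0 + 1) x / es s 0 x = ∑ i ∈ s, x i := by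
      intro x; simp [es, Finset.powersetCard_one]
    rw [hg]
    refine ⟨convex_univ, fun x _ y _ a b _ _ _ => ?_⟩
    simp only [hl, Pi.add_apply, Pi.smul_apply, smul_eq_mul, Finset.sum_add_distrib,
      Finset.mul_sum, le_refl]
  | succ m ih =>
    have hconv : Convex ℝ (gam s (m + 1)) := by
      have : gam s (m + 1) = {x ∈ gam s m | 0 < es s (m + 1) x / es s m x} := by
        ext x
        constructor
        · exact fun hx => ⟨gam_anti s (by omega) hx, div_pos (hx _ le_rfl) (hx _ (by omega))⟩
        · rintro ⟨hx, hp⟩ j hj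
          rcases Nat.lt_or_ge j (m + 1) with h | h
          · exact hx j (by omega)
          · obtain rfl : j = m + 1 := by omega
            have := hx m le_rfl
            exact (div_pos_iff_of_pos_right this).1 hp
      rw [this]
      exact (ih s).convex_gt 0
    refine ⟨hconv, fun x hx y hy a b ha hb hab => ?_⟩
    have hz := hconv hx hy ha hb hab
    simp only
    rw [es_quotient_recursion hx, es_quotient_recursion hy, es_quotient_recursion hz,
      smul_eq_mul, smul_eq_mul, mul_left_comm, mul_left_comm b, ← mul_add]
    refine mul_le_mul_of_nonneg_left ?_ (by positivity)
    rw [Finset.mul_sum, Finset.mul_sum, ← Finset.sum_add_distrib]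
    refine Finset.sum_le_sum fun i hi => ?_
    have hc := (ih (s.erase i)).2 (mem_gam_erase hi hx) (mem_gam_erase hi hy) ha hb hab
    have px := gam_erase_add_pos hi hx
    have py := gam_erase_add_pos hi hy
    simp only [Pi.add_apply, Pi.smul_apply, smul_eq_mul] at hc ⊢
    generalize es (s.erase i) (m + 1) x / es (s.erase i) m x = r at *
    generalize es (s.erase i) (m + 1) y / es (s.erase i) m y = r' at *
    generalize es (s.erase i) (m + 1) (a • x + b • y) / es (s.erase i) m (a • x + b • y) = R at *
    rcases ha.eq_or_lt with rfl | ha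
    · obtain rfl : b = 1 := by linarith
      simp only [zero_mul, one_mul, zero_add] at hc ⊢
      exact mul_div_add_mono py hc
    rcases hb.eq_or_lt with rfl | hb
    · obtain rfl : a = 1 := by linarith
      simp only [zero_mul, one_mul, add_zero] at hc ⊢
      exact mul_div_add_mono px hc
    have e : ∀ c u v : ℝ, 0 < c → c * (u * v / (u + v)) = (c * u) * (c * v) / (c * u + c * v) := by
      intro c u v hc
      rw [← mul_add, mul_mul_mul_comm, mul_assoc c c, mul_div_mul_left _ _ hc.ne',
        mul_div_assoc, mul_div_assoc, mul_div_assoc]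
    rw [e a _ _ ha, e b _ _ hb]
    have pa : 0 < a * x i + a * r := by rw [← mul_add]; exact mul_pos ha px
    have pb : 0 < b * y i + b * r' := by rw [← mul_add]; exact mul_pos hb py
    exact (mul_div_add_superadditive pa pb).trans (mul_div_add_mono (by linarith) hc)

theorem convex_gam (s : Finset ι) (m : ℕ) : Convex ℝ (gam s m) := (concaveOn_es_quotient m s).1

/-- Newton's inequality on `Γ_{m+1}`: the quotients `σ_{j+1}/σ_j` decrease with `j`. -/
theorem es_quotient_succ_le {s : Finset ι} {m : ℕ} {x : ι → ℝ} (hx : x ∈ gam s (m + 1)) :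
    es s (m + 2) x / es s (m + 1) x ≤ es s (m + 1) x / es s m x := by
  rw [div_le_div_iff₀ (hx _ le_rfl) (hx _ (by omega))]
  nlinarith [es_mul_es_le_sq s m x]

theorem mem_gam_of_pos {s : Finset ι} {m : ℕ} (hm : m ≤ s.card) {x : ι → ℝ}
    (hx : ∀ i, 0 < x i) : x ∈ gam s m := by
  intro j hj
  refine Finset.sum_pos (fun t _ => Finset.prod_pos fun i _ => hx i) ?_
  exact Finset.powersetCard_nonempty.2 (hj.trans hm)

/-- A concave function on a cone which is homogeneous of degree one lies below its gradient at
every point. This turns concavity of `σ_{m+1}/σ_m` into a linear upper bound with nonnegative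
coefficients. -/
theorem exists_es_quotient_support [Fintype ι] {m : ℕ} (hm : m + 1 ≤ Fintype.card ι) {x : ι → ℝ}
    (hx : x ∈ gam Finset.univ m) :
    ∃ p : ι → ℝ, (∀ i, 0 ≤ p i) ∧
      es Finset.univ (m + 1) (fun _ : ι => (1 : ℝ)) / es Finset.univ m (fun _ : ι => (1 : ℝ))
        ≤ ∑ i, p i ∧
      (∀ y ∈ gam Finset.univ m, es Finset.univ (m + 1) y / es Finset.univ m y ≤ ∑ i, p i * y i) ∧
      es Finset.univ (m + 1) x / es Finset.univ m x = ∑ i, p i * x i := by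
  classical
  set f : (ι → ℝ) → ℝ := fun x => es Finset.univ (m + 1) x / es Finset.univ m x with hf
  have hconc : ConcaveOn ℝ (gam Finset.univ m) f := concaveOn_es_quotient m _
  have hd : HasFDerivAt f (fderiv ℝ f x) x := by
    refine DifferentiableAt.hasFDerivAt (ContDiffAt.differentiableAt (n := 1) ?_ one_ne_zero)
    exact (contDiff_es _ _).contDiffAt.div (contDiff_es _ _).contDiffAt (hx m le_rfl).ne'
  have hline : ∀ v : ι → ℝ, HasDerivAt (fun t : ℝ => f (x + t • v)) (fderiv ℝ f x v) 0 := by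
    intro v
    have h1 : HasDerivAt (fun t : ℝ => x + t • v) v 0 := by
      simpa using ((hasDerivAt_id (0 : ℝ)).smul_const v).const_add x
    have h2 : HasFDerivAt f (fderiv ℝ f x) (x + (0 : ℝ) • v) := by simpa using hd
    exact h2.comp_hasDerivAt 0 h1
  have hhom : ∀ c : ℝ, 0 < c → f (c • x) = c * f x := by
    intro c hc
    simp only [hf, es_smul]
    have := (hx m le_rfl).ne'
    field_simp
    ring
  have heuler : fderiv ℝ f x x = f x := by
    have h1 := hline x
    have h2 : HasDerivAt (fun t : ℝ => (1 + t) * f x) (f x) 0 := by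
      simpa using ((hasDerivAt_id (0 : ℝ)).const_add 1).mul_const (f x)
    refine h1.unique (h2.congr_of_eventuallyEq ?_)
    filter_upwards [lt_mem_nhds (show (-1 : ℝ) < 0 by norm_num)] with t ht
    rw [show x + t • x = (1 + t) • x by rw [add_smul, one_smul], hhom _ (by linarith)]
  have hsupp : ∀ y ∈ gam Finset.univ m, f y ≤ fderiv ℝ f x y := by
    intro y hy
    have h1 := hline (y - x)
    have h2 : f y - f x ≤ fderiv ℝ f x (y - x) := by
      have ht := (hasDerivAt_iff_tendsto_slope_zero.1 h1).mono_left
        (nhdsWithin_mono (0 : ℝ) (fun t (ht : t ∈ Set.Ioi (0 : ℝ)) => ne_of_gt ht))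
      refine ge_of_tendsto ht ?_
      filter_upwards [Ioc_mem_nhdsGT (show (0 : ℝ) < 1 by norm_num)] with t ht
      have hc := hconc.2 hx hy (show 0 ≤ 1 - t by linarith [ht.2]) ht.1.le (by ring)
      have e : (1 - t) • x + t • y = x + t • (y - x) := by module
      rw [e] at hc
      simp only [zero_add, zero_smul, add_zero, smul_eq_mul] at hc ⊢
      rw [inv_mul_eq_div, le_div_iff₀ ht.1]
      linarith
    rw [map_sub, heuler] at h2
    linarith
  have hexp : ∀ y, fderiv ℝ f x y = ∑ i, fderiv ℝ f x (Pi.single i 1) * y i := by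
    intro y
    conv_lhs => rw [← Finset.univ_sum_single y, map_sum]
    refine Finset.sum_congr rfl fun i _ => ?_
    rw [show (Pi.single i (y i) : ι → ℝ) = y i • Pi.single i 1 by
      rw [← Pi.single_smul, smul_eq_mul, mul_one], map_smul, smul_eq_mul, mul_comm]
  have hcard : m ≤ (Finset.univ : Finset ι).card := by rw [Finset.card_univ]; omega
  refine ⟨fun i => fderiv ℝ f x (Pi.single i 1), fun i => ?_, ?_, fun y hy => ?_, ?_⟩
  · have key : ∀ ε : ℝ, 0 < ε →
        0 ≤ fderiv ℝ f x (Pi.single i 1) + ε * fderiv ℝ f x (fun _ => 1) := by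
      intro ε hε
      have hpos : ∀ j, 0 < ((Pi.single i 1 + ε • (fun _ => (1 : ℝ)) : ι → ℝ)) j := by
        intro j
        rcases eq_or_ne j i with rfl | h
        · simp; linarith
        · simp [h, hε]
      have h1 := hsupp _ (mem_gam_of_pos hcard hpos)
      rw [map_add, map_smul, smul_eq_mul] at h1
      refine le_trans ?_ h1
      exact (div_pos (mem_gam_of_pos (by rw [Finset.card_univ]; exact hm) hpos _ le_rfl)
        (mem_gam_of_pos hcard hpos _ le_rfl)).le
    have ht : Filter.Tendsto (fun ε : ℝ => fderiv ℝ f x (Pi.single i 1)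
        + ε * fderiv ℝ f x (fun _ => 1)) (nhdsWithin 0 (Set.Ioi 0))
        (nhds (fderiv ℝ f x (Pi.single i 1) + 0 * fderiv ℝ f x (fun _ => 1))) := by
      refine Filter.Tendsto.mono_left ?_ nhdsWithin_le_nhds
      exact (Continuous.tendsto (by fun_prop) 0)
    rw [zero_mul, add_zero] at ht
    exact ge_of_tendsto ht (by filter_upwards [self_mem_nhdsWithin] with ε hε using key ε hε)
  · have := hsupp _ (mem_gam_of_pos hcard (x := fun _ => 1) fun _ => one_pos)
    rw [hexp] at this
    simpa [hf] using this
  · rw [← hexp]; exact hsupp y hy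
  · rw [← hexp, heuler]

end Symmetric

/-! ### Elementary symmetric functions of the eigenvalues of a matrix -/

section MatrixSymmetric

variable {n : ℕ}

/-- The `j`-th elementary symmetric function of the eigenvalues of `A`, read off from the
characteristic polynomial, so that it is a polynomial in the entries of `A`. -/
def charSigma (j : ℕ) (A : Matrix (Fin n) (Fin n) ℝ) : ℝ := (-1) ^ j * A.charpoly.coeff (n - j)

theorem sigma_eigenvals {A : Matrix (Fin n) (Fin n) ℝ} (hA : A.charpoly.Splits) {j : ℕ}
    (hj : j ≤ n) : sigma j (eigenvals A) = charSigma j A := by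
  have hd : A.charpoly.natDegree = n := by rw [Matrix.charpoly_natDegree_eq_dim, Fintype.card_fin]
  have hm : A.charpoly.leadingCoeff = 1 := A.charpoly_monic
  have := Polynomial.coeff_eq_esymm_roots_of_splits hA (k := n - j) (by omega)
  rw [hd, hm, one_mul, show n - (n - j) = j by omega] at this
  rw [charSigma, this, ← mul_assoc, ← mul_pow]
  simp [sigma, eigenvals]

theorem charSigma_transpose (j : ℕ) (A : Matrix (Fin n) (Fin n) ℝ) :
    charSigma j A.transpose = charSigma j A := by
  rw [charSigma, charSigma, Matrix.charpoly_transpose]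

theorem charSigma_diagonal {j : ℕ} (hj : j ≤ n) (x : Fin n → ℝ) :
    charSigma j (Matrix.diagonal x) = es Finset.univ j x := by
  have h := Finset.prod_X_add_C_coeff (Finset.univ : Finset (Fin n)) (fun i => -x i)
    (k := n - j) (by simp)
  rw [Finset.card_univ, Fintype.card_fin, show n - (n - j) = j by omega] at h
  have h2 := es_smul (Finset.univ : Finset (Fin n)) j (-1) x
  rw [charSigma, Matrix.charpoly_diagonal]
  simp only [map_neg, ← sub_eq_add_neg] at h
  rw [h]
  have h3 : ∑ t ∈ Finset.powersetCard j Finset.univ, ∏ i ∈ t, -x i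
      = es Finset.univ j ((-1 : ℝ) • x) := by simp [es]
  rw [h3, h2, ← mul_assoc, ← mul_pow]
  simp

theorem contDiff_charSigma (j : ℕ) {m : WithTop ℕ∞} :
    ContDiff ℝ m fun A : Fin n → Fin n → ℝ => charSigma j (Matrix.of A) := by
  have h : (fun A : Fin n → Fin n → ℝ => charSigma j (Matrix.of A)) = fun A => (-1) ^ j *
      MvPolynomial.aeval (fun q : Fin n × Fin n => A q.1 q.2)
        ((Matrix.charpoly.univ ℝ (Fin n)).coeff (n - j)) := by
    ext A
    have := Matrix.charpoly.univ_coeff_eval₂Hom (Fin n) (RingHom.id ℝ)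
      (fun q : Fin n × Fin n => A q.1 q.2) (n - j)
    rw [charSigma, MvPolynomial.aeval_def]
    congr 1
    exact this.symm
  rw [contDiff_iff_contDiffAt, h]
  intro A
  refine contDiffAt_const.mul (AnalyticAt.aeval_mvPolynomial (fun q => ?_) _).contDiffAt
  exact ((ContinuousLinearMap.proj q.2 : (Fin n → ℝ) →L[ℝ] ℝ).comp
    (ContinuousLinearMap.proj q.1 : (Fin n → Fin n → ℝ) →L[ℝ] (Fin n → ℝ))).analyticAt A

/-- Orthogonal diagonalization of a real symmetric matrix. -/
theorem exists_orthogonal_diagonalization {A : Matrix (Fin n) (Fin n) ℝ} (hA : A.IsSymm) :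
    ∃ (V : Matrix (Fin n) (Fin n) ℝ) (x : Fin n → ℝ), V * V.transpose = 1 ∧ V.transpose * V = 1 ∧
      A = V * Matrix.diagonal x * V.transpose := by
  have hH : A.IsHermitian := by
    rw [Matrix.IsHermitian, Matrix.conjTranspose_eq_transpose_of_trivial]; exact hA
  have e : star (hH.eigenvectorUnitary : Matrix (Fin n) (Fin n) ℝ)
      = (hH.eigenvectorUnitary : Matrix (Fin n) (Fin n) ℝ).transpose := by
    rw [Matrix.star_eq_conjTranspose, Matrix.conjTranspose_eq_transpose_of_trivial]
  refine ⟨hH.eigenvectorUnitary, hH.eigenvalues, ?_, ?_, ?_⟩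
  · rw [← e]; exact Unitary.coe_mul_star_self _
  · rw [← e]; exact Unitary.coe_star_mul_self _
  · have := hH.spectral_theorem
    rw [Unitary.conjStarAlgAut_apply, ← Unitary.coe_star] at this
    rw [← e]
    exact this

theorem charpoly_conj {A V V' : Matrix (Fin n) (Fin n) ℝ} (h : V' * V = 1) :
    (V * A * V').charpoly = A.charpoly := by
  rw [Matrix.charpoly_mul_comm, ← Matrix.mul_assoc, h, Matrix.one_mul]

theorem es_comp_perm (j : ℕ) (x : Fin n → ℝ) (σ : Equiv.Perm (Fin n)) :
    es Finset.univ j (x ∘ σ) = es Finset.univ j x := by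
  rw [← sigma_map_eq_es, ← sigma_map_eq_es]
  congr 1
  rw [← Multiset.map_map]
  congr 1
  exact Multiset.map_univ_val_equiv σ

/-- A Schur-type inequality: averaging by a doubly stochastic matrix stays in `Γ_m` and increases
the concave symmetric function `σ_{m+1}/σ_m`. -/
theorem es_quotient_le_doublyStochastic {m : ℕ} {x : Fin n → ℝ} (hx : x ∈ gam Finset.univ m)
    {D : Matrix (Fin n) (Fin n) ℝ} (hD : D ∈ doublyStochastic ℝ (Fin n)) :
    D.mulVec x ∈ gam Finset.univ m ∧ es Finset.univ (m + 1) x / es Finset.univ m x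
      ≤ es Finset.univ (m + 1) (D.mulVec x) / es Finset.univ m (D.mulVec x) := by
  obtain ⟨w, hw0, hw1, rfl⟩ := exists_eq_sum_perm_of_mem_doublyStochastic hD
  have e : (∑ σ : Equiv.Perm (Fin n), w σ • σ.permMatrix ℝ).mulVec x
      = ∑ σ : Equiv.Perm (Fin n), w σ • (x ∘ σ) := by
    rw [Matrix.sum_mulVec]
    refine Finset.sum_congr rfl fun σ _ => ?_
    rw [Matrix.smul_mulVec, Matrix.permMatrix_mulVec]
  have hmem : ∀ σ : Equiv.Perm (Fin n), x ∘ σ ∈ gam Finset.univ m := fun σ j hj => by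
    rw [es_comp_perm]; exact hx j hj
  rw [e]
  refine ⟨(convex_gam _ m).sum_mem (fun σ _ => hw0 σ) hw1 (fun σ _ => hmem σ), ?_⟩
  have := (concaveOn_es_quotient m (Finset.univ : Finset (Fin n))).le_map_sum
    (t := Finset.univ) (fun σ _ => hw0 σ) hw1 (fun σ _ => hmem σ)
  refine le_trans (le_of_eq ?_) this
  simp only [es_comp_perm, smul_eq_mul]
  rw [← Finset.sum_mul, hw1, one_mul]

/-- The matrix form of `exists_es_quotient_support`: at a diagonal matrix with eigenvalues in
`Γ_m`, the function `σ_{m+1}/σ_m` has a linear upper bound which sees only diagonal entries. -/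
theorem exists_charSigma_quotient_support {m : ℕ} (hm : m + 1 ≤ n) {x : Fin n → ℝ}
    (hx : x ∈ gam Finset.univ m) :
    ∃ p : Fin n → ℝ, (∀ i, 0 ≤ p i) ∧
      es Finset.univ (m + 1) (fun _ : Fin n => (1 : ℝ)) / es Finset.univ m (fun _ : Fin n => 1)
        ≤ ∑ i, p i ∧
      (∀ A : Matrix (Fin n) (Fin n) ℝ, A.IsSymm → (∀ j ≤ m, 0 < charSigma j A) →
        charSigma (m + 1) A / charSigma m A
          ≤ charSigma (m + 1) (Matrix.diagonal x) / charSigma m (Matrix.diagonal x)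
            + ∑ i, p i * (A i i - x i)) := by
  obtain ⟨p, h0, h1, h2, h3⟩ := exists_es_quotient_support (by simpa using hm) hx
  refine ⟨p, h0, h1, fun A hA hpos => ?_⟩
  obtain ⟨V, y, hV1, hV2, hAV⟩ := exists_orthogonal_diagonalization hA
  have hS : ∀ j ≤ n, charSigma j A = es Finset.univ j y := by
    intro j hj
    rw [← charSigma_diagonal hj, charSigma, charSigma, hAV, charpoly_conj hV2]
  have hy : y ∈ gam Finset.univ m := fun j hj => by
    rw [← hS j (by omega)]; exact hpos j hj
  set D : Matrix (Fin n) (Fin n) ℝ := Matrix.of fun i j => V i j ^ 2 with hD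
  have hDm : D ∈ doublyStochastic ℝ (Fin n) := by
    rw [mem_doublyStochastic_iff_sum]
    refine ⟨fun i j => sq_nonneg _, fun i => ?_, fun j => ?_⟩
    · have := congrFun (congrFun hV1 i) i
      simpa [Matrix.mul_apply, hD, sq] using this
    · have := congrFun (congrFun hV2 j) j
      simpa [Matrix.mul_apply, hD, sq] using this
  have hdiag : D.mulVec y = fun i => A i i := by
    ext i
    rw [hAV]
    rw [Matrix.mul_apply]
    simp only [Matrix.mulVec, dotProduct, hD, Matrix.of_apply,
      Matrix.mul_diagonal, Matrix.transpose_apply]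
    exact Finset.sum_congr rfl fun j _ => by ring
  obtain ⟨hg, hle⟩ := es_quotient_le_doublyStochastic hy hDm
  rw [hdiag] at hg hle
  rw [hS _ hm, hS _ (by omega), charSigma_diagonal hm, charSigma_diagonal (by omega), h3]
  refine hle.trans ((h2 _ hg).trans (le_of_eq ?_))
  rw [← Finset.sum_add_distrib]
  exact Finset.sum_congr rfl fun i _ => by ring

/-- The analogous bound for `log (σ_m/σ_l)`, `l ≤ m`, a sum of logarithms of the concave
functions `σ_{j+1}/σ_j`. -/
theorem exists_log_charSigma_quotient_support {l m : ℕ} (hl : l ≤ m) (hm : m ≤ n)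
    {x : Fin n → ℝ} (hx : x ∈ gam Finset.univ m) :
    ∃ r : Fin n → ℝ, (∀ i, 0 ≤ r i) ∧
      (∀ A : Matrix (Fin n) (Fin n) ℝ, A.IsSymm → (∀ j ≤ m, 0 < charSigma j A) →
        Real.log (charSigma m A / charSigma l A)
          ≤ Real.log (charSigma m (Matrix.diagonal x) / charSigma l (Matrix.diagonal x))
            + ∑ i, r i * (A i i - x i)) := by
  induction m, hl using Nat.le_induction with
  | base =>
    refine ⟨fun _ => 0, fun _ => le_rfl, fun A _ hpos => ?_⟩
    have h1 := hpos l le_rfl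
    have h2 : 0 < charSigma l (Matrix.diagonal x) := by
      rw [charSigma_diagonal hm]; exact hx l le_rfl
    simp [div_self h1.ne', div_self h2.ne']
  | succ m hl ih =>
    obtain ⟨r, hr0, hr⟩ := ih (by omega) (gam_anti _ (by omega) hx)
    obtain ⟨p, hp0, -, hp⟩ := exists_charSigma_quotient_support hm (gam_anti _ (by omega) hx)
    set U := Matrix.diagonal x with hU
    have hUpos : ∀ j ≤ m + 1, 0 < charSigma j U := fun j hj => by
      rw [charSigma_diagonal (by omega)]; exact hx j hj
    have hq : 0 < charSigma (m + 1) U / charSigma m U :=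
      div_pos (hUpos _ le_rfl) (hUpos _ (by omega))
    refine ⟨fun i => p i / (charSigma (m + 1) U / charSigma m U) + r i,
      fun i => add_nonneg (div_nonneg (hp0 i) hq.le) (hr0 i), fun A hA hpos => ?_⟩
    have hsplit : ∀ B : Matrix (Fin n) (Fin n) ℝ, (∀ j ≤ m + 1, 0 < charSigma j B) →
        Real.log (charSigma (m + 1) B / charSigma l B)
          = Real.log (charSigma (m + 1) B / charSigma m B)
            + Real.log (charSigma m B / charSigma l B) := by
      intro B hB
      have h1 := hB (m + 1) le_rfl
      have h2 := hB m (by omega)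
      have h3 := hB l (by omega)
      rw [← Real.log_mul (by positivity) (by positivity)]
      congr 1
      field_simp
    rw [hsplit A hpos, hsplit U hUpos]
    have h1 := hr A hA fun j hj => hpos j (by omega)
    have h2 := hp A hA fun j hj => hpos j (by omega)
    have hqA : 0 < charSigma (m + 1) A / charSigma m A :=
      div_pos (hpos _ le_rfl) (hpos _ (by omega))
    have h3 := Real.log_le_sub_one_of_pos (div_pos hqA hq)
    rw [Real.log_div hqA.ne' hq.ne'] at h3
    have h4 : charSigma (m + 1) A / charSigma m A / (charSigma (m + 1) U / charSigma m U) - 1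
        ≤ ∑ i, p i / (charSigma (m + 1) U / charSigma m U) * (A i i - x i) := by
      have : ∑ i, p i / (charSigma (m + 1) U / charSigma m U) * (A i i - x i)
          = (∑ i, p i * (A i i - x i)) / (charSigma (m + 1) U / charSigma m U) := by
        rw [Finset.sum_div]
        exact Finset.sum_congr rfl fun i _ => by ring
      rw [this, div_sub_one hq.ne', div_le_div_iff_of_pos_right hq]
      linarith
    simp only [add_mul, Finset.sum_add_distrib]
    linarith

/-! ### Second derivatives along curves -/

/-- The second-order necessary condition at an interior maximum. -/
theorem deriv_deriv_nonpos_of_isLocalMax {f : ℝ → ℝ} {x : ℝ} (hf : ContinuousAt f x)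
    (h : IsLocalMax f x) : deriv (deriv f) x ≤ 0 := by
  by_contra hc
  push Not at hc
  have hmin := isLocalMin_of_deriv_deriv_pos hc h.deriv_eq_zero hf
  have hconst : f =ᶠ[nhds x] fun _ => f x := by
    filter_upwards [h, hmin] with y h1 h2 using le_antisymm h1 h2
  have h1 : deriv f =ᶠ[nhds x] fun _ => 0 := by
    have := hconst.deriv
    simpa using this
  rw [h1.deriv_eq] at hc
  simp at hc

section Curves

variable {F : Type*} [NormedAddCommGroup F] [NormedSpace ℝ F]

theorem hasDerivAt_deriv_of_contDiffAt {γ : ℝ → F} {s : ℝ} (h : ContDiffAt ℝ 2 γ s) :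
    HasDerivAt (deriv γ) (deriv (deriv γ) s) s := by
  have h1 : ContDiffAt ℝ 1 (fun t => fderiv ℝ γ t 1) s :=
    (h.fderiv_right (m := 1) (by norm_num)).clm_apply contDiffAt_const
  exact (h1.differentiableAt one_ne_zero).hasDerivAt

theorem deriv_comp_curve {Q : F → ℝ} {γ : ℝ → F} {s : ℝ} (hQ : DifferentiableAt ℝ Q (γ s))
    (hγ : DifferentiableAt ℝ γ s) : deriv (fun t => Q (γ t)) s = fderiv ℝ Q (γ s) (deriv γ s) :=
  (hQ.hasFDerivAt.comp_hasDerivAt s hγ.hasDerivAt).deriv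

theorem deriv_deriv_comp_curve {Q : F → ℝ} {γ : ℝ → F} {s : ℝ} (hQ : ContDiffAt ℝ 2 Q (γ s))
    (hγ : ContDiffAt ℝ 2 γ s) :
    deriv (deriv fun t => Q (γ t)) s
      = fderiv ℝ (fderiv ℝ Q) (γ s) (deriv γ s) (deriv γ s)
        + fderiv ℝ Q (γ s) (deriv (deriv γ) s) := by
  have h1 : deriv (fun t => Q (γ t)) =ᶠ[nhds s] fun t => fderiv ℝ Q (γ t) (deriv γ t) := by
    have e1 := hγ.continuousAt.eventually (hQ.eventually (by simp))
    filter_upwards [e1, hγ.eventually (by simp)] with t h1 h2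
    exact deriv_comp_curve (h1.differentiableAt two_ne_zero) (h2.differentiableAt two_ne_zero)
  rw [h1.deriv_eq]
  have h2 : HasFDerivAt (fderiv ℝ Q) (fderiv ℝ (fderiv ℝ Q) (γ s)) (γ s) :=
    ((hQ.fderiv_right (m := 1) (by norm_num)).differentiableAt one_ne_zero).hasFDerivAt
  have h3 := h2.comp_hasDerivAt s (hγ.differentiableAt two_ne_zero).hasDerivAt
  exact (h3.clm_apply (hasDerivAt_deriv_of_contDiffAt hγ)).deriv

end Curves

/-- A function of matrices which is invariant under transposition and, on symmetric matrices, has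
the affine upper bound `∑ p_i A_ii` touching it at the symmetric matrix `γ 0`, has first
derivative given by `p` and second derivative at most that of the bound along every curve `γ`
with symmetric velocity at `0`; the curve itself need not consist of symmetric matrices. -/
theorem deriv_deriv_le_of_support {Q : (Fin n → Fin n → ℝ) → ℝ}
    {γ : ℝ → Fin n → Fin n → ℝ} {p : Fin n → ℝ}
    (hQ : ContDiffAt ℝ 2 Q (γ 0)) (hT : ∀ A, Q (fun i j => A j i) = Q A) (hγ : ContDiffAt ℝ 2 γ 0)
    (h0 : ∀ i j, γ 0 i j = γ 0 j i) (h1 : ∀ i j, deriv γ 0 i j = deriv γ 0 j i)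
    (hsup : ∀ᶠ A in nhds (γ 0), (∀ i j, A i j = A j i) →
      Q A ≤ Q (γ 0) + ∑ i, p i * (A i i - γ 0 i i)) :
    deriv (fun s => Q (γ s)) 0 = ∑ i, p i * deriv γ 0 i i ∧
      deriv (deriv fun s => Q (γ s)) 0 ≤ ∑ i, p i * deriv (deriv γ) 0 i i := by
  set U := γ 0 with hU
  set V := deriv γ 0 with hV
  set B := deriv (deriv γ) 0 with hB
  set Bt : Fin n → Fin n → ℝ := fun i j => B j i with hBt
  set B' : Fin n → Fin n → ℝ := (1 / 2 : ℝ) • (B + Bt) with hB'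
  have hB's : ∀ i j, B' i j = B' j i := by
    intro i j
    simp [hB', hBt, add_comm]
  set η : ℝ → Fin n → Fin n → ℝ := fun s => U + (s • V + (s ^ 2 / 2) • B') with hη
  have hη0 : η 0 = U := by simp [hη]
  have hηs : ∀ s i j, η s i j = η s j i := by
    intro s i j
    simp only [hη, Pi.add_apply, Pi.smul_apply]
    rw [h0 i j, h1 i j, hB's i j]
  have hη1 : deriv η = fun s => V + s • B' := by
    ext1 s
    refine HasDerivAt.deriv ?_
    have a1 := (hasDerivAt_id s).smul_const V
    have a2 := (((hasDerivAt_id s).pow 2).div_const 2).smul_const B'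
    have := (a1.add a2).const_add U
    convert! this using 1
    simp
  have hη2 : deriv (deriv η) 0 = B' := by
    rw [hη1]
    refine HasDerivAt.deriv ?_
    simpa using ((hasDerivAt_id (0 : ℝ)).smul_const B').const_add V
  have hηc : ContDiffAt ℝ 2 η 0 := by
    have : ContDiff ℝ 2 η := by rw [hη]; fun_prop
    exact this.contDiffAt
  have hη10 : deriv η 0 = V := by rw [hη1]; simp
  -- the derivative of `Q` at `U` depends only on the symmetric part of the direction
  have hsym : fderiv ℝ Q U B' = fderiv ℝ Q U B := by
    have hQd : HasFDerivAt Q (fderiv ℝ Q U) U :=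
      (hQ.differentiableAt two_ne_zero).hasFDerivAt
    have e : fderiv ℝ Q U Bt = fderiv ℝ Q U B := by
      have l1 : HasDerivAt (fun s : ℝ => U + s • B) B 0 := by
        simpa using HasDerivAt.const_add U ((hasDerivAt_id (0 : ℝ)).smul_const B)
      have l2 : HasDerivAt (fun s : ℝ => U + s • Bt) Bt 0 := by
        simpa using ((hasDerivAt_id (0 : ℝ)).smul_const Bt).const_add U
      have d1 := HasFDerivAt.comp_hasDerivAt (x := (0 : ℝ)) (l := Q) (l' := fderiv ℝ Q U)
        (by simpa using hQd) l1
      have d2 := HasFDerivAt.comp_hasDerivAt (x := (0 : ℝ)) (l := Q) (l' := fderiv ℝ Q U)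
        (by simpa using hQd) l2
      refine d2.unique ?_
      convert! d1 using 1
      ext s
      have : U + s • Bt = fun i j => (U + s • B) j i := by
        ext i j
        simp [hBt, h0 i j]
      simp only [Function.comp_apply]
      rw [this, hT]
    rw [hB', map_smul, map_add, e, smul_eq_mul]; ring
  have d1γ := deriv_comp_curve (γ := γ) (s := 0) (hQ.differentiableAt two_ne_zero)
    (hγ.differentiableAt two_ne_zero)
  have d2γ := deriv_deriv_comp_curve (γ := γ) (s := 0) hQ hγ
  have hQη : ContDiffAt ℝ 2 Q (η 0) := by rw [hη0]; exact hQ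
  have d1η := deriv_comp_curve (γ := η) (s := 0) (hQη.differentiableAt two_ne_zero)
    (hηc.differentiableAt two_ne_zero)
  have d2η := deriv_deriv_comp_curve (γ := η) (s := 0) hQη hηc
  rw [hη0, hη10] at d1η d2η
  rw [hη2, hsym] at d2η
  rw [← hU, ← hV] at d1γ d2γ
  rw [← hB] at d2γ
  rw [d1γ, d2γ, ← d1η, ← d2η]
  -- compare `Q` with its bound along the symmetric curve `η`
  set b : ℝ → ℝ := fun s => ∑ i, p i * (s * V i i + s ^ 2 / 2 * B i i) with hb
  have hdiag : ∀ i, B' i i = B i i := by intro i; simp [hB', hBt]; ring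
  have hmax : IsLocalMax (fun s => Q (η s) - b s) 0 := by
    have hc : Filter.Tendsto η (nhds 0) (nhds U) := by
      have := hηc.continuousAt
      rwa [ContinuousAt, hη0] at this
    filter_upwards [hc.eventually hsup] with s hs
    have := hs (hηs s)
    have e0 : b 0 = 0 := by simp [hb]
    rw [hη0, e0, sub_zero]
    have e1 : ∑ i, p i * (η s i i - U i i) = b s := by
      refine Finset.sum_congr rfl fun i _ => ?_
      simp only [hη, Pi.add_apply, Pi.smul_apply, smul_eq_mul, hdiag]
      ring
    linarith
  have hbd : deriv b = fun s => ∑ i, p i * (V i i + s * B i i) := by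
    ext1 s
    refine HasDerivAt.deriv (HasDerivAt.fun_sum fun i _ => HasDerivAt.const_mul _ ?_)
    have a1 := (hasDerivAt_id s).mul_const (V i i)
    have a2 := (((hasDerivAt_id s).pow 2).div_const 2).mul_const (B i i)
    convert! a1.add a2 using 1
    simp
  have hbd2 : deriv (deriv b) 0 = ∑ i, p i * B i i := by
    rw [hbd]
    refine HasDerivAt.deriv (HasDerivAt.fun_sum fun i _ => HasDerivAt.const_mul _ ?_)
    simpa using ((hasDerivAt_id (0 : ℝ)).mul_const (B i i)).const_add (V i i)
  have hbc : ContDiffAt ℝ 2 b 0 := by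
    have : ContDiff ℝ 2 b := by rw [hb]; fun_prop
    exact this.contDiffAt
  have hQc : ContDiffAt ℝ 2 (fun s => Q (η s)) 0 := hQη.comp 0 hηc
  have hd0 := hmax.deriv_eq_zero
  have hdd := deriv_deriv_nonpos_of_isLocalMax (hQc.sub hbc).continuousAt hmax
  have hfirst : deriv (fun s => Q (η s) - b s) =ᶠ[nhds 0]
      fun s => deriv (fun s => Q (η s)) s - deriv b s := by
    filter_upwards [hQc.eventually (by simp), hbc.eventually (by simp)] with s h1 h2
    exact deriv_fun_sub (h1.differentiableAt two_ne_zero) (h2.differentiableAt two_ne_zero)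
  have hb10 : deriv b 0 = ∑ i, p i * V i i := by rw [hbd]; simp
  rw [hfirst.eq_of_nhds, hb10] at hd0
  rw [hfirst.deriv_eq, deriv_fun_sub (hasDerivAt_deriv_of_contDiffAt hQc).differentiableAt
    (hasDerivAt_deriv_of_contDiffAt hbc).differentiableAt, hbd2] at hdd
  exact ⟨by linarith, by linarith⟩

end MatrixSymmetric

/-! ### Partial derivatives of scalar and matrix functions on `ℝⁿ` -/

section PartialDerivatives

/-- Euclidean coordinate space. -/
abbrev Euc (n : ℕ) := EuclideanSpace ℝ (Fin n)

variable {n : ℕ}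

theorem pd_congr {f f' : Euc n → ℝ} {y : Euc n} (h : f =ᶠ[nhds y] f') (i : Fin n) :
    pd i f y = pd i f' y := by
  rw [pd, pd, h.fderiv_eq]

theorem pd_eventuallyEq {f f' : Euc n → ℝ} {y : Euc n} (h : f =ᶠ[nhds y] f') (i : Fin n) :
    pd i f =ᶠ[nhds y] pd i f' := by
  filter_upwards [h.fderiv (𝕜 := ℝ)] with z hz
  rw [pd, pd, hz]

theorem pd_add {f f' : Euc n → ℝ} {y : Euc n} (hf : DifferentiableAt ℝ f y)
    (hf' : DifferentiableAt ℝ f' y) (i : Fin n) :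
    pd i (fun z => f z + f' z) y = pd i f y + pd i f' y := by
  simp [pd, fderiv_fun_add hf hf']

theorem pd_sub {f f' : Euc n → ℝ} {y : Euc n} (hf : DifferentiableAt ℝ f y)
    (hf' : DifferentiableAt ℝ f' y) (i : Fin n) :
    pd i (fun z => f z - f' z) y = pd i f y - pd i f' y := by
  simp [pd, fderiv_fun_sub hf hf']

theorem pd_mul {f f' : Euc n → ℝ} {y : Euc n} (hf : DifferentiableAt ℝ f y)
    (hf' : DifferentiableAt ℝ f' y) (i : Fin n) :
    pd i (fun z => f z * f' z) y = pd i f y * f' y + f y * pd i f' y := by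
  simp only [pd, fderiv_fun_mul hf hf', add_apply,
    smul_apply, smul_eq_mul]
  ring

@[simp] theorem pd_const (c : ℝ) (y : Euc n) (i : Fin n) : pd i (fun _ => c) y = 0 := by
  simp [pd]

theorem pd_const_mul {f : Euc n → ℝ} {y : Euc n} (hf : DifferentiableAt ℝ f y) (c : ℝ) (i : Fin n) :
    pd i (fun z => c * f z) y = c * pd i f y := by
  simp [pd, fderiv_const_mul hf]

theorem pd_sum {κ : Type*} {s : Finset κ} {f : κ → Euc n → ℝ} {y : Euc n}
    (hf : ∀ a ∈ s, DifferentiableAt ℝ (f a) y) (i : Fin n) :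
    pd i (fun z => ∑ a ∈ s, f a z) y = ∑ a ∈ s, pd i (f a) y := by
  simp only [pd, fderiv_fun_sum hf, sum_apply]

theorem pd_sum_mul {κ : Type*} {s : Finset κ} {f f' : κ → Euc n → ℝ} {y : Euc n}
    (hf : ∀ a ∈ s, DifferentiableAt ℝ (f a) y) (hf' : ∀ a ∈ s, DifferentiableAt ℝ (f' a) y)
    (i : Fin n) : pd i (fun z => ∑ a ∈ s, f a z * f' a z) y
      = ∑ a ∈ s, (pd i (f a) y * f' a y + f a y * pd i (f' a) y) := by
  rw [pd_sum (f := fun a z => f a z * f' a z) fun a ha => (hf a ha).mul (hf' a ha)]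
  exact Finset.sum_congr rfl fun a ha => pd_mul (hf a ha) (hf' a ha) i

theorem contDiffAt_pd {f : Euc n → ℝ} {y : Euc n} {m m' : WithTop ℕ∞} (hf : ContDiffAt ℝ m f y)
    (h : m' + 1 ≤ m) (i : Fin n) : ContDiffAt ℝ m' (pd i f) y :=
  (hf.fderiv_right h).clm_apply contDiffAt_const

theorem pd_comm {f : Euc n → ℝ} {y : Euc n} (hf : ContDiffAt ℝ 2 f y) (i j : Fin n) :
    pd i (pd j f) y = pd j (pd i f) y := by
  have hd : DifferentiableAt ℝ (fderiv ℝ f) y :=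
    (hf.fderiv_right (m := 1) (by norm_num)).differentiableAt one_ne_zero
  have e : ∀ a b : Fin n, pd a (pd b f) y
      = fderiv ℝ (fderiv ℝ f) y (EuclideanSpace.single a 1) (EuclideanSpace.single b 1) := by
    intro a b
    have : pd b f = fun z => fderiv ℝ f z (EuclideanSpace.single b 1) := rfl
    rw [pd, this, fderiv_clm_apply hd (by fun_prop)]
    simp
  rw [e, e]
  exact (hf.isSymmSndFDerivAt (by simp)).eq _ _

theorem pd_eq_fderiv {F : Type*} [NormedAddCommGroup F] [NormedSpace ℝ F] (f : Euc n → F)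
    (L : F →L[ℝ] ℝ) {y : Euc n} (hf : DifferentiableAt ℝ f y) (i : Fin n) :
    pd i (fun z => L (f z)) y = L (fderiv ℝ f y (EuclideanSpace.single i 1)) := by
  have : HasFDerivAt (fun z => L (f z)) (L.comp (fderiv ℝ f y)) y :=
    L.hasFDerivAt.comp y hf.hasFDerivAt
  rw [pd, this.fderiv]; rfl

theorem contDiffAt_coord {f : Euc n → Euc n} {y : Euc n} {m : WithTop ℕ∞} (hf : ContDiffAt ℝ m f y)
    (i : Fin n) : ContDiffAt ℝ m (fun z => f z i) y :=
  (contDiffAt_piLp 2).1 hf i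

theorem fderiv_eq_sum_pd (f : Euc n → ℝ) (y v : Euc n) : fderiv ℝ f y v = ∑ i, v i * pd i f y := by
  conv_lhs => rw [← (EuclideanSpace.basisFun (Fin n) ℝ).sum_repr v, map_sum]
  simp [pd]

theorem pd_comp {f : Euc n → ℝ} {ψ : Euc n → Euc n} {z : Euc n} (hf : DifferentiableAt ℝ f (ψ z))
    (hψ : DifferentiableAt ℝ ψ z) (a : Fin n) :
    pd a (fun x => f (ψ x)) z = ∑ i, pd a (fun x => ψ x i) z * pd i f (ψ z) := by
  have h : HasFDerivAt (fun x => f (ψ x)) ((fderiv ℝ f (ψ z)).comp (fderiv ℝ ψ z)) z :=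
    hf.hasFDerivAt.comp z hψ.hasFDerivAt
  rw [pd, h.fderiv, ContinuousLinearMap.comp_apply, fderiv_eq_sum_pd]
  refine Finset.sum_congr rfl fun i _ => ?_
  congr 1
  exact (pd_eq_fderiv ψ (EuclideanSpace.proj i) hψ a).symm

theorem hasDerivAt_line {f : Euc n → ℝ} {a : Fin n} {s : ℝ}
    (hf : DifferentiableAt ℝ f (s • EuclideanSpace.single a 1)) :
    HasDerivAt (fun s : ℝ => f (s • EuclideanSpace.single a 1))
      (pd a f (s • EuclideanSpace.single a 1)) s := by
  have h := hf.hasFDerivAt.comp_hasDerivAt s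
    ((hasDerivAt_id s).smul_const (EuclideanSpace.single a (1 : ℝ)))
  simp only [id, one_smul] at h
  exact h

/-- Entrywise differentiability of a matrix-valued function. -/
def ContDiffMat (m : WithTop ℕ∞) (F : Euc n → Matrix (Fin n) (Fin n) ℝ) (y : Euc n) : Prop :=
  ∀ i j, ContDiffAt ℝ m (fun z => F z i j) y

/-- The entrywise partial derivative of a matrix-valued function. -/
def pdMat (a : Fin n) (F : Euc n → Matrix (Fin n) (Fin n) ℝ) (y : Euc n) :
    Matrix (Fin n) (Fin n) ℝ :=
  Matrix.of fun i j => pd a (fun z => F z i j) y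

variable {F F' : Euc n → Matrix (Fin n) (Fin n) ℝ} {y : Euc n} {m : WithTop ℕ∞}

theorem ContDiffMat.diff (h : ContDiffMat m F y) (hm : 1 ≤ m) (i j : Fin n) :
    DifferentiableAt ℝ (fun z => F z i j) y :=
  (h i j).differentiableAt (by rintro rfl; simp at hm)

theorem ContDiffMat.of_le {m' : WithTop ℕ∞} (h : ContDiffMat m F y) (hm : m' ≤ m) :
    ContDiffMat m' F y := fun i j => (h i j).of_le hm

theorem ContDiffMat.eventually (h : ContDiffMat m F y) (hm : m ≠ (∞ : WithTop ℕ∞)) :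
    ∀ᶠ z in nhds y, ContDiffMat m F z := by
  have : ∀ i j, ∀ᶠ z in nhds y, ContDiffAt ℝ m (fun z => F z i j) z :=
    fun i j => (h i j).eventually hm
  simpa [ContDiffMat, Filter.eventually_all] using this

theorem ContDiffMat.congr (h : ContDiffMat m F y) (he : F' =ᶠ[nhds y] F) : ContDiffMat m F' y :=
  fun i j => (h i j).congr_of_eventuallyEq (he.mono fun z hz => by simp only [hz])

theorem ContDiffMat.mul (h : ContDiffMat m F y) (h' : ContDiffMat m F' y) :
    ContDiffMat m (fun z => F z * F' z) y := fun i j => by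
  simp only [Matrix.mul_apply]
  exact ContDiffAt.sum fun k _ => (h i k).mul (h' k j)

theorem ContDiffMat.transpose (h : ContDiffMat m F y) :
    ContDiffMat m (fun z => (F z).transpose) y := fun i j => h j i

theorem contDiffAt_det {X : Type*} [NormedAddCommGroup X] [NormedSpace ℝ X]
    {F : X → Matrix (Fin n) (Fin n) ℝ} {y : X} (h : ∀ i j, ContDiffAt ℝ m (fun z => F z i j) y) :
    ContDiffAt ℝ m (fun z => (F z).det) y := by
  simp only [Matrix.det_apply]
  refine ContDiffAt.sum fun σ _ => ContDiffAt.const_smul _ ?_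
  exact contDiffAt_prod fun i _ => h _ _

theorem contDiffAt_inv_apply {X : Type*} [NormedAddCommGroup X] [NormedSpace ℝ X]
    {F : X → Matrix (Fin n) (Fin n) ℝ} {y : X} (h : ∀ i j, ContDiffAt ℝ m (fun z => F z i j) y)
    (hd : (F y).det ≠ 0) (i j : Fin n) : ContDiffAt ℝ m (fun z => (F z)⁻¹ i j) y := by
  have hdet := contDiffAt_det h
  have e : (fun z => (F z)⁻¹ i j) = fun z => ((F z).det)⁻¹ * (F z).adjugate i j := by
    ext z
    rw [Matrix.inv_def, Ring.inverse_eq_inv', Matrix.smul_apply, smul_eq_mul]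
  rw [e]
  refine (hdet.inv hd).mul ?_
  simp only [Matrix.adjugate_apply]
  refine contDiffAt_det fun a b => ?_
  by_cases hab : a = j
  · subst hab; simp only [Matrix.updateRow_self]; exact contDiffAt_const
  · simp only [Matrix.updateRow_ne hab]; exact h a b

theorem ContDiffMat.inv (h : ContDiffMat m F y) (hd : (F y).det ≠ 0) :
    ContDiffMat m (fun z => (F z)⁻¹) y := contDiffAt_inv_apply h hd

theorem ContDiffMat.det_ne_zero (h : ContDiffMat m F y) (hd : (F y).det ≠ 0) :
    ∀ᶠ z in nhds y, (F z).det ≠ 0 :=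
  (contDiffAt_det h).continuousAt.eventually_ne hd

theorem contDiffMat_pdMat {m' : WithTop ℕ∞} (h : ContDiffMat m F y) (hm : m' + 1 ≤ m) (a : Fin n) :
    ContDiffMat m' (pdMat a F) y := fun i j => contDiffAt_pd (h i j) hm a

theorem pdMat_congr (h : F =ᶠ[nhds y] F') (a : Fin n) : pdMat a F y = pdMat a F' y := by
  ext i j
  exact pd_congr (h.mono fun z hz => congrFun (congrFun hz i) j) a

theorem pdMat_mul (h : ContDiffMat 1 F y) (h' : ContDiffMat 1 F' y) (a : Fin n) :
    pdMat a (fun z => F z * F' z) y = pdMat a F y * F' y + F y * pdMat a F' y := by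
  ext i j
  simp only [pdMat, Matrix.of_apply, Matrix.add_apply, Matrix.mul_apply]
  rw [pd_sum_mul (f := fun k z => F z i k) (f' := fun k z => F' z k j)
    (fun k _ => h.diff le_rfl i k) (fun k _ => h'.diff le_rfl k j), ← Finset.sum_add_distrib]

theorem pdMat_add (h : ContDiffMat 1 F y) (h' : ContDiffMat 1 F' y) (a : Fin n) :
    pdMat a (fun z => F z + F' z) y = pdMat a F y + pdMat a F' y := by
  ext i j
  exact pd_add (h.diff le_rfl i j) (h'.diff le_rfl i j) a

theorem pdMat_transpose (F : Euc n → Matrix (Fin n) (Fin n) ℝ) (y : Euc n) (a : Fin n) :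
    pdMat a (fun z => (F z).transpose) y = (pdMat a F y).transpose := rfl

theorem pdMat_comm (h : ContDiffMat 2 F y) (a b : Fin n) :
    pdMat a (pdMat b F) y = pdMat b (pdMat a F) y := by
  ext i j
  exact pd_comm (h i j) a b

end PartialDerivatives

/-! ### The Levi-Civita connection and curvature of a metric on a domain of `ℝⁿ` -/

section LocalGeometry

variable {n : ℕ}

/-- The Christoffel symbols of a field `G` of metric coefficients on `ℝⁿ`. -/
def lchr (G : Euc n → Matrix (Fin n) (Fin n) ℝ) (k i j : Fin n) (y : Euc n) : ℝ :=
  (1 / 2) * ∑ l, (G y)⁻¹ k l *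
    (pd i (fun z => G z j l) y + pd j (fun z => G z i l) y - pd l (fun z => G z i j) y)

/-- The Ricci tensor of a field `G` of metric coefficients on `ℝⁿ`. -/
def lric (G : Euc n → Matrix (Fin n) (Fin n) ℝ) (y : Euc n) : Matrix (Fin n) (Fin n) ℝ :=
  Matrix.of fun i j =>
    (∑ k, (pd k (lchr G k i j) y - pd j (lchr G k i k) y))
      + ∑ k, ∑ l, (lchr G k k l y * lchr G l i j y - lchr G k j l y * lchr G l i k y)

/-- The covariant Hessian of a function on `ℝⁿ` for the metric `G`. -/
def lhess (G : Euc n → Matrix (Fin n) (Fin n) ℝ) (w : Euc n → ℝ) (y : Euc n) :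
    Matrix (Fin n) (Fin n) ℝ :=
  Matrix.of fun i j => pd i (pd j w) y - ∑ k, lchr G k i j y * pd k w y

/-- The connection matrices `(Γ_c)^k_a` of the metric `G`. -/
def connMat (G : Euc n → Matrix (Fin n) (Fin n) ℝ) (c : Fin n) (y : Euc n) :
    Matrix (Fin n) (Fin n) ℝ :=
  Matrix.of fun k a => lchr G k c a y

/-- The curvature endomorphisms `∂_a Γ_b - ∂_b Γ_a + [Γ_a, Γ_b]` of the metric `G`. -/
def curvMat (G : Euc n → Matrix (Fin n) (Fin n) ℝ) (a b : Fin n) (y : Euc n) :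
    Matrix (Fin n) (Fin n) ℝ :=
  pdMat a (connMat G b) y - pdMat b (connMat G a) y
    + (connMat G a y * connMat G b y - connMat G b y * connMat G a y)

/-- The Jacobian matrix of a map of `ℝⁿ`. -/
def jac (ψ : Euc n → Euc n) (z : Euc n) : Matrix (Fin n) (Fin n) ℝ :=
  Matrix.of fun k a => pd a (fun x => ψ x k) z

variable {G : Euc n → Matrix (Fin n) (Fin n) ℝ} {y : Euc n}

theorem lchr_symm (hs : ∀ᶠ z in nhds y, (G z).IsSymm) (k i j : Fin n) :
    lchr G k i j y = lchr G k j i y := by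
  have : ∀ l, pd l (fun z => G z i j) y = pd l (fun z => G z j i) y := fun l =>
    pd_congr (hs.mono fun z hz => (hz.apply i j).symm) l
  simp only [lchr, this]
  congr 1
  exact Finset.sum_congr rfl fun l _ => by ring

theorem contDiffAt_lchr {m m' : WithTop ℕ∞} (hG : ContDiffMat m G y) (hd : (G y).det ≠ 0)
    (hm : m' + 1 ≤ m) (k i j : Fin n) : ContDiffAt ℝ m' (lchr G k i j) y := by
  have hle : m' ≤ m := le_trans (by simp) hm
  refine contDiffAt_const.mul (ContDiffAt.sum fun l _ => ?_)
  refine ((hG.of_le hle).inv hd k l).mul ?_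
  exact ((contDiffAt_pd (hG _ _) hm _).add (contDiffAt_pd (hG _ _) hm _)).sub
    (contDiffAt_pd (hG _ _) hm _)

theorem contDiffMat_connMat {m m' : WithTop ℕ∞} (hG : ContDiffMat m G y) (hd : (G y).det ≠ 0)
    (hm : m' + 1 ≤ m) (c : Fin n) : ContDiffMat m' (connMat G c) y :=
  fun k a => contDiffAt_lchr hG hd hm k c a

/-- Koszul: a torsion-free metric connection is the Levi-Civita connection. -/
theorem eq_connMat (hs : ∀ᶠ z in nhds y, (G z).IsSymm) (hd : (G y).det ≠ 0)
    {Θ : Fin n → Matrix (Fin n) (Fin n) ℝ} (ht : ∀ c k a, Θ c k a = Θ a k c)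
    (hc : ∀ c, pdMat c G y = (Θ c).transpose * G y + G y * Θ c) (c : Fin n) :
    Θ c = connMat G c y := by
  have hsy := hs.self_of_nhds
  set T : Fin n → Fin n → Fin n → ℝ := fun l i j => (G y * Θ i) l j with hT
  have hTs : ∀ l i j, T l i j = T l j i := by
    intro l i j
    simp only [hT, Matrix.mul_apply]
    exact Finset.sum_congr rfl fun k _ => by rw [ht i k j]
  have hpd : ∀ c a b, pd c (fun z => G z a b) y = T b c a + T a c b := by
    intro c a b
    have h1 := congrFun (congrFun (hc c) a) b
    rw [Matrix.add_apply] at h1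
    have h2 : ((Θ c).transpose * G y) a b = T b c a := by
      have : (Θ c).transpose * G y = (G y * Θ c).transpose := by
        rw [Matrix.transpose_mul, hsy.eq]
      rw [this]; rfl
    rw [h2] at h1
    exact h1
  ext k a
  have e : ∀ l, pd c (fun z => G z a l) y + pd a (fun z => G z c l) y - pd l (fun z => G z c a) y
      = 2 * (G y * Θ c) l a := by
    intro l
    have e2 : (G y * Θ c) l a = T l c a := rfl
    rw [hpd, hpd, hpd, e2, hTs l a c, hTs a l c, hTs c l a]; ring
  have e3 : lchr G k c a y = ∑ l, (G y)⁻¹ k l * (G y * Θ c) l a := by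
    simp only [lchr, e, Finset.mul_sum]
    exact Finset.sum_congr rfl fun l _ => by ring
  rw [connMat, Matrix.of_apply, e3, ← Matrix.mul_apply, ← Matrix.mul_assoc,
    Matrix.nonsing_inv_mul _ (isUnit_iff_ne_zero.2 hd), Matrix.one_mul]

/-- The Levi-Civita connection is metric. -/
theorem pdMat_metric (hs : ∀ᶠ z in nhds y, (G z).IsSymm) (hd : (G y).det ≠ 0) (c : Fin n) :
    pdMat c G y = (connMat G c y).transpose * G y + G y * connMat G c y := by
  have hsy := hs.self_of_nhds
  have hT : ∀ c l a, (G y * connMat G c y) l a = 1 / 2 * (pd c (fun z => G z a l) y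
      + pd a (fun z => G z c l) y - pd l (fun z => G z c a) y) := by
    intro c l a
    have e : connMat G c y = (1 / 2 : ℝ) • ((G y)⁻¹ * Matrix.of fun l a =>
        (pd c (fun z => G z a l) y + pd a (fun z => G z c l) y - pd l (fun z => G z c a) y)) := by
      ext k b
      simp [connMat, lchr, Matrix.mul_apply]
    rw [e, Matrix.mul_smul, ← Matrix.mul_assoc, Matrix.mul_nonsing_inv _ (isUnit_iff_ne_zero.2 hd),
      Matrix.one_mul]
    rfl
  have hsym : ∀ l i j, pd l (fun z => G z i j) y = pd l (fun z => G z j i) y := fun l i j =>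
    pd_congr (hs.mono fun z hz => (hz.apply i j).symm) l
  ext a b
  have h2 : ((connMat G c y).transpose * G y) a b = (G y * connMat G c y) b a := by
    have : (connMat G c y).transpose * G y = (G y * connMat G c y).transpose := by
      rw [Matrix.transpose_mul, hsy.eq]
    rw [this]; rfl
  rw [Matrix.add_apply, h2, hT, hT, pdMat, Matrix.of_apply, hsym c b a, hsym a c b, hsym b c a]
  ring

theorem lric_eq_curvMat (hs : ∀ᶠ z in nhds y, (G z).IsSymm) (i j : Fin n) :
    lric G y i j = ∑ k, curvMat G k j y k i := by
  have hsy : ∀ k i j, lchr G k i j y = lchr G k j i y := lchr_symm hs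
  have hse : ∀ k i j, lchr G k i j =ᶠ[nhds y] lchr G k j i := fun k i j =>
    (eventually_eventually_nhds.2 hs).mono fun z hz => lchr_symm hz k i j
  simp only [lric, Matrix.of_apply, curvMat, Matrix.add_apply, Matrix.sub_apply, pdMat, connMat,
    Matrix.mul_apply]
  rw [← Finset.sum_add_distrib]
  refine Finset.sum_congr rfl fun k _ => ?_
  rw [pd_congr (hse k i j) k, pd_congr (hse k i k) j, Finset.sum_sub_distrib]
  congr 1
  congr 1
  · exact Finset.sum_congr rfl fun l _ => by rw [hsy l i j]
  · exact Finset.sum_congr rfl fun l _ => by rw [hsy l i k]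

/-! ### Change of coordinates -/

variable {G' : Euc n → Matrix (Fin n) (Fin n) ℝ} {ψ : Euc n → Euc n} {z : Euc n}

theorem contDiffMat_jac {m m' : WithTop ℕ∞} (hψ : ContDiffAt ℝ m ψ z) (hm : m' + 1 ≤ m) :
    ContDiffMat m' (jac ψ) z := fun k a => contDiffAt_pd (contDiffAt_coord hψ k) hm a

theorem pdMat_jac_symm (hψ : ContDiffAt ℝ 2 ψ z) (c k a : Fin n) :
    pdMat c (jac ψ) z k a = pdMat a (jac ψ) z k c :=
  pd_comm (contDiffAt_coord hψ k) c a

theorem ContDiffMat.comp {m : WithTop ℕ∞} (hG : ContDiffMat m G (ψ z)) (hψ : ContDiffAt ℝ m ψ z) :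
    ContDiffMat m (fun x => G (ψ x)) z := fun i j => (hG i j).comp z hψ

theorem pdMat_comp (hG : ContDiffMat 1 G (ψ z)) (hψ : ContDiffAt ℝ 1 ψ z) (c : Fin n) :
    pdMat c (fun x => G (ψ x)) z = ∑ i, jac ψ z i c • pdMat i G (ψ z) := by
  ext a b
  simp only [Matrix.sum_apply, Matrix.smul_apply, smul_eq_mul]
  exact pd_comp (hG.diff le_rfl a b) (hψ.differentiableAt one_ne_zero) c

/-- The pull-back of the connection matrices of `G` under `ψ`. -/
def connPull (G : Euc n → Matrix (Fin n) (Fin n) ℝ) (ψ : Euc n → Euc n) (c : Fin n) (z : Euc n) :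
    Matrix (Fin n) (Fin n) ℝ := ∑ i, jac ψ z i c • connMat G i (ψ z)

/-- The transformation law of the Christoffel symbols. -/
theorem jac_mul_connMat (hψ : ContDiffAt ℝ 2 ψ z) (hG : ContDiffMat 1 G (ψ z))
    (hs : ∀ᶠ x in nhds (ψ z), (G x).IsSymm) (hd : (G (ψ z)).det ≠ 0) (hJ : (jac ψ z).det ≠ 0)
    (hG' : ∀ᶠ x in nhds z, G' x = (jac ψ x).transpose * G (ψ x) * jac ψ x) (c : Fin n) :
    jac ψ z * connMat G' c z = pdMat c (jac ψ) z + connPull G ψ c z * jac ψ z := by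
  have hJu : IsUnit (jac ψ z).det := isUnit_iff_ne_zero.2 hJ
  have hs' : ∀ᶠ x in nhds z, (G' x).IsSymm := by
    filter_upwards [hG', hψ.continuousAt.eventually hs] with x h1 h2
    rw [h1, Matrix.IsSymm, Matrix.transpose_mul, Matrix.transpose_mul, Matrix.transpose_transpose,
      h2.eq, Matrix.mul_assoc]
  have hd' : (G' z).det ≠ 0 := by
    rw [hG'.self_of_nhds, Matrix.det_mul, Matrix.det_mul, Matrix.det_transpose]
    exact mul_ne_zero (mul_ne_zero hJ hd) hJ
  set Θ : Fin n → Matrix (Fin n) (Fin n) ℝ := fun c =>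
    (jac ψ z)⁻¹ * (pdMat c (jac ψ) z + connPull G ψ c z * jac ψ z) with hΘ
  have hJΘ : ∀ c, jac ψ z * Θ c = pdMat c (jac ψ) z + connPull G ψ c z * jac ψ z := by
    intro c
    rw [hΘ, ← Matrix.mul_assoc, Matrix.mul_nonsing_inv _ hJu, Matrix.one_mul]
  have ht : ∀ c k a, Θ c k a = Θ a k c := by
    intro c k a
    simp only [hΘ, Matrix.mul_apply, Matrix.add_apply]
    refine Finset.sum_congr rfl fun l _ => ?_
    rw [pdMat_jac_symm hψ c l a]
    congr 2
    simp only [connPull, Matrix.sum_apply, Matrix.smul_apply, smul_eq_mul, Finset.sum_mul]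
    rw [Finset.sum_comm]
    refine Finset.sum_congr rfl fun i _ => Finset.sum_congr rfl fun j _ => ?_
    have : connMat G j (ψ z) l i = connMat G i (ψ z) l j := lchr_symm hs l j i
    rw [this]; ring
  have hc : ∀ c, pdMat c G' z = (Θ c).transpose * G' z + G' z * Θ c := by
    intro c
    have hJ1 : ContDiffMat 1 (jac ψ) z := contDiffMat_jac hψ (by norm_num)
    have hGc : ContDiffMat 1 (fun x => G (ψ x)) z := hG.comp (hψ.of_le (by norm_num))
    rw [pdMat_congr hG', pdMat_mul (hJ1.transpose.mul hGc) hJ1, pdMat_mul hJ1.transpose hGc,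
      pdMat_transpose, pdMat_comp hG (hψ.of_le (by norm_num))]
    have e1 : ∑ i, jac ψ z i c • pdMat i G (ψ z)
        = (connPull G ψ c z).transpose * G (ψ z) + G (ψ z) * connPull G ψ c z := by
      simp only [connPull, Matrix.transpose_sum, Matrix.transpose_smul, Matrix.sum_mul,
        Matrix.mul_sum, Matrix.smul_mul, Matrix.mul_smul]
      rw [← Finset.sum_add_distrib]
      refine Finset.sum_congr rfl fun i _ => ?_
      rw [pdMat_metric hs hd, smul_add]
    have e2 : (Θ c).transpose * G' z = (jac ψ z * Θ c).transpose * (G (ψ z) * jac ψ z) := by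
      rw [hG'.self_of_nhds, Matrix.transpose_mul (jac ψ z) (Θ c), Matrix.mul_assoc,
        Matrix.mul_assoc]
    have e3 : G' z * Θ c = (jac ψ z).transpose * G (ψ z) * (jac ψ z * Θ c) := by
      rw [hG'.self_of_nhds, Matrix.mul_assoc]
    rw [e1, e2, e3, hJΘ, Matrix.transpose_add, Matrix.transpose_mul]
    noncomm_ring
  rw [← eq_connMat hs' hd' ht hc c, hJΘ]

/-- The curvature transforms tensorially: differentiating the transformation law of the connection
and antisymmetrizing, the second derivatives of the Jacobian drop out. -/
theorem jac_mul_curvMat (hψ : ContDiffAt ℝ 3 ψ z) (hG : ContDiffMat 2 G (ψ z))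
    (hs : ∀ᶠ x in nhds (ψ z), (G x).IsSymm) (hd : (G (ψ z)).det ≠ 0) (hJ : (jac ψ z).det ≠ 0)
    (hG' : ∀ᶠ x in nhds z, G' x = (jac ψ x).transpose * G (ψ x) * jac ψ x) (a b : Fin n) :
    jac ψ z * curvMat G' a b z
      = (∑ i, ∑ j, (jac ψ z i a * jac ψ z j b) • curvMat G i j (ψ z)) * jac ψ z := by
  have hψ2 : ContDiffAt ℝ 2 ψ z := hψ.of_le (by norm_num)
  have hψ1 : ContDiffAt ℝ 1 ψ z := hψ.of_le (by norm_num)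
  have hG1 : ContDiffMat 1 G (ψ z) := hG.of_le (by norm_num)
  have hJ2 : ContDiffMat 2 (jac ψ) z := contDiffMat_jac hψ (by norm_num)
  have hJ1 : ContDiffMat 1 (jac ψ) z := hJ2.of_le (by norm_num)
  have hG'2 : ContDiffMat 2 G' z :=
    ((hJ2.transpose.mul (hG.comp hψ2)).mul hJ2).congr hG'
  have hd' : (G' z).det ≠ 0 := by
    rw [hG'.self_of_nhds, Matrix.det_mul, Matrix.det_mul, Matrix.det_transpose]
    exact mul_ne_zero (mul_ne_zero hJ hd) hJ
  have hΓ' : ∀ c, ContDiffMat 1 (connMat G' c) z := contDiffMat_connMat hG'2 hd' (by norm_num)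
  have hΓ : ∀ c, ContDiffMat 1 (connMat G c) (ψ z) := contDiffMat_connMat hG hd (by norm_num)
  have hΓψ : ∀ c, ContDiffMat 1 (fun x => connMat G c (ψ x)) z := fun c => (hΓ c).comp hψ1
  have hP : ∀ c, ContDiffMat 1 (connPull G ψ c) z := by
    intro c k l
    simp only [connPull, Matrix.sum_apply, Matrix.smul_apply, smul_eq_mul]
    exact ContDiffAt.sum fun i _ => (hJ1 i c).mul (hΓψ i k l)
  have hlaw : ∀ c, (fun x => jac ψ x * connMat G' c x) =ᶠ[nhds z]
      fun x => pdMat c (jac ψ) x + connPull G ψ c x * jac ψ x := by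
    intro c
    filter_upwards [eventually_eventually_nhds.2 hG', hψ2.eventually (by simp),
      hψ.continuousAt.eventually (hG1.eventually (by simp)),
      hψ.continuousAt.eventually (eventually_eventually_nhds.2 hs),
      hψ.continuousAt.eventually (hG1.det_ne_zero hd), hJ1.det_ne_zero hJ]
      with x h1 h2 h3 h4 h5 h6
    exact jac_mul_connMat h2 h3 h4 h5 h6 h1 c
  have hpt : ∀ c, pdMat c (jac ψ) z = jac ψ z * connMat G' c z - connPull G ψ c z * jac ψ z :=
    fun c => eq_sub_of_add_eq (hlaw c).self_of_nhds.symm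
  have hder : ∀ a b, pdMat a (jac ψ) z * connMat G' b z + jac ψ z * pdMat a (connMat G' b) z
      = pdMat a (pdMat b (jac ψ)) z
        + (pdMat a (connPull G ψ b) z * jac ψ z + connPull G ψ b z * pdMat a (jac ψ) z) := by
    intro a b
    have := pdMat_congr (hlaw b) a
    rw [pdMat_mul hJ1 (hΓ' b), pdMat_add (contDiffMat_pdMat hJ2 (by norm_num) b)
      ((hP b).mul hJ1), pdMat_mul (hP b) hJ1] at this
    exact this
  have hpull : ∀ a b, pdMat a (connPull G ψ b) z
      = (∑ j, pdMat a (jac ψ) z j b • connMat G j (ψ z))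
        + ∑ i, ∑ j, (jac ψ z i a * jac ψ z j b) • pdMat i (connMat G j) (ψ z) := by
    intro a b
    ext k l
    have e : (fun x => connPull G ψ b x k l)
        = fun x => ∑ j, jac ψ x j b * connMat G j (ψ x) k l := by
      ext x
      simp [connPull, Matrix.sum_apply]
    simp only [Matrix.add_apply, Matrix.sum_apply, Matrix.smul_apply, smul_eq_mul]
    rw [pdMat, Matrix.of_apply, e, pd_sum_mul (f := fun j z => jac ψ z j b)
      (f' := fun j z => connMat G j (ψ z) k l) (fun j _ => hJ1.diff le_rfl j b)
      (fun j _ => (hΓψ j).diff le_rfl k l), Finset.sum_comm (γ := Fin n),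
      ← Finset.sum_add_distrib]
    refine Finset.sum_congr rfl fun j _ => ?_
    congr 1
    have := congrFun (congrFun (pdMat_comp (hΓ j) hψ1 a) k) l
    simp only [Matrix.sum_apply, Matrix.smul_apply, smul_eq_mul] at this
    have e4 : pd a (fun x => connMat G j (ψ x) k l) z
      = pdMat a (fun x => connMat G j (ψ x)) z k l := rfl
    rw [e4, this, Finset.mul_sum]
    exact Finset.sum_congr rfl fun i _ => by ring
  have hanti : pdMat a (connPull G ψ b) z - pdMat b (connPull G ψ a) z
      = ∑ i, ∑ j, (jac ψ z i a * jac ψ z j b) •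
          (pdMat i (connMat G j) (ψ z) - pdMat j (connMat G i) (ψ z)) := by
    rw [hpull, hpull]
    have e1 : ∑ j, pdMat a (jac ψ) z j b • connMat G j (ψ z)
        = ∑ j, pdMat b (jac ψ) z j a • connMat G j (ψ z) :=
      Finset.sum_congr rfl fun j _ => by rw [pdMat_jac_symm hψ2]
    have e2 : ∑ i, ∑ j, (jac ψ z i b * jac ψ z j a) • pdMat i (connMat G j) (ψ z)
        = ∑ i, ∑ j, (jac ψ z i a * jac ψ z j b) • pdMat j (connMat G i) (ψ z) := by
      rw [Finset.sum_comm]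
      exact Finset.sum_congr rfl fun i _ => Finset.sum_congr rfl fun j _ => by rw [mul_comm]
    rw [e1, e2, add_sub_add_left_eq_sub]
    simp only [smul_sub, Finset.sum_sub_distrib]
  have hcomm : connPull G ψ a z * connPull G ψ b z - connPull G ψ b z * connPull G ψ a z
      = ∑ i, ∑ j, (jac ψ z i a * jac ψ z j b) •
          (connMat G i (ψ z) * connMat G j (ψ z) - connMat G j (ψ z) * connMat G i (ψ z)) := by
    simp only [connPull, Finset.sum_mul, Finset.mul_sum, Matrix.smul_mul, Matrix.mul_smul,
      smul_smul, smul_sub, Finset.sum_sub_distrib]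
    congr 1
    · rw [Finset.sum_comm]
      exact Finset.sum_congr rfl fun i _ => Finset.sum_congr rfl fun j _ => by rw [mul_comm]
  have hR : ∑ i, ∑ j, (jac ψ z i a * jac ψ z j b) • curvMat G i j (ψ z)
      = pdMat a (connPull G ψ b) z - pdMat b (connPull G ψ a) z
        + (connPull G ψ a z * connPull G ψ b z - connPull G ψ b z * connPull G ψ a z) := by
    rw [hanti, hcomm, ← Finset.sum_add_distrib]
    refine Finset.sum_congr rfl fun i _ => ?_
    rw [← Finset.sum_add_distrib]
    exact Finset.sum_congr rfl fun j _ => by rw [← smul_add, curvMat]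
  have h1 := hder a b
  have h2 := hder b a
  rw [pdMat_comm hJ2 b a, hpt b] at h2
  rw [hpt a] at h1
  rw [hR, curvMat]
  generalize pdMat a (pdMat b (jac ψ)) z = X at *
  generalize jac ψ z = J at *
  generalize connMat G' a z = A at *
  generalize connMat G' b z = B at *
  generalize connPull G ψ a z = C at *
  generalize connPull G ψ b z = D at *
  generalize pdMat a (connMat G' b) z = P at *
  generalize pdMat b (connMat G' a) z = Q at *
  generalize pdMat a (connPull G ψ b) z = R at *
  generalize pdMat b (connPull G ψ a) z = S at *
  have h3 : J * P = X + (R * J + D * (J * A - C * J)) - (J * A - C * J) * B := by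
    rw [← h1]; simp
  have h4 : J * Q = X + (S * J + C * (J * B - D * J)) - (J * B - D * J) * A := by
    rw [← h2]; simp
  rw [Matrix.mul_add, Matrix.mul_sub, h3, h4]
  noncomm_ring

/-- The Ricci tensor transforms as a tensor. -/
theorem lric_pullback (hψ : ContDiffAt ℝ 3 ψ z) (hG : ContDiffMat 2 G (ψ z))
    (hs : ∀ᶠ x in nhds (ψ z), (G x).IsSymm) (hd : (G (ψ z)).det ≠ 0) (hJ : (jac ψ z).det ≠ 0)
    (hG' : ∀ᶠ x in nhds z, G' x = (jac ψ x).transpose * G (ψ x) * jac ψ x) :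
    lric G' z = (jac ψ z).transpose * lric G (ψ z) * jac ψ z := by
  have hJu : IsUnit (jac ψ z).det := isUnit_iff_ne_zero.2 hJ
  have hs' : ∀ᶠ x in nhds z, (G' x).IsSymm := by
    filter_upwards [hG', hψ.continuousAt.eventually hs] with x h1 h2
    rw [h1, Matrix.IsSymm, Matrix.transpose_mul, Matrix.transpose_mul, Matrix.transpose_transpose,
      h2.eq, Matrix.mul_assoc]
  have hcurv : ∀ a b, curvMat G' a b z = (jac ψ z)⁻¹ *
      ((∑ i, ∑ j, (jac ψ z i a * jac ψ z j b) • curvMat G i j (ψ z)) * jac ψ z) := by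
    intro a b
    rw [← jac_mul_curvMat hψ hG hs hd hJ hG' a b, ← Matrix.mul_assoc,
      Matrix.nonsing_inv_mul _ hJu, Matrix.one_mul]
  have hinv : ∀ i k, ∑ a, jac ψ z i a * (jac ψ z)⁻¹ a k = if i = k then 1 else 0 := by
    intro i k
    rw [← Matrix.mul_apply, Matrix.mul_nonsing_inv _ hJu, Matrix.one_apply]
  ext c b
  rw [lric_eq_curvMat hs']
  have e1 : ∀ a, curvMat G' a b z a c = ∑ k, ∑ i, ∑ j, ∑ l,
      jac ψ z i a * (jac ψ z)⁻¹ a k * (jac ψ z j b * (curvMat G i j (ψ z) k l * jac ψ z l c)) := by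
    intro a
    rw [hcurv, Matrix.mul_apply]
    refine Finset.sum_congr rfl fun k _ => ?_
    simp only [Finset.sum_mul, Matrix.sum_apply, Finset.mul_sum,
      Matrix.smul_apply, smul_eq_mul, Matrix.mul_apply]
    rw [Finset.sum_comm]
    refine Finset.sum_congr rfl fun i _ => ?_
    rw [Finset.sum_comm]
    exact Finset.sum_congr rfl fun j _ => Finset.sum_congr rfl fun l _ => by ring
  simp only [e1]
  rw [Finset.sum_comm]
  have e2 : ∀ k, ∑ a, ∑ i, ∑ j, ∑ l, jac ψ z i a * (jac ψ z)⁻¹ a k *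
      (jac ψ z j b * (curvMat G i j (ψ z) k l * jac ψ z l c))
      = ∑ j, ∑ l, jac ψ z j b * (curvMat G k j (ψ z) k l * jac ψ z l c) := by
    intro k
    rw [Finset.sum_comm]
    have : ∀ i, ∑ a, ∑ j, ∑ l, jac ψ z i a * (jac ψ z)⁻¹ a k *
        (jac ψ z j b * (curvMat G i j (ψ z) k l * jac ψ z l c))
        = (if i = k then 1 else 0) *
          ∑ j, ∑ l, jac ψ z j b * (curvMat G i j (ψ z) k l * jac ψ z l c) := by
      intro i
      rw [← hinv, Finset.sum_mul]
      simp only [Finset.mul_sum]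
    simp only [this, ite_mul, one_mul, zero_mul, Finset.sum_ite_eq', Finset.mem_univ, if_true]
  simp only [e2, Matrix.mul_apply, Matrix.transpose_apply, lric_eq_curvMat hs, Finset.sum_mul,
    Finset.mul_sum]
  rw [Finset.sum_comm]
  refine Finset.sum_congr rfl fun j _ => ?_
  rw [Finset.sum_comm]
  refine Finset.sum_congr rfl fun l _ => Finset.sum_congr rfl fun k _ => by ring

/-- The covariant Hessian transforms as a tensor: the second derivatives of the change of
coordinates cancel against the inhomogeneous term of the Christoffel symbols. -/
theorem lhess_pullback {w : Euc n → ℝ} (hw : ContDiffAt ℝ 2 w (ψ z)) (hψ : ContDiffAt ℝ 2 ψ z)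
    (hG : ContDiffMat 1 G (ψ z))
    (hs : ∀ᶠ x in nhds (ψ z), (G x).IsSymm) (hd : (G (ψ z)).det ≠ 0) (hJ : (jac ψ z).det ≠ 0)
    (hG' : ∀ᶠ x in nhds z, G' x = (jac ψ x).transpose * G (ψ x) * jac ψ x) :
    lhess G' (fun x => w (ψ x)) z = (jac ψ z).transpose * lhess G w (ψ z) * jac ψ z := by
  have hψ1 : ContDiffAt ℝ 1 ψ z := hψ.of_le (by norm_num)
  have hw1 : ContDiffAt ℝ 1 w (ψ z) := hw.of_le (by norm_num)
  have hJ1 : ContDiffMat 1 (jac ψ) z := contDiffMat_jac hψ (by norm_num)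
  have hgrad : ∀ b, pd b (fun x => w (ψ x)) =ᶠ[nhds z]
      fun x => ∑ i, jac ψ x i b * pd i w (ψ x) := by
    intro b
    filter_upwards [hψ.continuousAt.eventually (hw1.eventually (by simp)),
      hψ1.eventually (by simp)] with x h1 h2
    exact pd_comp (h1.differentiableAt one_ne_zero) (h2.differentiableAt one_ne_zero) b
  have hwi : ∀ i, ContDiffAt ℝ 1 (pd i w) (ψ z) := contDiffAt_pd hw (by norm_num)
  have hwiψ : ∀ i, DifferentiableAt ℝ (fun x => pd i w (ψ x)) z := fun i =>
    ((hwi i).comp z hψ1).differentiableAt one_ne_zero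
  ext a b
  have e1 : pd a (pd b fun x => w (ψ x)) z
      = ∑ i, pdMat a (jac ψ) z i b * pd i w (ψ z)
        + ∑ i, ∑ j, jac ψ z i b * (jac ψ z j a * pd j (pd i w) (ψ z)) := by
    rw [pd_congr (hgrad b), pd_sum_mul (f := fun i z => jac ψ z i b)
      (f' := fun i z => pd i w (ψ z)) (fun i _ => hJ1.diff le_rfl i b) (fun i _ => hwiψ i),
      ← Finset.sum_add_distrib]
    refine Finset.sum_congr rfl fun i _ => ?_
    rw [pd_comp ((hwi i).differentiableAt one_ne_zero) (hψ1.differentiableAt one_ne_zero),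
      Finset.mul_sum]
    rfl
  have e2 : ∑ k, lchr G' k a b z * pd k (fun x => w (ψ x)) z
      = ∑ i, (jac ψ z * connMat G' a z) i b * pd i w (ψ z) := by
    simp only [fun k => (hgrad k).self_of_nhds, Finset.mul_sum, Matrix.mul_apply, Finset.sum_mul]
    rw [Finset.sum_comm]
    refine Finset.sum_congr rfl fun i _ => Finset.sum_congr rfl fun k _ => ?_
    simp only [connMat, Matrix.of_apply]; ring
  have e3 : ∑ i, (connPull G ψ a z * jac ψ z) i b * pd i w (ψ z)
      = ∑ i, ∑ j, jac ψ z i b * (jac ψ z j a * ∑ k, lchr G k j i (ψ z) * pd k w (ψ z)) := by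
    simp only [connPull, Matrix.mul_apply, Matrix.sum_apply, Matrix.smul_apply, smul_eq_mul,
      Finset.sum_mul, Finset.mul_sum, connMat, Matrix.of_apply]
    rw [Finset.sum_comm]
    refine Finset.sum_congr rfl fun i _ => ?_
    rw [Finset.sum_comm]
    exact Finset.sum_congr rfl fun j _ => Finset.sum_congr rfl fun k _ => by ring
  rw [lhess, Matrix.of_apply, e1, e2, jac_mul_connMat hψ hG hs hd hJ hG' a]
  simp only [Matrix.add_apply, add_mul, Finset.sum_add_distrib]
  rw [e3, add_sub_add_left_eq_sub]
  simp only [Matrix.mul_apply, Matrix.transpose_apply, lhess, Matrix.of_apply, Finset.sum_mul]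
  rw [← Finset.sum_sub_distrib]
  refine Finset.sum_congr rfl fun i _ => ?_
  rw [← Finset.sum_sub_distrib]
  refine Finset.sum_congr rfl fun j _ => ?_
  ring

end LocalGeometry

/-! ### Second derivatives in normal coordinates -/

section NormalCoordinates

variable {n : ℕ}

/-- The second partial derivative `∂_a² f`. -/
def pd2 (a : Fin n) (f : Euc n → ℝ) (y : Euc n) : ℝ := pd a (pd a f) y

theorem pd2_congr {f f' : Euc n → ℝ} {y : Euc n} (h : f =ᶠ[nhds y] f') (a : Fin n) :
    pd2 a f y = pd2 a f' y := pd_congr (pd_eventuallyEq h a) a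

theorem contDiffAt_two_pd {f : Euc n → ℝ} {y : Euc n} (hf : ContDiffAt ℝ 2 f y) (a : Fin n) :
    DifferentiableAt ℝ (pd a f) y :=
  (contDiffAt_pd hf (m' := 1) (by norm_num) a).differentiableAt one_ne_zero

theorem eventually_differentiableAt {f : Euc n → ℝ} {y : Euc n} (hf : ContDiffAt ℝ 2 f y) :
    ∀ᶠ z in nhds y, DifferentiableAt ℝ f z :=
  (hf.eventually (by simp)).mono fun _ hz => hz.differentiableAt two_ne_zero

theorem pd2_add {f f' : Euc n → ℝ} {y : Euc n} (hf : ContDiffAt ℝ 2 f y)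
    (hf' : ContDiffAt ℝ 2 f' y) (a : Fin n) :
    pd2 a (fun z => f z + f' z) y = pd2 a f y + pd2 a f' y := by
  have : pd a (fun z => f z + f' z) =ᶠ[nhds y] fun z => pd a f z + pd a f' z := by
    filter_upwards [eventually_differentiableAt hf, eventually_differentiableAt hf'] with z h1 h2
    exact pd_add h1 h2 a
  rw [pd2, pd_congr this, pd_add (contDiffAt_two_pd hf a) (contDiffAt_two_pd hf' a)]; rfl

theorem pd2_sub {f f' : Euc n → ℝ} {y : Euc n} (hf : ContDiffAt ℝ 2 f y)
    (hf' : ContDiffAt ℝ 2 f' y) (a : Fin n) :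
    pd2 a (fun z => f z - f' z) y = pd2 a f y - pd2 a f' y := by
  have : pd a (fun z => f z - f' z) =ᶠ[nhds y] fun z => pd a f z - pd a f' z := by
    filter_upwards [eventually_differentiableAt hf, eventually_differentiableAt hf'] with z h1 h2
    exact pd_sub h1 h2 a
  rw [pd2, pd_congr this, pd_sub (contDiffAt_two_pd hf a) (contDiffAt_two_pd hf' a)]; rfl

theorem pd2_mul {f f' : Euc n → ℝ} {y : Euc n} (hf : ContDiffAt ℝ 2 f y)
    (hf' : ContDiffAt ℝ 2 f' y) (a : Fin n) :
    pd2 a (fun z => f z * f' z) y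
      = pd2 a f y * f' y + 2 * (pd a f y * pd a f' y) + f y * pd2 a f' y := by
  have : pd a (fun z => f z * f' z) =ᶠ[nhds y] fun z => pd a f z * f' z + f z * pd a f' z := by
    filter_upwards [eventually_differentiableAt hf, eventually_differentiableAt hf'] with z h1 h2
    exact pd_mul h1 h2 a
  have d1 := hf.differentiableAt two_ne_zero
  have d2 := hf'.differentiableAt two_ne_zero
  have d3 := contDiffAt_two_pd hf a
  have d4 := contDiffAt_two_pd hf' a
  rw [pd2, pd_congr this, pd_add (f := fun z => pd a f z * f' z)
    (f' := fun z => f z * pd a f' z) (d3.mul d2) (d1.mul d4), pd_mul d3 d2, pd_mul d1 d4]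
  simp only [pd2]; ring

theorem pd2_sum {κ : Type*} {s : Finset κ} {f : κ → Euc n → ℝ} {y : Euc n}
    (hf : ∀ a ∈ s, ContDiffAt ℝ 2 (f a) y) (i : Fin n) :
    pd2 i (fun z => ∑ a ∈ s, f a z) y = ∑ a ∈ s, pd2 i (f a) y := by
  have : pd i (fun z => ∑ a ∈ s, f a z) =ᶠ[nhds y] fun z => ∑ a ∈ s, pd i (f a) z := by
    have h : ∀ᶠ z in nhds y, ∀ a ∈ s, DifferentiableAt ℝ (f a) z :=
      (Filter.eventually_all_finset s).2 fun a ha => eventually_differentiableAt (hf a ha)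
    filter_upwards [h] with z hz
    exact pd_sum hz i
  rw [pd2, pd_congr this, pd_sum fun a ha => contDiffAt_two_pd (hf a ha) i]; rfl

@[simp] theorem pd2_const (c : ℝ) (y : Euc n) (a : Fin n) : pd2 a (fun _ => c) y = 0 := by
  have : pd a (fun _ : Euc n => c) = fun _ => 0 := by ext z; simp
  rw [pd2, this]; simp

theorem pd2_const_mul {f : Euc n → ℝ} {y : Euc n} (hf : ContDiffAt ℝ 2 f y) (c : ℝ) (a : Fin n) :
    pd2 a (fun z => c * f z) y = c * pd2 a f y := by
  rw [pd2_mul contDiffAt_const hf]; simp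

theorem deriv_line {f : Euc n → ℝ} (hf : ContDiffAt ℝ 2 f 0) (a : Fin n) :
    HasDerivAt (fun s : ℝ => f (s • EuclideanSpace.single a 1)) (pd a f 0) 0 ∧
    HasDerivAt (deriv fun s : ℝ => f (s • EuclideanSpace.single a 1)) (pd2 a f 0) 0 := by
  have h0 : (0 : ℝ) • EuclideanSpace.single a (1 : ℝ) = (0 : Euc n) := zero_smul _ _
  have hcont : Filter.Tendsto (fun s : ℝ => s • EuclideanSpace.single a (1 : ℝ)) (nhds 0)
      (nhds (0 : Euc n)) := by
    have : Continuous fun s : ℝ => s • (EuclideanSpace.single a (1 : ℝ) : Euc n) := by fun_prop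
    simpa using this.tendsto 0
  constructor
  · have := hasDerivAt_line (f := f) (a := a) (s := 0)
      (by rw [h0]; exact hf.differentiableAt two_ne_zero)
    rwa [h0] at this
  · have e : (deriv fun s : ℝ => f (s • EuclideanSpace.single a 1)) =ᶠ[nhds 0]
        fun s => pd a f (s • EuclideanSpace.single a 1) := by
      filter_upwards [hcont.eventually (eventually_differentiableAt hf)] with s hs
      exact (hasDerivAt_line hs).deriv
    have := hasDerivAt_line (f := pd a f) (a := a) (s := 0)
      (by rw [h0]; exact contDiffAt_two_pd hf a)
    rw [h0] at this
    exact this.congr_of_eventuallyEq e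

theorem pd_eq_zero_of_isLocalMax {f : Euc n → ℝ} {y : Euc n} (h : IsLocalMax f y) (a : Fin n) :
    pd a f y = 0 := by
  rw [pd, h.fderiv_eq_zero]; rfl

theorem pd2_nonpos_of_isLocalMax {f : Euc n → ℝ} (hf : ContDiffAt ℝ 2 f 0) (h : IsLocalMax f 0)
    (a : Fin n) : pd2 a f 0 ≤ 0 := by
  have hc : Filter.Tendsto (fun s : ℝ => s • EuclideanSpace.single a (1 : ℝ)) (nhds 0)
      (nhds (0 : Euc n)) := by
    have : Continuous fun s : ℝ => s • (EuclideanSpace.single a (1 : ℝ) : Euc n) := by fun_prop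
    simpa using this.tendsto 0
  have hmax : IsLocalMax (fun s : ℝ => f (s • EuclideanSpace.single a 1)) 0 := by
    filter_upwards [hc.eventually h] with s hs
    simpa using hs
  rw [← (deriv_line hf a).2.deriv]
  exact deriv_deriv_nonpos_of_isLocalMax (deriv_line hf a).1.continuousAt hmax

/-- The trace of `T` with respect to the metric `G` at `y`. -/
def ltr (G : Euc n → Matrix (Fin n) (Fin n) ℝ) (y : Euc n) (T : Matrix (Fin n) (Fin n) ℝ) : ℝ :=
  ∑ i, ∑ j, (G y)⁻¹ i j * T i j

/-- The squared length of the gradient for the metric `G`. -/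
def lgradSq (G : Euc n → Matrix (Fin n) (Fin n) ℝ) (w : Euc n → ℝ) (y : Euc n) : ℝ :=
  ∑ i, ∑ j, (G y)⁻¹ i j * pd i w y * pd j w y

/-- The Laplacian for the metric `G`. -/
def lapl (G : Euc n → Matrix (Fin n) (Fin n) ℝ) (w : Euc n → ℝ) (y : Euc n) : ℝ :=
  ltr G y (lhess G w y)

/-- The part `∇²w - dw ⊗ dw - t A` of the tensor `U`. -/
def coreMat (G A : Euc n → Matrix (Fin n) (Fin n) ℝ) (t : ℝ) (w : Euc n → ℝ) (y : Euc n) :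
    Matrix (Fin n) (Fin n) ℝ :=
  lhess G w y - Matrix.vecMulVec (fun i => pd i w y) (fun i => pd i w y) - t • A y

/-- The endomorphism `G⁻¹ U`, where `U = ∇²w - dw ⊗ dw - t A + (κ Δw + μ |∇w|² + 1 - t) G`. -/
def endoMat (G A : Euc n → Matrix (Fin n) (Fin n) ℝ) (κ μ t : ℝ) (w : Euc n → ℝ) (y : Euc n) :
    Matrix (Fin n) (Fin n) ℝ :=
  (G y)⁻¹ * coreMat G A t w y + (κ * lapl G w y + μ * lgradSq G w y + (1 - t)) • 1

/-- The coordinates are normal at the origin for the metric `G`, and `B` bounds the derivatives of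
`G` and of the symmetric tensor `A` at the origin which enter the second-order estimate. -/
structure NormalAt (G A : Euc n → Matrix (Fin n) (Fin n) ℝ) (B : ℝ) : Prop where
  smooth : ContDiffMat 3 G 0
  symm : ∀ᶠ z in nhds 0, (G z).IsSymm
  one : G 0 = 1
  chr : ∀ k i j, lchr G k i j 0 = 0
  smoothA : ContDiffMat 2 A 0
  symmA : ∀ᶠ z in nhds 0, (A z).IsSymm
  chr1 : ∀ a k i j, |pd a (lchr G k i j) 0| ≤ B
  chr2 : ∀ a k i j, |pd2 a (lchr G k i j) 0| ≤ B
  inv2 : ∀ a i j, |pd2 a (fun z => (G z)⁻¹ i j) 0| ≤ B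
  bdA : ∀ i j, |A 0 i j| ≤ B
  bdA1 : ∀ a i j, |pd a (fun z => A z i j) 0| ≤ B
  bdA2 : ∀ a i j, |pd2 a (fun z => A z i j) 0| ≤ B

variable {G A : Euc n → Matrix (Fin n) (Fin n) ℝ} {B : ℝ} {w : Euc n → ℝ}

theorem abs_sum_le_mul {f : Fin n → ℝ} {c : ℝ} (h : ∀ i, |f i| ≤ c) : |∑ i, f i| ≤ n * c := by
  refine (Finset.abs_sum_le_sum_abs _ _).trans ?_
  refine (Finset.sum_le_sum fun i _ => h i).trans (le_of_eq ?_)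
  simp

namespace NormalAt

theorem det_ne (h : NormalAt G A B) : (G 0).det ≠ 0 := by rw [h.one]; simp

theorem contDiffAt_inv (h : NormalAt G A B) (i j : Fin n) :
    ContDiffAt ℝ 3 (fun z => (G z)⁻¹ i j) 0 := h.smooth.inv h.det_ne i j

theorem contDiffAt_chr (h : NormalAt G A B) (k i j : Fin n) : ContDiffAt ℝ 2 (lchr G k i j) 0 :=
  contDiffAt_lchr h.smooth h.det_ne (by norm_num) k i j

theorem inv_zero (h : NormalAt G A B) (i j : Fin n) : (G 0)⁻¹ i j = if i = j then 1 else 0 := by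
  rw [h.one, inv_one, Matrix.one_apply]

theorem inv_one (h : NormalAt G A B) (a i j : Fin n) : pd a (fun z => (G z)⁻¹ i j) 0 = 0 := by
  have hG : ContDiffMat 1 G 0 := h.smooth.of_le (by norm_num)
  have h0 : pdMat a G 0 = 0 := by
    have hc : connMat G a 0 = 0 := by ext k l; exact h.chr k a l
    rw [pdMat_metric h.symm h.det_ne, hc]; simp
  have h1 : pdMat a (fun z => G z * (G z)⁻¹) 0 = 0 := by
    have : (fun z => G z * (G z)⁻¹) =ᶠ[nhds 0] fun _ => 1 := by
      filter_upwards [h.smooth.det_ne_zero h.det_ne] with z hz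
      exact Matrix.mul_nonsing_inv _ (isUnit_iff_ne_zero.2 hz)
    rw [pdMat_congr this]
    ext i j
    simp [pdMat]
  rw [pdMat_mul hG (hG.inv h.det_ne), h0, h.one] at h1
  have h2 : pdMat a (fun z => (G z)⁻¹) 0 = 0 := by simpa using h1
  exact congrFun (congrFun h2 i) j

variable (h : NormalAt G A B) (hw : ContDiffAt ℝ 4 w 0)
include h hw

theorem contDiffAt_hess (i j : Fin n) : ContDiffAt ℝ 2 (fun z => lhess G w z i j) 0 := by
  refine (contDiffAt_pd (contDiffAt_pd hw (m' := 3) (by norm_num) j) (by norm_num) i).sub ?_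
  exact ContDiffAt.sum fun k _ => (h.contDiffAt_chr k i j).mul
    ((contDiffAt_pd hw (m' := 3) (by norm_num) k).of_le (by norm_num))

theorem contDiffAt_lapl : ContDiffAt ℝ 2 (lapl G w) 0 := by
  have : ContDiffAt ℝ 2 (fun z => ∑ i, ∑ j, (G z)⁻¹ i j * lhess G w z i j) 0 :=
    ContDiffAt.sum fun i _ => ContDiffAt.sum fun j _ =>
      ((h.contDiffAt_inv i j).of_le (by norm_num)).mul (h.contDiffAt_hess hw i j)
  exact this

theorem contDiffAt_gradSq : ContDiffAt ℝ 2 (lgradSq G w) 0 :=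
  ContDiffAt.sum fun i _ => ContDiffAt.sum fun j _ =>
    (((h.contDiffAt_inv i j).of_le (by norm_num)).mul
      ((contDiffAt_pd hw (m' := 3) (by norm_num) i).of_le (by norm_num))).mul
      ((contDiffAt_pd hw (m' := 3) (by norm_num) j).of_le (by norm_num))

theorem contDiffAt_core (t : ℝ) (i j : Fin n) :
    ContDiffAt ℝ 2 (fun z => coreMat G A t w z i j) 0 := by
  have hwi : ∀ k, ContDiffAt ℝ 2 (pd k w) 0 := fun k =>
    (contDiffAt_pd hw (m' := 3) (by norm_num) k).of_le (by norm_num)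
  exact ((h.contDiffAt_hess hw i j).sub ((hwi i).mul (hwi j))).sub
    (contDiffAt_const.mul (h.smoothA i j))

omit hw in
theorem hess_zero (i j : Fin n) : lhess G w 0 i j = pd i (pd j w) 0 := by
  simp [lhess, h.chr]

theorem pd_hess (a i j : Fin n) : pd a (fun z => lhess G w z i j) 0
    = pd a (pd i (pd j w)) 0 - ∑ k, pd a (lchr G k i j) 0 * pd k w 0 := by
  have hwi : ∀ k, ContDiffAt ℝ 2 (pd k w) 0 := fun k =>
    (contDiffAt_pd hw (m' := 3) (by norm_num) k).of_le (by norm_num)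
  have hwij : ContDiffAt ℝ 2 (pd i (pd j w)) 0 :=
    contDiffAt_pd (contDiffAt_pd hw (m' := 3) (by norm_num) j) (by norm_num) i
  have e : (fun z => lhess G w z i j)
      = fun z => pd i (pd j w) z - ∑ k, lchr G k i j z * pd k w z := rfl
  have hd1 : ∀ k, DifferentiableAt ℝ (lchr G k i j) 0 := fun k =>
    (h.contDiffAt_chr k i j).differentiableAt two_ne_zero
  have hd2 : ∀ k, DifferentiableAt ℝ (pd k w) 0 := fun k => (hwi k).differentiableAt two_ne_zero
  rw [e, pd_sub (hwij.differentiableAt two_ne_zero)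
    (DifferentiableAt.fun_sum fun k _ => (hd1 k).fun_mul (hd2 k)),
    pd_sum_mul (fun k _ => hd1 k) (fun k _ => hd2 k)]
  simp [h.chr]

theorem pd2_hess (a i j : Fin n) : pd2 a (fun z => lhess G w z i j) 0
    = pd2 a (pd i (pd j w)) 0 - ∑ k, (pd2 a (lchr G k i j) 0 * pd k w 0
      + 2 * (pd a (lchr G k i j) 0 * pd a (pd k w) 0)) := by
  have hwi : ∀ k, ContDiffAt ℝ 2 (pd k w) 0 := fun k =>
    (contDiffAt_pd hw (m' := 3) (by norm_num) k).of_le (by norm_num)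
  have hwij : ContDiffAt ℝ 2 (pd i (pd j w)) 0 :=
    contDiffAt_pd (contDiffAt_pd hw (m' := 3) (by norm_num) j) (by norm_num) i
  have e : (fun z => lhess G w z i j)
      = fun z => pd i (pd j w) z - ∑ k, lchr G k i j z * pd k w z := rfl
  rw [e, pd2_sub hwij (ContDiffAt.sum fun k _ => (h.contDiffAt_chr k i j).mul (hwi k)),
    pd2_sum fun k _ => (h.contDiffAt_chr k i j).mul (hwi k)]
  congr 1
  refine Finset.sum_congr rfl fun k _ => ?_
  rw [pd2_mul (h.contDiffAt_chr k i j) (hwi k), h.chr]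
  ring

omit hw in
/-- At the centre of normal coordinates, a contraction with `G⁻¹` may be differentiated once as
if the metric were constant. -/
theorem pd_contract {T : Fin n → Fin n → Euc n → ℝ} (hT : ∀ i j, ContDiffAt ℝ 2 (T i j) 0)
    (a : Fin n) : pd a (fun z => ∑ i, ∑ j, (G z)⁻¹ i j * T i j z) 0 = ∑ i, pd a (T i i) 0 := by
  have hi : ∀ i j, DifferentiableAt ℝ (fun z => (G z)⁻¹ i j) 0 := fun i j =>
    (h.contDiffAt_inv i j).differentiableAt (by norm_num)
  have hTd : ∀ i j, DifferentiableAt ℝ (T i j) 0 := fun i j =>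
    (hT i j).differentiableAt two_ne_zero
  rw [pd_sum (f := fun i z => ∑ j, (G z)⁻¹ i j * T i j z)
    fun i _ => DifferentiableAt.fun_sum fun j _ => (hi i j).fun_mul (hTd i j)]
  refine Finset.sum_congr rfl fun i _ => ?_
  rw [pd_sum_mul (f := fun j z => (G z)⁻¹ i j) (fun j _ => hi i j) (fun j _ => hTd i j)]
  simp [h.inv_one, h.inv_zero]

omit hw in
theorem pd2_contract {T : Fin n → Fin n → Euc n → ℝ} (hT : ∀ i j, ContDiffAt ℝ 2 (T i j) 0)
    (a : Fin n) : pd2 a (fun z => ∑ i, ∑ j, (G z)⁻¹ i j * T i j z) 0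
      = ∑ i, pd2 a (T i i) 0 + ∑ i, ∑ j, pd2 a (fun z => (G z)⁻¹ i j) 0 * T i j 0 := by
  have hi : ∀ i j, ContDiffAt ℝ 2 (fun z => (G z)⁻¹ i j) 0 := fun i j =>
    (h.contDiffAt_inv i j).of_le (by norm_num)
  rw [pd2_sum fun i _ => ContDiffAt.sum fun j _ => (hi i j).mul (hT i j),
    ← Finset.sum_add_distrib]
  refine Finset.sum_congr rfl fun i _ => ?_
  rw [pd2_sum fun j _ => (hi i j).mul (hT i j)]
  have : ∀ j, pd2 a (fun z => (G z)⁻¹ i j * T i j z) 0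
      = pd2 a (fun z => (G z)⁻¹ i j) 0 * T i j 0 + (if i = j then 1 else 0) * pd2 a (T i j) 0 := by
    intro j
    rw [pd2_mul (hi i j) (hT i j), h.inv_one, h.inv_zero]; ring
  simp only [this, Finset.sum_add_distrib, ite_mul, one_mul, zero_mul, Finset.sum_ite_eq,
    Finset.mem_univ, if_true]
  ring

theorem pd_lapl (a : Fin n) :
    pd a (lapl G w) 0 = ∑ i, pd a (fun z => lhess G w z i i) 0 :=
  h.pd_contract (T := fun i j z => lhess G w z i j) (h.contDiffAt_hess hw) a

theorem pd2_lapl (a : Fin n) : pd2 a (lapl G w) 0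
    = ∑ i, pd2 a (fun z => lhess G w z i i) 0
      + ∑ i, ∑ j, pd2 a (fun z => (G z)⁻¹ i j) 0 * pd i (pd j w) 0 := by
  have := h.pd2_contract (T := fun i j z => lhess G w z i j) (h.contDiffAt_hess hw) a
  simp only [h.hess_zero] at this
  exact this

omit hw in
theorem lapl_zero : lapl G w 0 = ∑ i, pd i (pd i w) 0 := by
  simp [lapl, ltr, h.inv_zero, h.hess_zero]

omit hw in
theorem gradSq_zero : lgradSq G w 0 = ∑ i, pd i w 0 ^ 2 := by
  simp [lgradSq, h.inv_zero, sq]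

theorem pd_gradSq (a : Fin n) :
    pd a (lgradSq G w) 0 = ∑ i, 2 * (pd i w 0 * pd a (pd i w) 0) := by
  have hwi : ∀ k, ContDiffAt ℝ 2 (pd k w) 0 := fun k =>
    (contDiffAt_pd hw (m' := 3) (by norm_num) k).of_le (by norm_num)
  have e : lgradSq G w = fun z => ∑ i, ∑ j, (G z)⁻¹ i j * (pd i w z * pd j w z) := by
    ext z; simp only [lgradSq, mul_assoc]
  rw [e, h.pd_contract (T := fun i j z => pd i w z * pd j w z)
    (fun i j => (hwi i).mul (hwi j))]
  refine Finset.sum_congr rfl fun i _ => ?_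
  rw [pd_mul ((hwi i).differentiableAt two_ne_zero) ((hwi i).differentiableAt two_ne_zero)]
  ring

theorem pd2_gradSq (a : Fin n) :
    pd2 a (lgradSq G w) 0
      = ∑ i, (2 * pd a (pd i w) 0 ^ 2 + 2 * (pd i w 0 * pd2 a (pd i w) 0))
        + ∑ i, ∑ j, pd2 a (fun z => (G z)⁻¹ i j) 0 * (pd i w 0 * pd j w 0) := by
  have hwi : ∀ k, ContDiffAt ℝ 2 (pd k w) 0 := fun k =>
    (contDiffAt_pd hw (m' := 3) (by norm_num) k).of_le (by norm_num)
  have e : lgradSq G w = fun z => ∑ i, ∑ j, (G z)⁻¹ i j * (pd i w z * pd j w z) := by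
    ext z; simp only [lgradSq, mul_assoc]
  rw [e, h.pd2_contract (T := fun i j z => pd i w z * pd j w z)
    (fun i j => (hwi i).mul (hwi j))]
  congr 1
  refine Finset.sum_congr rfl fun i _ => ?_
  rw [pd2_mul (hwi i) (hwi i)]
  ring

theorem pd_core (t : ℝ) (a i j : Fin n) : pd a (fun z => coreMat G A t w z i j) 0
    = pd a (fun z => lhess G w z i j) 0
      - (pd a (pd i w) 0 * pd j w 0 + pd i w 0 * pd a (pd j w) 0)
      - t * pd a (fun z => A z i j) 0 := by
  have hwi : ∀ k, DifferentiableAt ℝ (pd k w) 0 := fun k =>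
    (contDiffAt_pd hw (m' := 3) (by norm_num) k).differentiableAt (by norm_num)
  have hH := (h.contDiffAt_hess hw i j).differentiableAt two_ne_zero
  have hA := (h.smoothA i j).differentiableAt two_ne_zero
  have e : (fun z => coreMat G A t w z i j)
      = fun z => lhess G w z i j - pd i w z * pd j w z - t * A z i j := rfl
  rw [e, pd_sub (hH.fun_sub ((hwi i).fun_mul (hwi j))) (hA.const_mul t),
    pd_sub hH ((hwi i).fun_mul (hwi j)),
    pd_mul (hwi i) (hwi j), pd_const_mul hA]

theorem pd2_core (t : ℝ) (a i j : Fin n) : pd2 a (fun z => coreMat G A t w z i j) 0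
    = pd2 a (fun z => lhess G w z i j) 0
      - (pd2 a (pd i w) 0 * pd j w 0 + 2 * (pd a (pd i w) 0 * pd a (pd j w) 0)
        + pd i w 0 * pd2 a (pd j w) 0)
      - t * pd2 a (fun z => A z i j) 0 := by
  have hwi : ∀ k, ContDiffAt ℝ 2 (pd k w) 0 := fun k =>
    (contDiffAt_pd hw (m' := 3) (by norm_num) k).of_le (by norm_num)
  have hH := h.contDiffAt_hess hw i j
  have e : (fun z => coreMat G A t w z i j)
      = fun z => lhess G w z i j - pd i w z * pd j w z - t * A z i j := rfl
  rw [e, pd2_sub (hH.sub ((hwi i).mul (hwi j))) (contDiffAt_const.mul (h.smoothA i j)),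
    pd2_sub hH ((hwi i).mul (hwi j)), pd2_mul (hwi i) (hwi j), pd2_const_mul (h.smoothA i j)]

theorem contDiffAt_factor (κ μ t : ℝ) :
    ContDiffAt ℝ 2 (fun z => κ * lapl G w z + μ * lgradSq G w z + (1 - t)) 0 :=
  ((contDiffAt_const.mul (h.contDiffAt_lapl hw)).add
    (contDiffAt_const.mul (h.contDiffAt_gradSq hw))).add contDiffAt_const

theorem contDiffAt_endo (κ μ t : ℝ) (i j : Fin n) :
    ContDiffAt ℝ 2 (fun z => endoMat G A κ μ t w z i j) 0 := by
  simp only [endoMat, Matrix.add_apply, Matrix.mul_apply, Matrix.smul_apply, smul_eq_mul]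
  refine (ContDiffAt.sum fun k _ => ?_).add ((h.contDiffAt_factor hw κ μ t).mul contDiffAt_const)
  exact ((h.contDiffAt_inv i k).of_le (by norm_num)).mul (h.contDiffAt_core hw t k j)

theorem pd_endo (κ μ t : ℝ) (a i j : Fin n) : pd a (fun z => endoMat G A κ μ t w z i j) 0
    = pd a (fun z => coreMat G A t w z i j) 0
      + (κ * pd a (lapl G w) 0 + μ * pd a (lgradSq G w) 0) * (if i = j then 1 else 0) := by
  have e : (fun z => endoMat G A κ μ t w z i j) = fun z =>
      ∑ k, (G z)⁻¹ i k * coreMat G A t w z k j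
        + (κ * lapl G w z + μ * lgradSq G w z + (1 - t)) * (if i = j then 1 else 0) := by
    ext z
    simp only [endoMat, Matrix.add_apply, Matrix.mul_apply, Matrix.smul_apply, smul_eq_mul,
      Matrix.one_apply]
  have hi : ∀ k, DifferentiableAt ℝ (fun z => (G z)⁻¹ i k) 0 := fun k =>
    (h.contDiffAt_inv i k).differentiableAt (by norm_num)
  have hc : ∀ k, DifferentiableAt ℝ (fun z => coreMat G A t w z k j) 0 := fun k =>
    (h.contDiffAt_core hw t k j).differentiableAt two_ne_zero
  have hΔ := (h.contDiffAt_lapl hw).differentiableAt two_ne_zero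
  have hN := (h.contDiffAt_gradSq hw).differentiableAt two_ne_zero
  have hf := (h.contDiffAt_factor hw κ μ t).differentiableAt two_ne_zero
  rw [e, pd_add (DifferentiableAt.fun_sum fun k _ => (hi k).fun_mul (hc k))
    (hf.fun_mul (differentiableAt_const _)), pd_mul hf (differentiableAt_const _),
    pd_sum_mul (f := fun k z => (G z)⁻¹ i k) (fun k _ => hi k) (fun k _ => hc k),
    pd_add (f := fun z => κ * lapl G w z + μ * lgradSq G w z)
      ((hΔ.const_mul κ).add (hN.const_mul μ)) (differentiableAt_const _),
    pd_add (hΔ.const_mul κ) (hN.const_mul μ), pd_const_mul hΔ, pd_const_mul hN]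
  simp [h.inv_one, h.inv_zero]

theorem pd2_endo (κ μ t : ℝ) (a i : Fin n) : pd2 a (fun z => endoMat G A κ μ t w z i i) 0
    = pd2 a (fun z => coreMat G A t w z i i) 0
      + ∑ k, pd2 a (fun z => (G z)⁻¹ i k) 0 * coreMat G A t w 0 k i
      + (κ * pd2 a (lapl G w) 0 + μ * pd2 a (lgradSq G w) 0) := by
  have e : (fun z => endoMat G A κ μ t w z i i) = fun z =>
      ∑ k, (G z)⁻¹ i k * coreMat G A t w z k i
        + (κ * lapl G w z + μ * lgradSq G w z + (1 - t)) := by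
    ext z
    simp only [endoMat, Matrix.add_apply, Matrix.mul_apply, Matrix.smul_apply, smul_eq_mul,
      Matrix.one_apply_eq, mul_one]
  have hi : ∀ k, ContDiffAt ℝ 2 (fun z => (G z)⁻¹ i k) 0 := fun k =>
    (h.contDiffAt_inv i k).of_le (by norm_num)
  have hc : ∀ k, ContDiffAt ℝ 2 (fun z => coreMat G A t w z k i) 0 := fun k =>
    h.contDiffAt_core hw t k i
  have hΔ := h.contDiffAt_lapl hw
  have hN := h.contDiffAt_gradSq hw
  rw [e, pd2_add (ContDiffAt.sum fun k _ => (hi k).mul (hc k)) (h.contDiffAt_factor hw κ μ t),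
    pd2_sum fun k _ => (hi k).mul (hc k),
    pd2_add (f := fun z => κ * lapl G w z + μ * lgradSq G w z)
      ((contDiffAt_const.mul hΔ).add (contDiffAt_const.mul hN)) contDiffAt_const,
    pd2_add (contDiffAt_const.mul hΔ) (contDiffAt_const.mul hN), pd2_const_mul hΔ,
    pd2_const_mul hN]
  have : ∀ k, pd2 a (fun z => (G z)⁻¹ i k * coreMat G A t w z k i) 0
      = pd2 a (fun z => (G z)⁻¹ i k) 0 * coreMat G A t w 0 k i
        + (if i = k then 1 else 0) * pd2 a (fun z => coreMat G A t w z k i) 0 := by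
    intro k
    rw [pd2_mul (hi k) (hc k), h.inv_one, h.inv_zero]; ring
  simp only [this, Finset.sum_add_distrib, ite_mul, one_mul, zero_mul, Finset.sum_ite_eq,
    Finset.mem_univ, if_true, pd2_const]
  ring

theorem core_symm (t : ℝ) : ∀ᶠ z in nhds 0, (coreMat G A t w z).IsSymm := by
  have hw2 : ContDiffAt ℝ 2 w 0 := hw.of_le (by norm_num)
  filter_upwards [eventually_eventually_nhds.2 h.symm, h.symmA, hw2.eventually (by simp)]
    with z h1 h2 h3
  ext i j
  simp only [coreMat, Matrix.transpose_apply, Matrix.sub_apply, Matrix.smul_apply, lhess,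
    Matrix.of_apply, Matrix.vecMulVec_apply, h2.apply i j, pd_comm h3 j i,
    fun k => lchr_symm h1 k j i]
  ring

end NormalAt

end NormalCoordinates

/-! ### The second-order estimate at a maximum point -/

section MaximumPoint

variable {n : ℕ}

theorem abs_sum_mul_le {f g : Fin n → ℝ} {c d : ℝ} (hf : ∀ i, |f i| ≤ c) (hg : ∀ i, |g i| ≤ d) :
    |∑ i, f i * g i| ≤ n * (c * d) := by
  refine abs_sum_le_mul fun i => ?_
  rw [abs_mul]
  exact mul_le_mul (hf i) (hg i) (abs_nonneg _) ((abs_nonneg _).trans (hf i))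

theorem abs_weighted_sum_le {f g : Fin n → ℝ} {c : ℝ} (hg : ∀ i, 0 ≤ g i) (hf : ∀ i, |f i| ≤ c) :
    |∑ i, g i * f i| ≤ c * ∑ i, g i := by
  rw [Finset.mul_sum]
  refine (Finset.abs_sum_le_sum_abs _ _).trans (Finset.sum_le_sum fun i _ => ?_)
  rw [abs_mul, abs_of_nonneg (hg i), mul_comm]
  exact mul_le_mul_of_nonneg_right (hf i) (hg i)

/-- The pointwise inequality behind the estimate. The arrays `w1`, `w2`, `w3`, `w4` are the partial
derivatives of `w` at the centre of normal coordinates, `dΔ`, `ddΔ`, `dN`, `ddN` the first and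
pure second derivatives of `Δw` and `N = |∇w|²`, and `W1`, `W2` those of the diagonal entries of
`G⁻¹ U`; each agrees up to controlled terms with its flat expression. The weights `g` are those
of the linearized equation. The term `K N` of the test function `Δw + K N` contributes
`-2 K κ |∇²w|²`, which beats the term `2 μ |∇²w|²` coming from `μ |∇w|²` in `U`. -/
theorem hessian_bound_of_jets {w1 : Fin n → ℝ} {w2 : Fin n → Fin n → ℝ}
    {w3 : Fin n → Fin n → Fin n → ℝ} {w4 : Fin n → Fin n → ℝ}
    {dΔ ddΔ dN ddN : Fin n → ℝ} {W1 W2 : Fin n → Fin n → ℝ} {g : Fin n → ℝ} {c κ μ K Y : ℝ}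
    (hc : 0 ≤ c) (hμ : 0 ≤ μ) (hκ : 0 ≤ κ) (hK : 0 ≤ K) (hKκ : K * κ = μ + 1) (hY : 1 ≤ Y)
    (hw2 : ∀ i j, w2 i j = w2 j i) (hw3 : ∀ a i, w3 a a i = w3 i a a)
    (hw4 : ∀ a i, w4 a i = w4 i a) (h1 : ∀ i, |w1 i| ≤ c)
    (hΔ1 : ∀ a, |dΔ a - ∑ i, w3 a i i| ≤ c) (hΔ2 : ∀ a, |ddΔ a - ∑ i, w4 a i| ≤ c * Y)
    (hN1 : ∀ a, |dN a| ≤ c * Y)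
    (hN2 : ∀ a, |ddN a - 2 * ∑ i, w2 a i ^ 2 - 2 * ∑ i, w1 i * w3 a a i| ≤ c)
    (hW1 : ∀ a i, |W1 a i - w3 a i i - κ * dΔ a| ≤ c * Y)
    (hW2 : ∀ a i, |W2 a i - (w4 a i - 2 * w2 a i ^ 2 - 2 * (w1 i * w3 a a i) + κ * ddΔ a
      + μ * ddN a)| ≤ c * Y)
    (hg : ∀ i, 0 ≤ g i) (hT : 0 < ∑ i, g i)
    (hE1 : ∀ a, |∑ i, g i * W1 a i| ≤ c * ∑ i, g i)
    (hE2 : -(c * Y * ∑ i, g i) ≤ ∑ a, ∑ i, g i * W2 a i)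
    (hmax1 : ∀ a, dΔ a + K * dN a = 0) (hmax2 : ∀ a, ddΔ a + K * ddN a ≤ 0) :
    2 * ∑ i, ∑ j, w2 i j ^ 2 ≤ (c + 2 * K * (n * (c * (c * (2 + κ * K))))
      + (c + 2 * (c * (c * (K + 1))) + n * c + K * c
        + (2 * μ + 1) * (2 * (n * (c * (c * (K + 1)))) + n * c))) * Y := by
  set S : Fin n → ℝ := fun a => ∑ i, w2 a i ^ 2 with hS
  set S2 := ∑ i, S i with hS2
  set D : Fin n → ℝ := fun i => ∑ a, w3 a a i with hD
  set T := ∑ i, g i with hTdef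
  have hS0 : ∀ i, 0 ≤ S i := fun i => Finset.sum_nonneg fun j _ => sq_nonneg _
  have hdΔ : ∀ i, |dΔ i| ≤ K * (c * Y) := by
    intro i
    have : dΔ i = -(K * dN i) := by linarith [hmax1 i]
    rw [this, abs_neg, abs_mul, abs_of_nonneg hK]
    exact mul_le_mul_of_nonneg_left (hN1 i) hK
  have hcY : c ≤ c * Y := le_mul_of_one_le_right hc hY
  have hDb : ∀ i, |D i| ≤ c * (K + 1) * Y := by
    intro i
    have e : D i = dΔ i - (dΔ i - ∑ a, w3 i a a) := by
      simp only [hD, hw3]; ring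
    rw [e]
    refine (abs_sub _ _).trans ?_
    linarith [hdΔ i, hΔ1 i]
  set P := ∑ i, w1 i * D i with hP
  have hPb : |P| ≤ n * (c * (c * (K + 1) * Y)) := abs_sum_mul_le h1 hDb
  have hNsum : |∑ a, ddN a - 2 * S2 - 2 * P| ≤ n * c := by
    have e : ∑ a, ddN a - 2 * S2 - 2 * P
        = ∑ a, (ddN a - 2 * ∑ i, w2 a i ^ 2 - 2 * ∑ i, w1 i * w3 a a i) := by
      rw [Finset.sum_sub_distrib, Finset.sum_sub_distrib, ← Finset.mul_sum, ← Finset.mul_sum]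
      congr 2
      simp only [hP, hD, Finset.mul_sum]
      rw [Finset.sum_comm]
    rw [e]
    exact abs_sum_le_mul hN2
  set Q : Fin n → ℝ := fun i => ∑ j, w1 j * w3 i i j with hQ
  have hcol : ∀ i, ∑ a, W2 a i ≤ -2 * S2 - 2 * K * Q i
      + (c + 2 * (c * (c * (K + 1))) + n * c + K * c
        + (2 * μ + 1) * (2 * (n * (c * (c * (K + 1)))) + n * c)) * Y := by
    intro i
    have e1 : |∑ a, W2 a i - (∑ a, w4 i a - 2 * S i - 2 * (w1 i * D i) + κ * ∑ a, ddΔ a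
        + μ * ∑ a, ddN a)| ≤ n * (c * Y) := by
      have e : ∑ a, W2 a i - (∑ a, w4 i a - 2 * S i - 2 * (w1 i * D i) + κ * ∑ a, ddΔ a
          + μ * ∑ a, ddN a) = ∑ a, (W2 a i - (w4 a i - 2 * w2 a i ^ 2 - 2 * (w1 i * w3 a a i)
            + κ * ddΔ a + μ * ddN a)) := by
        simp only [Finset.sum_sub_distrib, Finset.sum_add_distrib, ← Finset.mul_sum, hS, hD]
        have a1 : ∑ a, w2 i a ^ 2 = ∑ a, w2 a i ^ 2 :=
          Finset.sum_congr rfl fun a _ => by rw [hw2]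
        have a2 : ∑ a, w4 i a = ∑ a, w4 a i := Finset.sum_congr rfl fun a _ => by rw [hw4]
        rw [a1, a2]
      rw [e]
      exact abs_sum_le_mul fun a => hW2 a i
    have b1 := abs_le.1 e1
    have b2 := abs_le.1 (hΔ2 i)
    have b3 : |w1 i * D i| ≤ c * (c * (K + 1) * Y) := by
      rw [abs_mul]; exact mul_le_mul (h1 i) (hDb i) (abs_nonneg _) hc
    have b3 := abs_le.1 b3
    have b4 := abs_le.1 (hN2 i)
    have b5 := abs_le.1 hNsum
    have b6 := abs_le.1 hPb
    -- the maximum condition, summed over all directions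
    have m1 : κ * ∑ a, ddΔ a ≤ -(μ + 1) * ∑ a, ddN a := by
      have : ∑ a, (ddΔ a + K * ddN a) ≤ 0 := Finset.sum_nonpos fun a _ => hmax2 a
      rw [Finset.sum_add_distrib, ← Finset.mul_sum] at this
      have := mul_nonpos_of_nonneg_of_nonpos hκ this
      rw [← hKκ]; linarith
    have m2 : ddΔ i ≤ -K * (2 * S i + 2 * Q i - c) := by
      have := mul_le_mul_of_nonneg_left (show 2 * S i + 2 * Q i - c ≤ ddN i by
        simp only [hS, hQ]; linarith) hK
      linarith [hmax2 i]
    have m3 := mul_nonneg hK (hS0 i)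
    have m4 : μ * ∑ a, ddN a + -(μ + 1) * ∑ a, ddN a = -∑ a, ddN a := by ring
    have nc : (0 : ℝ) ≤ n * c := by positivity
    have ncY : (n : ℝ) * c ≤ n * c * Y := le_mul_of_one_le_right nc hY
    have KcY : K * c ≤ K * c * Y := le_mul_of_one_le_right (by positivity) hY
    have hμY : 0 ≤ μ * (2 * (n * (c * (c * (K + 1)))) + n * c) * Y := by positivity
    nlinarith [hS0 i]
  have hQsum : |∑ i, g i * Q i| ≤ n * (c * (c * (2 + κ * K) * Y * T)) := by
    have e : ∑ i, g i * Q i = ∑ j, w1 j * ∑ i, g i * w3 j i i := by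
      simp only [hQ, Finset.mul_sum]
      rw [Finset.sum_comm]
      refine Finset.sum_congr rfl fun j _ => Finset.sum_congr rfl fun i _ => ?_
      rw [hw3 i j]; ring
    rw [e]
    refine abs_sum_mul_le h1 fun j => ?_
    have e2 : ∑ i, g i * w3 j i i
        = ∑ i, g i * W1 j i - κ * dΔ j * T - ∑ i, g i * (W1 j i - w3 j i i - κ * dΔ j) := by
      rw [hTdef, Finset.mul_sum, ← Finset.sum_sub_distrib, ← Finset.sum_sub_distrib]
      exact Finset.sum_congr rfl fun i _ => by ring
    have c1 := hE1 j
    have c2 := abs_weighted_sum_le hg (hW1 j)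
    have c3 : |κ * dΔ j * T| ≤ κ * (K * (c * Y)) * T := by
      rw [abs_mul, abs_mul, abs_of_nonneg hκ, abs_of_pos hT]
      exact mul_le_mul_of_nonneg_right (mul_le_mul_of_nonneg_left (hdΔ j) hκ) hT.le
    rw [e2]
    refine ((abs_sub _ _).trans (add_le_add (abs_sub _ _) le_rfl)).trans ?_
    have c4 : c * T ≤ c * Y * T := mul_le_mul_of_nonneg_right hcY hT.le
    rw [← hTdef] at c2
    linarith
  have hfin : ∑ a, ∑ i, g i * W2 a i ≤ -2 * S2 * T - 2 * K * ∑ i, g i * Q i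
      + (c + 2 * (c * (c * (K + 1))) + n * c + K * c
        + (2 * μ + 1) * (2 * (n * (c * (c * (K + 1)))) + n * c)) * Y * T := by
    rw [Finset.sum_comm]
    have : ∀ i, ∑ a, g i * W2 a i ≤ g i * (-2 * S2 - 2 * K * Q i
      + (c + 2 * (c * (c * (K + 1))) + n * c + K * c
        + (2 * μ + 1) * (2 * (n * (c * (c * (K + 1)))) + n * c)) * Y) := by
      intro i
      rw [← Finset.mul_sum]
      exact mul_le_mul_of_nonneg_left (hcol i) (hg i)
    refine (Finset.sum_le_sum fun i _ => this i).trans (le_of_eq ?_)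
    simp only [mul_add, mul_sub, Finset.sum_add_distrib, Finset.sum_sub_distrib, ← Finset.sum_mul]
    have e1 : ∑ i, g i * (2 * K * Q i) = 2 * K * ∑ i, g i * Q i := by
      rw [Finset.mul_sum]; exact Finset.sum_congr rfl fun i _ => by ring
    rw [e1, ← hTdef]; ring
  have hQ' : -(2 * K * ∑ i, g i * Q i) ≤ 2 * K * (n * (c * (c * (2 + κ * K) * Y * T))) := by
    have := mul_le_mul_of_nonneg_left (abs_le.1 hQsum).1 (show 0 ≤ 2 * K by positivity)
    linarith
  refine le_of_mul_le_mul_right ?_ hT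
  have : 2 * S2 * T ≤ c * Y * T + 2 * K * (n * (c * (c * (2 + κ * K) * Y * T)))
      + (c + 2 * (c * (c * (K + 1))) + n * c + K * c
        + (2 * μ + 1) * (2 * (n * (c * (c * (K + 1)))) + n * c)) * Y * T := by linarith
  refine this.trans (le_of_eq ?_)
  ring

/-- The quantity `1 + ∑ |∂_i ∂_j w|`. -/
def hessSize (w : Euc n → ℝ) : ℝ := 1 + ∑ i, ∑ j, |pd i (pd j w) 0|

theorem one_le_hessSize (w : Euc n → ℝ) : 1 ≤ hessSize w := by
  have : 0 ≤ ∑ i, ∑ j, |pd i (pd j w) 0| :=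
    Finset.sum_nonneg fun i _ => Finset.sum_nonneg fun j _ => abs_nonneg _
  unfold hessSize; linarith

theorem abs_pd_pd_le_hessSize (w : Euc n → ℝ) (i j : Fin n) : |pd i (pd j w) 0| ≤ hessSize w := by
  have h1 : |pd i (pd j w) 0| ≤ ∑ j, |pd i (pd j w) 0| :=
    Finset.single_le_sum (f := fun j => |pd i (pd j w) 0|) (fun _ _ => abs_nonneg _)
      (Finset.mem_univ j)
  have h2 : ∑ j, |pd i (pd j w) 0| ≤ ∑ i, ∑ j, |pd i (pd j w) 0| :=
    Finset.single_le_sum (f := fun i => ∑ j, |pd i (pd j w) 0|)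
      (fun _ _ => Finset.sum_nonneg fun _ _ => abs_nonneg _) (Finset.mem_univ i)
  unfold hessSize; linarith

/-- A quadratic inequality for the Hessian bounds it. -/
theorem hessSize_le {w : Euc n → ℝ} {C : ℝ} (hC : 0 ≤ C)
    (h : 2 * ∑ i, ∑ j, pd i (pd j w) 0 ^ 2 ≤ C * hessSize w) : hessSize w ≤ 2 + n ^ 2 * C := by
  set X := ∑ i, ∑ j, |pd i (pd j w) 0| with hX
  have hX0 : 0 ≤ X := Finset.sum_nonneg fun i _ => Finset.sum_nonneg fun j _ => abs_nonneg _
  have hXs : X = ∑ q : Fin n × Fin n, |pd q.1 (pd q.2 w) 0| := by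
    rw [hX, Fintype.sum_prod_type]
  have hsq : X ^ 2 ≤ n ^ 2 * ∑ i, ∑ j, pd i (pd j w) 0 ^ 2 := by
    have := sq_sum_le_card_mul_sum_sq (s := (Finset.univ : Finset (Fin n × Fin n)))
      (f := fun q => |pd q.1 (pd q.2 w) 0|)
    simp only [sq_abs, Finset.card_univ, Fintype.card_prod, Fintype.card_fin] at this
    rw [hXs]
    refine this.trans (le_of_eq ?_)
    rw [Fintype.sum_prod_type]; push_cast; ring
  have e : hessSize w = 1 + X := rfl
  rw [e] at h ⊢
  rcases le_or_gt X 1 with h1 | h1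
  · have : 0 ≤ (n : ℝ) ^ 2 * C := by positivity
    linarith
  · have h2 : 2 * X ^ 2 ≤ n ^ 2 * C * (1 + X) := by
      have := mul_le_mul_of_nonneg_left h (show (0 : ℝ) ≤ n ^ 2 by positivity)
      linarith
    have h3 : n ^ 2 * C * (1 + X) ≤ 2 * (n ^ 2 * C) * X := by
      have : 0 ≤ (n : ℝ) ^ 2 * C := by positivity
      nlinarith
    have : X ≤ n ^ 2 * C := by nlinarith
    linarith

end MaximumPoint

section JetBounds

variable {n : ℕ} {G A : Euc n → Matrix (Fin n) (Fin n) ℝ} {B b : ℝ} {w : Euc n → ℝ}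

theorem pd_pd_pd_comm (hw : ContDiffAt ℝ 3 w 0) (a i : Fin n) :
    pd a (pd a (pd i w)) 0 = pd i (pd a (pd a w)) 0 := by
  have e : pd a (pd i w) =ᶠ[nhds 0] pd i (pd a w) := by
    filter_upwards [(hw.of_le (m := 2) (by norm_num)).eventually (by simp)] with z hz
    exact pd_comm hz a i
  rw [pd_congr e, pd_comm (contDiffAt_pd hw (m' := 2) (by norm_num) a)]

theorem pd2_pd_pd_comm (hw : ContDiffAt ℝ 4 w 0) (a i : Fin n) :
    pd2 a (pd i (pd i w)) 0 = pd2 i (pd a (pd a w)) 0 := by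
  have h3 : ∀ᶠ z in nhds 0, ContDiffAt ℝ 3 w z :=
    (hw.of_le (m := 3) (by norm_num)).eventually (by simp)
  have e1 : pd a (pd i (pd i w)) =ᶠ[nhds 0] pd i (pd i (pd a w)) := by
    filter_upwards [eventually_eventually_nhds.2 h3] with z hz
    have hz0 := hz.self_of_nhds
    have e : pd a (pd i w) =ᶠ[nhds z] pd i (pd a w) := by
      filter_upwards [hz] with y hy
      exact pd_comm (hy.of_le (by norm_num)) a i
    rw [pd_comm (contDiffAt_pd hz0 (m' := 2) (by norm_num) i), pd_congr e]
  have e2 : pd a (pd i (pd a w)) =ᶠ[nhds 0] pd i (pd a (pd a w)) := by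
    filter_upwards [h3] with z hz
    exact pd_comm (contDiffAt_pd hz (m' := 2) (by norm_num) a) a i
  have hai : ContDiffAt ℝ 2 (pd i (pd a w)) 0 :=
    contDiffAt_pd (contDiffAt_pd hw (m' := 3) (by norm_num) a) (by norm_num) i
  rw [pd2, pd_congr e1, pd_comm hai, pd_congr e2]
  rfl

namespace NormalAt

theorem abs_le_bound_nonneg [NeZero n] (h : NormalAt G A B) : 0 ≤ B :=
  (abs_nonneg _).trans (h.bdA 0 0)

variable (h : NormalAt G A B) (hw : ContDiffAt ℝ 4 w 0) (hb : ∀ i, |pd i w 0| ≤ b)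
include h hw hb

theorem abs_pd_lapl_sub_le (a : Fin n) :
    |pd a (lapl G w) 0 - ∑ i, pd a (pd i (pd i w)) 0| ≤ n * (n * (B * b)) := by
  rw [h.pd_lapl hw, ← Finset.sum_sub_distrib]
  refine abs_sum_le_mul fun i => ?_
  rw [h.pd_hess hw, sub_sub_cancel_left, abs_neg]
  exact abs_sum_mul_le (fun k => h.chr1 a k i i) hb

theorem abs_pd2_hess_sub_le (a i : Fin n) :
    |pd2 a (fun z => lhess G w z i i) 0 - pd2 a (pd i (pd i w)) 0|
      ≤ n * (B * b + 2 * (B * hessSize w)) := by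
  rw [h.pd2_hess hw, sub_sub_cancel_left, abs_neg]
  refine abs_sum_le_mul fun k => (abs_add_le _ _).trans (add_le_add ?_ ?_)
  · rw [abs_mul]
    exact mul_le_mul (h.chr2 a k i i) (hb k) (abs_nonneg _) ((abs_nonneg _).trans (h.bdA i i))
  · rw [abs_mul, abs_mul, abs_of_pos (two_pos : (0 : ℝ) < 2)]
    exact mul_le_mul_of_nonneg_left (mul_le_mul (h.chr1 a k i i) (abs_pd_pd_le_hessSize w a k)
      (abs_nonneg _) ((abs_nonneg _).trans (h.bdA i i))) two_pos.le

theorem abs_pd2_lapl_sub_le (a : Fin n) :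
    |pd2 a (lapl G w) 0 - ∑ i, pd2 a (pd i (pd i w)) 0|
      ≤ n * (n * (B * b + 2 * (B * hessSize w))) + n * (n * (B * hessSize w)) := by
  rw [h.pd2_lapl hw, add_sub_right_comm, ← Finset.sum_sub_distrib]
  refine (abs_add_le _ _).trans (add_le_add (abs_sum_le_mul fun i =>
    h.abs_pd2_hess_sub_le hw hb a i) (abs_sum_le_mul fun i => ?_))
  exact abs_sum_mul_le (fun j => h.inv2 a i j) (fun j => abs_pd_pd_le_hessSize w i j)

theorem abs_pd_gradSq_le (a : Fin n) : |pd a (lgradSq G w) 0| ≤ n * (2 * (b * hessSize w)) := by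
  rw [h.pd_gradSq hw]
  refine abs_sum_le_mul fun i => ?_
  rw [abs_mul, abs_mul, abs_of_pos (two_pos : (0 : ℝ) < 2)]
  exact mul_le_mul_of_nonneg_left (mul_le_mul (hb i) (abs_pd_pd_le_hessSize w a i)
      (abs_nonneg _) ((abs_nonneg _).trans (hb i))) two_pos.le

theorem abs_pd2_gradSq_sub_le (a : Fin n) :
    |pd2 a (lgradSq G w) 0 - 2 * ∑ i, pd a (pd i w) 0 ^ 2
      - 2 * ∑ i, pd i w 0 * pd a (pd a (pd i w)) 0| ≤ n * (n * (B * (b * b))) := by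
  have e : pd2 a (lgradSq G w) 0 - 2 * ∑ i, pd a (pd i w) 0 ^ 2
      - 2 * ∑ i, pd i w 0 * pd a (pd a (pd i w)) 0
      = ∑ i, ∑ j, pd2 a (fun z => (G z)⁻¹ i j) 0 * (pd i w 0 * pd j w 0) := by
    rw [h.pd2_gradSq hw, Finset.sum_add_distrib, ← Finset.mul_sum, ← Finset.mul_sum]
    simp only [pd2]; ring
  rw [e]
  refine abs_sum_le_mul fun i => abs_sum_mul_le (fun j => h.inv2 a i j) fun j => ?_
  rw [abs_mul]
  exact mul_le_mul (hb i) (hb j) (abs_nonneg _) ((abs_nonneg _).trans (hb i))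

theorem abs_pd_endo_sub_le {κ μ t : ℝ} (hμ : 0 ≤ μ) (ht : |t| ≤ 1) (a i : Fin n) :
    |pd a (fun z => endoMat G A κ μ t w z i i) 0 - pd a (pd i (pd i w)) 0
        - κ * pd a (lapl G w) 0|
      ≤ n * (B * b) + 2 * (b * hessSize w) + B + μ * (n * (2 * (b * hessSize w))) := by
  have e : pd a (fun z => endoMat G A κ μ t w z i i) 0 - pd a (pd i (pd i w)) 0
        - κ * pd a (lapl G w) 0
      = -∑ k, pd a (lchr G k i i) 0 * pd k w 0 - 2 * (pd i w 0 * pd a (pd i w) 0)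
        - t * pd a (fun z => A z i i) 0 + μ * pd a (lgradSq G w) 0 := by
    rw [h.pd_endo hw, h.pd_core hw, h.pd_hess hw]
    simp; ring
  rw [e]
  have h1 := abs_le.1 (abs_sum_mul_le (fun k => h.chr1 a k i i) hb)
  have h2 : |pd i w 0 * pd a (pd i w) 0| ≤ b * hessSize w := by
    rw [abs_mul]
    exact mul_le_mul (hb i) (abs_pd_pd_le_hessSize w a i) (abs_nonneg _)
      ((abs_nonneg _).trans (hb i))
  have h3 : |t * pd a (fun z => A z i i) 0| ≤ 1 * B := by
    rw [abs_mul]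
    exact mul_le_mul ht (h.bdA1 a i i) (abs_nonneg _) zero_le_one
  have h4 : |μ * pd a (lgradSq G w) 0| ≤ μ * (n * (2 * (b * hessSize w))) := by
    rw [abs_mul, abs_of_nonneg hμ]
    exact mul_le_mul_of_nonneg_left (h.abs_pd_gradSq_le hw hb a) hμ
  have h2 := abs_le.1 h2
  have h3 := abs_le.1 h3
  have h4 := abs_le.1 h4
  exact abs_le.2 ⟨by linarith, by linarith⟩

theorem abs_pd2_endo_sub_le {κ μ t : ℝ} (ht : |t| ≤ 1) (a i : Fin n) :
    |pd2 a (fun z => endoMat G A κ μ t w z i i) 0 - (pd2 a (pd i (pd i w)) 0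
        - 2 * pd a (pd i w) 0 ^ 2 - 2 * (pd i w 0 * pd a (pd a (pd i w)) 0)
        + κ * pd2 a (lapl G w) 0 + μ * pd2 a (lgradSq G w) 0)|
      ≤ n * (B * b + 2 * (B * hessSize w)) + B + n * (B * (hessSize w + b * b + B)) := by
  have e : pd2 a (fun z => endoMat G A κ μ t w z i i) 0 - (pd2 a (pd i (pd i w)) 0
        - 2 * pd a (pd i w) 0 ^ 2 - 2 * (pd i w 0 * pd a (pd a (pd i w)) 0)
        + κ * pd2 a (lapl G w) 0 + μ * pd2 a (lgradSq G w) 0)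
      = (pd2 a (fun z => lhess G w z i i) 0 - pd2 a (pd i (pd i w)) 0)
        - t * pd2 a (fun z => A z i i) 0
        + ∑ k, pd2 a (fun z => (G z)⁻¹ i k) 0 * coreMat G A t w 0 k i := by
    rw [h.pd2_endo hw, h.pd2_core hw]
    simp only [pd2]; ring
  rw [e]
  have h1 := abs_le.1 (h.abs_pd2_hess_sub_le hw hb a i)
  have h3 : ∀ x : ℝ, |x| ≤ B → |t * x| ≤ B := fun x hx => by
    rw [abs_mul]
    exact (mul_le_mul ht hx (abs_nonneg _) zero_le_one).trans (one_mul B).le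
  have h2 := abs_le.1 (h3 _ (h.bdA2 a i i))
  have h4 : |∑ k, pd2 a (fun z => (G z)⁻¹ i k) 0 * coreMat G A t w 0 k i|
      ≤ n * (B * (hessSize w + b * b + B)) := by
    refine abs_sum_mul_le (fun k => h.inv2 a i k) fun k => ?_
    have e : coreMat G A t w 0 k i = pd k (pd i w) 0 - pd k w 0 * pd i w 0 - t * A 0 k i := by
      rw [← h.hess_zero]; rfl
    rw [e]
    refine (abs_sub _ _).trans (add_le_add ((abs_sub _ _).trans (add_le_add
      (abs_pd_pd_le_hessSize w k i) ?_)) (h3 _ (h.bdA k i)))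
    rw [abs_mul]
    exact mul_le_mul (hb k) (hb i) (abs_nonneg _) ((abs_nonneg _).trans (hb k))
  have h4 := abs_le.1 h4
  exact abs_le.2 ⟨by linarith, by linarith⟩

end NormalAt

/-- The constant controlling the lower order terms in normal coordinates. -/
def jetConst (n : ℕ) (B b μ : ℝ) : ℝ :=
  b + n * (n * (B * b)) + (n * (n * (B * b + 2 * B)) + n * (n * B)) + n * (2 * b)
    + n * (n * (B * (b * b))) + (n * (B * b) + 2 * b + B + μ * (n * (2 * b)))
    + (n * (B * b + 2 * B) + B + n * (B * (1 + b * b + B)))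

/-- The bound obtained for the Hessian when all error terms are controlled by `c`. -/
def hessConst (n : ℕ) (c κ μ : ℝ) : ℝ :=
  2 + n ^ 2 * (c + 2 * ((μ + 1) / κ) * (n * (c * (c * (2 + κ * ((μ + 1) / κ)))))
      + (c + 2 * (c * (c * ((μ + 1) / κ + 1))) + n * c + ((μ + 1) / κ) * c
        + (2 * μ + 1) * (2 * (n * (c * (c * ((μ + 1) / κ + 1)))) + n * c)))

/-- The Hessian bound at a maximum point of `Δw + K |∇w|²`, given weights `p` for which the
linearized operator is controlled by `c₀`. -/
theorem NormalAt.hessSize_le [NeZero n] (h : NormalAt G A B) (hw : ContDiffAt ℝ 4 w 0)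
    (hb : ∀ i, |pd i w 0| ≤ b) {κ μ t c₀ : ℝ} (hκ : 0 < κ) (hμ : 0 ≤ μ) (ht : |t| ≤ 1)
    (hc₀ : 0 ≤ c₀) {p : Fin n → ℝ} (hp : ∀ i, 0 ≤ p i) (hT : 0 < ∑ i, p i)
    (hE1 : ∀ a, |∑ i, p i * pd a (fun z => endoMat G A κ μ t w z i i) 0| ≤ c₀ * ∑ i, p i)
    (hE2 : ∀ a, -(c₀ * hessSize w * ∑ i, p i)
      ≤ ∑ i, p i * pd2 a (fun z => endoMat G A κ μ t w z i i) 0)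
    (hmax : IsLocalMax (fun z => lapl G w z + (μ + 1) / κ * lgradSq G w z) 0) :
    hessSize w ≤ hessConst n (jetConst n B b μ + n * c₀) κ μ := by
  have hB : 0 ≤ B := h.abs_le_bound_nonneg
  have hb0 : 0 ≤ b := (abs_nonneg _).trans (hb 0)
  have hY := one_le_hessSize w
  set Y := hessSize w with hYdef
  set K := (μ + 1) / κ with hK
  have hK0 : 0 ≤ K := by positivity
  have hn1 : (1 : ℝ) ≤ n := by exact_mod_cast NeZero.one_le
  have hnc : c₀ ≤ n * c₀ := le_mul_of_one_le_left hc₀ hn1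
  set c := jetConst n B b μ + n * c₀ with hc
  have hsum : 0 ≤ n * c₀ := by positivity
  have t1 : 0 ≤ n * (n * (B * b)) := by positivity
  have t2 : 0 ≤ n * (n * (B * b + 2 * B)) + n * (n * B) := by positivity
  have t3 : 0 ≤ n * (2 * b) := by positivity
  have t4 : 0 ≤ n * (n * (B * (b * b))) := by positivity
  have t5 : 0 ≤ n * (B * b) + 2 * b + B + μ * (n * (2 * b)) := by positivity
  have t6 : 0 ≤ n * (B * b + 2 * B) + B + n * (B * (1 + b * b + B)) := by positivity
  have hc0 : 0 ≤ c := by rw [hc, jetConst]; linarith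
  have hY0 : 0 ≤ Y := by linarith
  have hd : ∀ x : ℝ, x ≤ c → x * Y ≤ c * Y := fun x hx => mul_le_mul_of_nonneg_right hx hY0
  have hNc := h.contDiffAt_gradSq hw
  have hΔc := h.contDiffAt_lapl hw
  refine KrylovEq.hessSize_le (by positivity) ?_
  refine hessian_bound_of_jets (w1 := fun i => pd i w 0) (w2 := fun a i => pd a (pd i w) 0)
    (w3 := fun a i j => pd a (pd i (pd j w)) 0) (w4 := fun a i => pd2 a (pd i (pd i w)) 0)
    (dΔ := fun a => pd a (lapl G w) 0) (ddΔ := fun a => pd2 a (lapl G w) 0)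
    (dN := fun a => pd a (lgradSq G w) 0) (ddN := fun a => pd2 a (lgradSq G w) 0)
    (W1 := fun a i => pd a (fun z => endoMat G A κ μ t w z i i) 0)
    (W2 := fun a i => pd2 a (fun z => endoMat G A κ μ t w z i i) 0)
    (g := p) hc0 hμ hκ.le hK0 (by field_simp [hK]) hY
    (fun i j => pd_comm (hw.of_le (by norm_num)) i j)
    (fun a i => pd_pd_pd_comm (hw.of_le (by norm_num)) a i) (fun a i => pd2_pd_pd_comm hw a i)
    (fun i => (hb i).trans (by rw [hc, jetConst]; linarith))
    (fun a => (h.abs_pd_lapl_sub_le hw hb a).trans (by rw [hc, jetConst]; linarith))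
    (fun a => (h.abs_pd2_lapl_sub_le hw hb a).trans ?_)
    (fun a => (h.abs_pd_gradSq_le hw hb a).trans ?_)
    (fun a => (h.abs_pd2_gradSq_sub_le hw hb a).trans (by rw [hc, jetConst]; linarith))
    (fun a i => (h.abs_pd_endo_sub_le hw hb hμ ht a i).trans ?_)
    (fun a i => (h.abs_pd2_endo_sub_le hw hb ht a i).trans ?_) hp hT
    (fun a => (hE1 a).trans ?_) ?_ ?_ ?_
  · refine le_trans ?_ (hd (n * (n * (B * b + 2 * B)) + n * (n * B))
      (by rw [hc, jetConst]; linarith))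
    have : 0 ≤ n * (n * (B * b)) * (Y - 1) := mul_nonneg t1 (by linarith)
    rw [← hYdef]; linarith
  · refine le_trans (le_of_eq ?_) (hd (n * (2 * b)) (by rw [hc, jetConst]; linarith))
    ring
  · refine le_trans ?_ (hd (n * (B * b) + 2 * b + B + μ * (n * (2 * b)))
      (by rw [hc, jetConst]; linarith))
    have : 0 ≤ (n * (B * b) + B) * (Y - 1) := mul_nonneg (by positivity) (by linarith)
    rw [← hYdef]; linarith
  · refine le_trans ?_ (hd (n * (B * b + 2 * B) + B + n * (B * (1 + b * b + B)))
      (by rw [hc, jetConst]; linarith))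
    have : 0 ≤ (n * (B * b) + B + n * (B * (b * b + B))) * (Y - 1) :=
      mul_nonneg (by positivity) (by linarith)
    rw [← hYdef]; linarith
  · refine mul_le_mul_of_nonneg_right ?_ hT.le
    rw [hc, jetConst]; linarith
  · have : ∑ _a : Fin n, -(c₀ * Y * ∑ i, p i) ≤ ∑ a, ∑ i, p i *
        pd2 a (fun z => endoMat G A κ μ t w z i i) 0 := Finset.sum_le_sum fun a _ => hE2 a
    refine le_trans ?_ this
    rw [Finset.sum_const, Finset.card_univ, Fintype.card_fin, nsmul_eq_mul]
    have : 0 ≤ jetConst n B b μ * Y * ∑ i, p i := by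
      have : 0 ≤ jetConst n B b μ := by rw [jetConst]; linarith
      positivity
    rw [hc]; linarith
  · intro a
    have := pd_eq_zero_of_isLocalMax hmax a
    rwa [pd_add (f' := fun z => K * lgradSq G w z) (hΔc.differentiableAt two_ne_zero)
      ((hNc.differentiableAt two_ne_zero).const_mul K),
      pd_const_mul (hNc.differentiableAt two_ne_zero)] at this
  · intro a
    have := pd2_nonpos_of_isLocalMax (hΔc.add (contDiffAt_const.mul hNc)) hmax a
    rwa [pd2_add hΔc (contDiffAt_const.mul hNc), pd2_const_mul hNc] at this

end JetBounds

/-! ### Differentiating the equation twice -/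

section Linearization

variable {n : ℕ}

theorem pd_exp {f : Euc n → ℝ} {y : Euc n} (hf : DifferentiableAt ℝ f y) (a : Fin n) :
    pd a (fun z => Real.exp (f z)) y = Real.exp (f y) * pd a f y := by
  rw [pd, hf.hasFDerivAt.exp.fderiv]; rfl

theorem pd2_exp {f : Euc n → ℝ} {y : Euc n} (hf : ContDiffAt ℝ 2 f y) (a : Fin n) :
    pd2 a (fun z => Real.exp (f z)) y = Real.exp (f y) * (pd a f y ^ 2 + pd2 a f y) := by
  have e : pd a (fun z => Real.exp (f z)) =ᶠ[nhds y] fun z => Real.exp (f z) * pd a f z := by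
    filter_upwards [eventually_differentiableAt hf] with z hz
    exact pd_exp hz a
  have hd := hf.differentiableAt two_ne_zero
  rw [pd2, pd_congr e, pd_mul hd.exp (contDiffAt_two_pd hf a), pd_exp hd, pd2]
  ring

/-- A function of a matrix field which is touched from above by an affine function of the diagonal
satisfies a one-sided second-order chain rule. -/
theorem pd_pd2_of_support {Q : (Fin n → Fin n → ℝ) → ℝ} {W : Euc n → Fin n → Fin n → ℝ}
    {p x : Fin n → ℝ} (hW0 : ∀ i j, W 0 i j = Matrix.diagonal x i j)
    (hQ : ContDiffAt ℝ 2 Q (W 0)) (hT : ∀ A, Q (fun i j => A j i) = Q A)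
    (hW : ∀ i j, ContDiffAt ℝ 2 (fun z => W z i j) 0)
    (hsym : ∀ a i j, pd a (fun z => W z i j) 0 = pd a (fun z => W z j i) 0)
    (hsup : ∀ᶠ A in nhds (W 0), (∀ i j, A i j = A j i) →
      Q A ≤ Q (W 0) + ∑ i, p i * (A i i - x i)) (a : Fin n) :
    pd a (fun z => Q (W z)) 0 = ∑ i, p i * pd a (fun z => W z i i) 0 ∧
      pd2 a (fun z => Q (W z)) 0 ≤ ∑ i, p i * pd2 a (fun z => W z i i) 0 := by
  set L : ℝ → Euc n := fun s => s • EuclideanSpace.single a (1 : ℝ) with hL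
  have hL0 : L 0 = 0 := zero_smul _ _
  have hLc : ContDiff ℝ 2 L := contDiff_id.smul contDiff_const
  have hWc : ContDiffAt ℝ 2 W 0 := contDiffAt_pi.2 fun i => contDiffAt_pi.2 fun j => hW i j
  have hf : ContDiffAt ℝ 2 (fun z => Q (W z)) 0 := hQ.comp (0 : Euc n) hWc
  have hγ : ContDiffAt ℝ 2 (fun s => W (L s)) 0 :=
    ContDiffAt.comp (0 : ℝ) (by rw [hL0]; exact hWc) hLc.contDiffAt
  have hcomp : ∀ᶠ s in nhds (0 : ℝ), DifferentiableAt ℝ (fun s => W (L s)) s :=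
    (hγ.eventually (by simp)).mono fun s hs => hs.differentiableAt two_ne_zero
  have hev : ∀ i j, (fun s => deriv (fun s => W (L s)) s i j) =ᶠ[nhds 0]
      deriv fun s => W (L s) i j := by
    intro i j
    filter_upwards [hcomp] with s hs
    exact (hasDerivAt_pi.1 (hasDerivAt_pi.1 hs.hasDerivAt i) j).deriv.symm
  have d1 : ∀ i j, deriv (fun s => W (L s)) 0 i j = pd a (fun z => W z i j) 0 := fun i j => by
    rw [← (deriv_line (hW i j) a).1.deriv]; exact (hev i j).self_of_nhds
  have d2 : ∀ i j, deriv (deriv fun s => W (L s)) 0 i j = pd2 a (fun z => W z i j) 0 := by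
    intro i j
    rw [← (deriv_line (hW i j) a).2.deriv, ← (hev i j).deriv_eq]
    exact (hasDerivAt_pi.1 (hasDerivAt_pi.1 (hasDerivAt_deriv_of_contDiffAt hγ) i) j).deriv.symm
  have hdiag : ∀ i j, W 0 i j = W 0 j i := fun i j => by
    rw [hW0, hW0]; exact congrFun (congrFun (Matrix.diagonal_transpose x) j) i
  have := deriv_deriv_le_of_support (Q := Q) (γ := fun s => W (L s)) (p := p)
    (by simpa only [hL0] using hQ) hT hγ (by simpa only [hL0] using hdiag)
    (fun i j => by rw [d1, d1, hsym]) (by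
      simp only [hL0]
      filter_upwards [hsup] with A hA hs
      have := hA hs
      simpa only [hW0, Matrix.diagonal_apply_eq] using this)
  simp only [d1, d2] at this
  rw [← (deriv_line hf a).1.deriv, ← (deriv_line hf a).2.deriv]
  exact this

/-- The linearized equation. If `σ_{m+1}/σ_m - ∑ β_l σ_l/σ_m = -ρ` along a matrix field whose value
at `0` is diagonal with eigenvalues in `Γ_m`, then some nonnegative weights `p` (the linearization
of the operator at `0`) control the first and second derivatives of the diagonal entries. The
second-order inequality combines concavity of `σ_{m+1}/σ_m` and of `log (σ_m/σ_l)`; the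
square from the latter absorbs the mixed term `2 ∂β_l ∂(σ_l/σ_m)`. -/
theorem exists_linearization {m : ℕ} (hm : m + 1 ≤ n) {W : Euc n → Fin n → Fin n → ℝ}
    {x : Fin n → ℝ} (hW0 : ∀ i j, W 0 i j = Matrix.diagonal x i j) (hx : x ∈ gam Finset.univ m)
    (hW : ∀ i j, ContDiffAt ℝ 2 (fun z => W z i j) 0)
    (hsym : ∀ a i j, pd a (fun z => W z i j) 0 = pd a (fun z => W z j i) 0)
    {β : ℕ → Euc n → ℝ} {ρ : Euc n → ℝ} (hβ : ∀ l < m, ContDiffAt ℝ 2 (β l) 0)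
    (hβ0 : ∀ l < m, 0 < β l 0) (hρ : ContDiffAt ℝ 2 ρ 0)
    (heq : ∀ᶠ z in nhds 0, charSigma (m + 1) (Matrix.of (W z)) / charSigma m (Matrix.of (W z))
      - (∑ l ∈ Finset.range m, β l z * charSigma l (Matrix.of (W z)))
        / charSigma m (Matrix.of (W z)) = -ρ z)
    {Ψ d₁ d₂ : ℝ} (hΨ : ∀ l < m, es Finset.univ l x / es Finset.univ m x ≤ Ψ)
    (hd₁ : ∀ l < m, ∀ a, |pd a (β l) 0| ≤ d₁)
    (hd₂ : ∀ l < m, ∀ a, pd a (β l) 0 ^ 2 / β l 0 - pd2 a (β l) 0 ≤ d₂) (hd₂0 : 0 ≤ d₂)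
    (hρ₁ : ∀ a, |pd a ρ 0| ≤ d₁) (hρ₂ : ∀ a, pd2 a ρ 0 ≤ d₂) :
    ∃ p : Fin n → ℝ, (∀ i, 0 ≤ p i) ∧
      es Finset.univ (m + 1) (fun _ : Fin n => (1 : ℝ)) / es Finset.univ m (fun _ : Fin n => 1)
        ≤ ∑ i, p i ∧
      (∀ a, |∑ i, p i * pd a (fun z => W z i i) 0| ≤ (m * Ψ + 1) * d₁) ∧
      (∀ a, -((m * Ψ + 1) * d₂) ≤ ∑ i, p i * pd2 a (fun z => W z i i) 0) := by
  classical
  obtain ⟨p, hp0, hpsum, hp⟩ := exists_charSigma_quotient_support hm hx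
  have hlog : ∀ l, ∃ r : Fin n → ℝ, (∀ i, 0 ≤ r i) ∧ (l < m →
      ∀ A : Matrix (Fin n) (Fin n) ℝ, A.IsSymm → (∀ j ≤ m, 0 < charSigma j A) →
        Real.log (charSigma m A / charSigma l A)
          ≤ Real.log (charSigma m (Matrix.diagonal x) / charSigma l (Matrix.diagonal x))
            + ∑ i, r i * (A i i - x i)) := by
    intro l
    by_cases hl : l < m
    · obtain ⟨r, h1, h2⟩ := exists_log_charSigma_quotient_support hl.le (by omega) hx
      exact ⟨r, h1, fun _ => h2⟩
    · exact ⟨0, fun _ => le_rfl, fun h => absurd h hl⟩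
  choose r hr0 hr using hlog
  have hW0' : Matrix.of (W 0) = Matrix.diagonal x := by ext i j; exact hW0 i j
  have hWc : ContDiffAt ℝ 2 W 0 := contDiffAt_pi.2 fun i => contDiffAt_pi.2 fun j => hW i j
  set σ : ℕ → (Fin n → Fin n → ℝ) → ℝ := fun j A => charSigma j (Matrix.of A) with hσ
  have hσc : ∀ j, ContDiff ℝ 2 (σ j) := fun j => contDiff_charSigma j
  have hσT : ∀ j A, σ j (fun i k => A k i) = σ j A := fun j A => charSigma_transpose j (Matrix.of A)
  have hσx : ∀ j ≤ m, σ j (W 0) = es Finset.univ j x := fun j hj => by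
    rw [← charSigma_diagonal (by omega) x, ← hW0']
  have hσ0 : ∀ j ≤ m, 0 < σ j (W 0) := fun j hj => by rw [hσx j hj]; exact hx j hj
  have hposA : ∀ᶠ A in nhds (W 0), ∀ j ≤ m, 0 < σ j A := by
    have : ∀ᶠ A in nhds (W 0), ∀ j ∈ Finset.range (m + 1), 0 < σ j A :=
      (Filter.eventually_all_finset _).2 fun j hj =>
        (hσc j).continuous.continuousAt.eventually_const_lt
          (hσ0 j (by simpa [Nat.lt_succ_iff] using hj))
    filter_upwards [this] with A hA j hj
    exact hA j (by simpa [Nat.lt_succ_iff] using hj)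
  have hposW : ∀ᶠ z in nhds 0, ∀ j ≤ m, 0 < σ j (W z) := hWc.continuousAt.eventually hposA
  -- the two families of concave functions
  set q : Euc n → ℝ := fun z => σ (m + 1) (W z) / σ m (W z) with hq
  set f : ℕ → Euc n → ℝ := fun l z => Real.log (σ m (W z) / σ l (W z)) with hf
  have hqQ : ContDiffAt ℝ 2 (fun A => σ (m + 1) A / σ m A) (W 0) :=
    (hσc _).contDiffAt.div (hσc _).contDiffAt (hσ0 m le_rfl).ne'
  have hfQ : ∀ l < m, ContDiffAt ℝ 2 (fun A => Real.log (σ m A / σ l A)) (W 0) := fun l hl =>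
    ((hσc _).contDiffAt.div (hσc _).contDiffAt (hσ0 l hl.le).ne').log
      (div_pos (hσ0 m le_rfl) (hσ0 l hl.le)).ne'
  have hq12 : ∀ a, pd a q 0 = ∑ i, p i * pd a (fun z => W z i i) 0 ∧
      pd2 a q 0 ≤ ∑ i, p i * pd2 a (fun z => W z i i) 0 := by
    refine pd_pd2_of_support (Q := fun A => σ (m + 1) A / σ m A) hW0 hqQ
      (fun A => congrArg₂ (· / ·) (hσT _ A) (hσT _ A)) hW hsym ?_
    filter_upwards [hposA] with A hA hs
    have := hp (Matrix.of A) (by ext i j; exact hs j i) hA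
    rw [← hW0'] at this
    exact this
  have hf12 : ∀ l < m, ∀ a, pd a (f l) 0 = ∑ i, r l i * pd a (fun z => W z i i) 0 ∧
      pd2 a (f l) 0 ≤ ∑ i, r l i * pd2 a (fun z => W z i i) 0 := by
    intro l hl
    refine pd_pd2_of_support (Q := fun A => Real.log (σ m A / σ l A)) hW0 (hfQ l hl)
      (fun A => congrArg Real.log (congrArg₂ (· / ·) (hσT _ A) (hσT _ A))) hW hsym ?_
    filter_upwards [hposA] with A hA hs
    have := hr l hl (Matrix.of A) (by ext i j; exact hs j i) hA
    rw [← hW0'] at this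
    exact this
  have hfc : ∀ l < m, ContDiffAt ℝ 2 (f l) 0 := fun l hl =>
    ContDiffAt.comp (0 : Euc n) (hfQ l hl) hWc
  set ψ : ℕ → ℝ := fun l => Real.exp (-f l 0) with hψ
  have hψx : ∀ l < m, ψ l ≤ Ψ := fun l hl => by
    have h1 : ψ l = es Finset.univ l x / es Finset.univ m x := by
      simp only [hψ, hf]
      rw [Real.exp_neg, Real.exp_log (div_pos (hσ0 m le_rfl) (hσ0 l hl.le)), inv_div,
        hσx l hl.le, hσx m le_rfl]
    rw [h1]; exact hΨ l hl
  have hψ0 : ∀ l, 0 < ψ l := fun l => Real.exp_pos _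
  have heq' : q =ᶠ[nhds 0] fun z => ∑ l ∈ Finset.range m, β l z * Real.exp (-f l z) - ρ z := by
    filter_upwards [heq, hposW] with z h1 h2
    have e : ∀ l ∈ Finset.range m, β l z * Real.exp (-f l z) = β l z * σ l (W z) / σ m (W z) := by
      intro l hl
      have hl := Finset.mem_range.1 hl
      simp only [hf]
      rw [Real.exp_neg, Real.exp_log (div_pos (h2 m le_rfl) (h2 l hl.le)), inv_div, mul_div_assoc]
    rw [Finset.sum_congr rfl e, ← Finset.sum_div]
    simp only [hq, hσ]
    linarith
  have hfneg : ∀ l < m, ContDiffAt ℝ 2 (fun z => -f l z) 0 := fun l hl => (hfc l hl).neg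
  have hterm : ∀ l ∈ Finset.range m, ContDiffAt ℝ 2 (fun z => β l z * Real.exp (-f l z)) 0 :=
    fun l hl => (hβ l (Finset.mem_range.1 hl)).mul (hfneg l (Finset.mem_range.1 hl)).exp
  have hneg : ∀ l < m, ∀ a, pd a (fun z => -f l z) 0 = -pd a (f l) 0 ∧
      pd2 a (fun z => -f l z) 0 = -pd2 a (f l) 0 := by
    intro l hl a
    have e : (fun z => -f l z) = fun z => (-1) * f l z := by ext z; ring
    rw [e, pd_const_mul ((hfc l hl).differentiableAt two_ne_zero), pd2_const_mul (hfc l hl)]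
    constructor <;> ring
  have hq1 : ∀ a, pd a q 0 + ∑ l ∈ Finset.range m, β l 0 * ψ l * pd a (f l) 0
      = ∑ l ∈ Finset.range m, pd a (β l) 0 * ψ l - pd a ρ 0 := by
    intro a
    rw [pd_congr heq', pd_sub (DifferentiableAt.fun_sum fun l hl =>
      (hterm l hl).differentiableAt two_ne_zero) (hρ.differentiableAt two_ne_zero),
      pd_sum fun l hl => (hterm l hl).differentiableAt two_ne_zero]
    have e : ∀ l ∈ Finset.range m, pd a (fun z => β l z * Real.exp (-f l z)) 0
        = pd a (β l) 0 * ψ l - β l 0 * ψ l * pd a (f l) 0 := by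
      intro l hl
      have hl := Finset.mem_range.1 hl
      rw [pd_mul ((hβ l hl).differentiableAt two_ne_zero)
        ((hfneg l hl).exp.differentiableAt two_ne_zero),
        pd_exp ((hfneg l hl).differentiableAt two_ne_zero), (hneg l hl a).1]
      simp only [hψ]; ring
    rw [Finset.sum_congr rfl e, Finset.sum_sub_distrib]
    ring
  have hq2 : ∀ a, pd2 a q 0 + ∑ l ∈ Finset.range m, β l 0 * ψ l * pd2 a (f l) 0
      = ∑ l ∈ Finset.range m, ψ l * (pd2 a (β l) 0 - 2 * pd a (β l) 0 * pd a (f l) 0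
          + β l 0 * pd a (f l) 0 ^ 2) - pd2 a ρ 0 := by
    intro a
    rw [pd2_congr heq', pd2_sub (ContDiffAt.sum hterm) hρ, pd2_sum hterm]
    have e : ∀ l ∈ Finset.range m, pd2 a (fun z => β l z * Real.exp (-f l z)) 0
        = ψ l * (pd2 a (β l) 0 - 2 * pd a (β l) 0 * pd a (f l) 0 + β l 0 * pd a (f l) 0 ^ 2)
          - β l 0 * ψ l * pd2 a (f l) 0 := by
      intro l hl
      have hl := Finset.mem_range.1 hl
      rw [pd2_mul (hβ l hl) (hfneg l hl).exp, pd_exp ((hfneg l hl).differentiableAt two_ne_zero),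
        pd2_exp (hfneg l hl), (hneg l hl a).1, (hneg l hl a).2]
      simp only [hψ]; ring
    rw [Finset.sum_congr rfl e, Finset.sum_sub_distrib]
    ring
  have hcard : ∀ {v : ℕ → ℝ} {d : ℝ}, (∀ l < m, v l ≤ d) → ∑ l ∈ Finset.range m, v l ≤ m * d := by
    intro v d hv
    refine (Finset.sum_le_sum fun l hl => hv l (Finset.mem_range.1 hl)).trans (le_of_eq ?_)
    simp
  have hswap : ∀ v : Fin n → ℝ,
      ∑ i, (p i + ∑ l ∈ Finset.range m, β l 0 * ψ l * r l i) * v i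
        = ∑ i, p i * v i + ∑ l ∈ Finset.range m, β l 0 * ψ l * ∑ i, r l i * v i := by
    intro v
    simp only [add_mul, Finset.sum_add_distrib, Finset.sum_mul, Finset.mul_sum]
    rw [Finset.sum_comm]
    simp only [mul_assoc]
  have hp' : ∀ i, p i ≤ p i + ∑ l ∈ Finset.range m, β l 0 * ψ l * r l i := fun i =>
    le_add_of_nonneg_right (Finset.sum_nonneg fun l hl =>
      mul_nonneg (mul_nonneg (hβ0 l (Finset.mem_range.1 hl)).le (hψ0 l).le) (hr0 l i))
  refine ⟨fun i => p i + ∑ l ∈ Finset.range m, β l 0 * ψ l * r l i, fun i => (hp0 i).trans (hp' i),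
    hpsum.trans (Finset.sum_le_sum fun i _ => hp' i), fun a => ?_, fun a => ?_⟩
  · rw [hswap, ← (hq12 a).1]
    have e : ∀ l ∈ Finset.range m, β l 0 * ψ l * ∑ i, r l i * pd a (fun z => W z i i) 0
        = β l 0 * ψ l * pd a (f l) 0 := fun l hl => by
      rw [(hf12 l (Finset.mem_range.1 hl) a).1]
    rw [Finset.sum_congr rfl e, hq1 a]
    have h1 : |∑ l ∈ Finset.range m, pd a (β l) 0 * ψ l| ≤ m * (d₁ * Ψ) := by
      refine (Finset.abs_sum_le_sum_abs _ _).trans (hcard fun l hl => ?_)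
      rw [abs_mul, abs_of_pos (hψ0 l)]
      exact mul_le_mul (hd₁ l hl a) (hψx l hl) (hψ0 l).le ((abs_nonneg _).trans (hρ₁ a))
    refine (abs_sub _ _).trans ((add_le_add h1 (hρ₁ a)).trans (le_of_eq ?_))
    ring
  · rw [hswap]
    have h1 : ∑ l ∈ Finset.range m, β l 0 * ψ l * pd2 a (f l) 0
        ≤ ∑ l ∈ Finset.range m, β l 0 * ψ l * ∑ i, r l i * pd2 a (fun z => W z i i) 0 :=
      Finset.sum_le_sum fun l hl => mul_le_mul_of_nonneg_left
        (hf12 l (Finset.mem_range.1 hl) a).2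
        (mul_nonneg (hβ0 l (Finset.mem_range.1 hl)).le (hψ0 l).le)
    refine le_trans ?_ (add_le_add (hq12 a).2 h1)
    rw [hq2 a]
    have h2 : ∑ l ∈ Finset.range m, -(ψ l * (pd2 a (β l) 0 - 2 * pd a (β l) 0 * pd a (f l) 0
          + β l 0 * pd a (f l) 0 ^ 2)) ≤ m * (Ψ * d₂) := by
      refine hcard fun l hl => ?_
      rw [← mul_neg]
      have hb := hβ0 l hl
      -- completing the square in `∂ log (σ_m/σ_l)`
      have h3 : -(pd2 a (β l) 0 - 2 * pd a (β l) 0 * pd a (f l) 0 + β l 0 * pd a (f l) 0 ^ 2)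
          ≤ d₂ := by
        refine le_trans ?_ (hd₂ l hl a)
        have : pd a (β l) 0 ^ 2 / β l 0 - 2 * pd a (β l) 0 * pd a (f l) 0
            + β l 0 * pd a (f l) 0 ^ 2 = β l 0 * (pd a (f l) 0 - pd a (β l) 0 / β l 0) ^ 2 := by
          field_simp; ring
        have : 0 ≤ β l 0 * (pd a (f l) 0 - pd a (β l) 0 / β l 0) ^ 2 := by positivity
        linarith
      exact (mul_le_mul_of_nonneg_left h3 (hψ0 l).le).trans
        (mul_le_mul_of_nonneg_right (hψx l hl) hd₂0)
    rw [Finset.sum_neg_distrib] at h2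
    have := hρ₂ a
    nlinarith

end Linearization

/-! ### The local Hessian estimate -/

section LocalEstimate

variable {n : ℕ}

theorem mul_es_le_es_succ {ι : Type*} [DecidableEq ι] {s : Finset ι} {x : ι → ℝ} {m : ℕ} {y : ℝ}
    (hx : x ∈ gam s (m + 1)) (hy : y * es s m x ≤ es s (m + 1) x) {j : ℕ} (hj : j ≤ m) :
    y * es s j x ≤ es s (j + 1) x := by
  induction hj using Nat.decreasingInduction with
  | self => exact hy
  | of_succ j hj ih =>
    have h0 := hx j (by omega)
    have h1 := hx (j + 1) (by omega)
    have := es_quotient_succ_le (gam_anti _ (by omega) hx : x ∈ gam s (j + 1))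
    have h2 : y ≤ es s (j + 2) x / es s (j + 1) x := (le_div_iff₀ h1).2 ih
    exact (le_div_iff₀ h0).1 (h2.trans this)

theorem pow_mul_es_le_es {ι : Type*} [DecidableEq ι] {s : Finset ι} {x : ι → ℝ} {m : ℕ} {y : ℝ}
    (hx : x ∈ gam s (m + 1)) (hy0 : 0 ≤ y) (hy : y * es s m x ≤ es s (m + 1) x) {j : ℕ}
    (hj : j ≤ m + 1) : y ^ (m + 1 - j) * es s j x ≤ es s (m + 1) x := by
  induction hj using Nat.decreasingInduction with
  | self => simp
  | of_succ j hj ih =>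
    refine le_trans ?_ ih
    rw [show m + 1 - j = (m + 1 - (j + 1)) + 1 by omega, pow_succ, mul_assoc]
    exact mul_le_mul_of_nonneg_left (mul_es_le_es_succ hx hy (by omega)) (pow_nonneg hy0 _)

/-- The equation bounds `σ_l/σ_m` for `l < m`: since `σ_{m+1}/σ_m ≤ σ_m/σ_{m-1}`, the
term with `l = m - 1` alone keeps `σ_m/σ_{m-1}` away from zero. -/
theorem es_div_le_of_eq {ι : Type*} [DecidableEq ι] {s : Finset ι} {x : ι → ℝ} {m : ℕ}
    (hx : x ∈ gam s (m + 1)) {β : ℕ → ℝ} {ρ b₀ ρ₀ : ℝ} (hb₀ : 0 < b₀)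
    (hβ : ∀ l < m + 1, b₀ ≤ β l) (hρ : ρ ≤ ρ₀) (hρ₀ : 0 ≤ ρ₀)
    (heq : es s (m + 2) x / es s (m + 1) x
      - (∑ l ∈ Finset.range (m + 1), β l * es s l x) / es s (m + 1) x = -ρ) {l : ℕ}
    (hl : l < m + 1) :
    es s l x / es s (m + 1) x ≤ (1 / min 1 (b₀ / (1 + ρ₀))) ^ (m + 1) := by
  set y := min 1 (b₀ / (1 + ρ₀)) with hydef
  have hy0 : 0 < y := lt_min one_pos (by positivity)
  have hm := hx m (by omega)
  have hm1 := hx (m + 1) le_rfl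
  have hq := es_quotient_succ_le hx
  set Y := es s (m + 1) x / es s m x with hY
  have hY0 : 0 < Y := div_pos hm1 hm
  have h1 : b₀ * es s m x ≤ ∑ l ∈ Finset.range (m + 1), β l * es s l x := by
    refine (mul_le_mul_of_nonneg_right (hβ m (by omega)) hm.le).trans ?_
    refine Finset.single_le_sum (f := fun l => β l * es s l x) (fun i hi => ?_) (by simp)
    have hi := Finset.mem_range.1 hi
    exact mul_nonneg (hb₀.le.trans (hβ i hi)) (hx i (by omega)).le
  have h2 : b₀ / Y ≤ Y + ρ₀ := by
    have e : b₀ / Y = b₀ * es s m x / es s (m + 1) x := by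
      rw [hY]; field_simp
    have := (div_le_div_iff_of_pos_right hm1).2 h1
    rw [e]; linarith
  have h3 : y ≤ Y := by
    rcases le_or_gt 1 Y with h | h
    · exact (min_le_left _ _).trans h
    · refine (min_le_right _ _).trans ?_
      rw [div_le_iff₀ (by positivity)]
      have := (div_le_iff₀ hY0).1 h2
      nlinarith
  have h4 := pow_mul_es_le_es hx hy0.le ((le_div_iff₀ hm).1 h3) hl.le
  have h5 : y ^ (m + 1) ≤ y ^ (m + 1 - l) :=
    pow_le_pow_of_le_one hy0.le (min_le_left _ _) (by omega)
  rw [div_le_iff₀ hm1, one_div, inv_pow, ← div_eq_inv_mul, le_div_iff₀ (by positivity)]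
  have := mul_le_mul_of_nonneg_right h5 (hx l (by omega)).le
  linarith

section Coefficients

variable {φ w : Euc n → ℝ} {y : Euc n} (hφ : ContDiffAt ℝ 2 φ y) (hw : ContDiffAt ℝ 2 w y) (s : ℝ)
  (a : Fin n)
include hφ hw

theorem pd_mul_exp : pd a (fun z => φ z * Real.exp (s * w z)) y
    = Real.exp (s * w y) * (pd a φ y + s * φ y * pd a w y) := by
  have hs : ContDiffAt ℝ 2 (fun z => s * w z) y := contDiffAt_const.mul hw
  rw [pd_mul (hφ.differentiableAt two_ne_zero) (hs.exp.differentiableAt two_ne_zero),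
    pd_exp (hs.differentiableAt two_ne_zero), pd_const_mul (hw.differentiableAt two_ne_zero)]
  ring

theorem pd2_mul_exp : pd2 a (fun z => φ z * Real.exp (s * w z)) y
    = Real.exp (s * w y) * (pd2 a φ y + 2 * s * (pd a φ y * pd a w y)
      + φ y * (s ^ 2 * pd a w y ^ 2 + s * pd2 a w y)) := by
  have hs : ContDiffAt ℝ 2 (fun z => s * w z) y := contDiffAt_const.mul hw
  rw [pd2_mul hφ hs.exp, pd_exp (hs.differentiableAt two_ne_zero), pd2_exp hs,
    pd_const_mul (hw.differentiableAt two_ne_zero), pd2_const_mul hw]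
  ring

variable {s a} {D b S Y : ℝ} (hD0 : |φ y| ≤ D) (hD1 : |pd a φ y| ≤ D) (hs : |s| ≤ S)
  (hw0 : |w y| ≤ b) (hw1 : |pd a w y| ≤ b)
include hs hw0

omit hφ hw in
theorem exp_mul_le : Real.exp (s * w y) ≤ Real.exp (S * b) := by
  refine Real.exp_le_exp.2 ((le_abs_self _).trans ?_)
  rw [abs_mul]
  exact mul_le_mul hs hw0 (abs_nonneg _) ((abs_nonneg _).trans hs)

include hD0 hD1 hw1

theorem abs_pd_mul_exp_le :
    |pd a (fun z => φ z * Real.exp (s * w z)) y| ≤ Real.exp (S * b) * (D + S * D * b) := by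
  have hS : 0 ≤ S := (abs_nonneg _).trans hs
  have hD : 0 ≤ D := (abs_nonneg _).trans hD0
  rw [pd_mul_exp hφ hw, abs_mul, Real.abs_exp]
  refine mul_le_mul (exp_mul_le hs hw0) ((abs_add_le _ _).trans (add_le_add hD1 ?_))
    (abs_nonneg _) (Real.exp_pos _).le
  rw [abs_mul, abs_mul]
  gcongr

theorem abs_pd2_mul_exp_le (hD2 : |pd2 a φ y| ≤ D) (hY : 1 ≤ Y) (hw2 : |pd2 a w y| ≤ Y) :
    |pd2 a (fun z => φ z * Real.exp (s * w z)) y|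
      ≤ Real.exp (S * b) * (D + 2 * S * (D * b) + D * (S ^ 2 * b ^ 2 + S)) * Y := by
  have hS : 0 ≤ S := (abs_nonneg _).trans hs
  have hD : 0 ≤ D := (abs_nonneg _).trans hD0
  have hb : 0 ≤ b := (abs_nonneg _).trans hw0
  rw [pd2_mul_exp hφ hw, abs_mul, Real.abs_exp, mul_assoc (Real.exp (S * b))]
  refine mul_le_mul (exp_mul_le hs hw0) ?_ (abs_nonneg _) (Real.exp_pos _).le
  have h1 : |2 * s * (pd a φ y * pd a w y)| ≤ 2 * S * (D * b) := by
    rw [abs_mul, abs_mul, abs_mul, abs_two]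
    gcongr
  have h2 : |s ^ 2 * pd a w y ^ 2| ≤ S ^ 2 * b ^ 2 := by
    rw [abs_mul, abs_pow, abs_pow]
    gcongr
  have h3 : |s * pd2 a w y| ≤ S * Y := by
    rw [abs_mul]
    exact mul_le_mul hs hw2 (abs_nonneg _) hS
  have h4 : |φ y * (s ^ 2 * pd a w y ^ 2 + s * pd2 a w y)| ≤ D * (S ^ 2 * b ^ 2 + S * Y) := by
    rw [abs_mul]
    exact mul_le_mul hD0 ((abs_add_le _ _).trans (add_le_add h2 h3)) (abs_nonneg _) hD
  refine (abs_add_three _ _ _).trans ((add_le_add_three hD2 h1 h4).trans ?_)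
  have : 0 ≤ (D + 2 * S * (D * b) + D * (S ^ 2 * b ^ 2)) * (Y - 1) :=
    mul_nonneg (by positivity) (by linarith)
  linarith

theorem sq_pd_mul_exp_div_le {δ : ℝ} (hδ : 0 < δ) (hφδ : δ ≤ φ y) :
    pd a (fun z => φ z * Real.exp (s * w z)) y ^ 2 / (φ y * Real.exp (s * w y))
      ≤ Real.exp (S * b) * ((D + S * D * b) ^ 2 / δ) := by
  have hS : 0 ≤ S := (abs_nonneg _).trans hs
  have hD : 0 ≤ D := (abs_nonneg _).trans hD0
  have hφ0 : 0 < φ y := hδ.trans_le hφδ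
  have e : pd a (fun z => φ z * Real.exp (s * w z)) y ^ 2 / (φ y * Real.exp (s * w y))
      = Real.exp (s * w y) * ((pd a φ y + s * φ y * pd a w y) ^ 2 / φ y) := by
    rw [pd_mul_exp hφ hw]
    field_simp
  rw [e]
  have h1 : |pd a φ y + s * φ y * pd a w y| ≤ D + S * D * b := by
    refine (abs_add_le _ _).trans (add_le_add hD1 ?_)
    rw [abs_mul, abs_mul]
    gcongr
  refine mul_le_mul (exp_mul_le hs hw0) ?_ (by positivity) (Real.exp_pos _).le
  have h2 : (pd a φ y + s * φ y * pd a w y) ^ 2 ≤ (D + S * D * b) ^ 2 :=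
    sq_le_sq' (abs_le.1 h1).1 (abs_le.1 h1).2
  exact div_le_div₀ (sq_nonneg _) h2 hδ hφδ

end Coefficients

/-- The second-order estimate at the centre of normal coordinates which is a local maximum of
`Δw + K |∇w|²`, with a constant independent of the solution and of the metric. -/
theorem exists_hessSize_bound [NeZero n] {m : ℕ} (hm : m + 2 ≤ n) (B b κ μ D δ S : ℝ) (hκ : 0 < κ)
    (hμ : 0 ≤ μ) (hδ : 0 < δ) (hS : 2 ≤ S) :
    ∃ C, ∀ (G A : Euc n → Matrix (Fin n) (Fin n) ℝ) (w : Euc n → ℝ) (t : ℝ) (x : Fin n → ℝ)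
      (φ : ℕ → Euc n → ℝ) (s : ℕ → ℝ) (ρ : Euc n → ℝ), NormalAt G A B → ContDiffAt ℝ 4 w 0 →
      |w 0| ≤ b → (∀ i, |pd i w 0| ≤ b) → |t| ≤ 1 →
      endoMat G A κ μ t w 0 = Matrix.diagonal x → x ∈ gam Finset.univ (m + 1) →
      (∀ l < m + 1, |s l| ≤ S) →
      (∀ l < m + 1, ContDiffAt ℝ 2 (φ l) 0 ∧ δ ≤ φ l 0 ∧ |φ l 0| ≤ D ∧
        (∀ a, |pd a (φ l) 0| ≤ D) ∧ ∀ a, |pd2 a (φ l) 0| ≤ D) →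
      (ContDiffAt ℝ 2 ρ 0 ∧ |ρ 0| ≤ D ∧ (∀ a, |pd a ρ 0| ≤ D) ∧ ∀ a, |pd2 a ρ 0| ≤ D) →
      (∀ᶠ z in nhds 0, charSigma (m + 2) (endoMat G A κ μ t w z)
          / charSigma (m + 1) (endoMat G A κ μ t w z)
        - (∑ l ∈ Finset.range (m + 1), φ l z * Real.exp (s l * w z)
            * charSigma l (endoMat G A κ μ t w z)) / charSigma (m + 1) (endoMat G A κ μ t w z)
          = -(ρ z * Real.exp (2 * w z))) →
      IsLocalMax (fun z => lapl G w z + (μ + 1) / κ * lgradSq G w z) 0 →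
      hessSize w ≤ C := by
  set E := Real.exp (S * b) with hE
  set Ψ := (1 / min 1 (δ * Real.exp (-(S * b)) / (1 + D * E))) ^ (m + 1) with hΨ
  set d₁ := E * (D + S * D * b) with hd₁
  set e₂ := E * (D + 2 * S * (D * b) + D * (S ^ 2 * b ^ 2 + S)) with he₂
  set d₂ := E * ((D + S * D * b) ^ 2 / δ) + e₂ with hd₂
  set cn := es Finset.univ (m + 2) (fun _ : Fin n => (1 : ℝ))
    / es Finset.univ (m + 1) (fun _ : Fin n => (1 : ℝ)) with hcn
  have hcn0 : 0 < cn := by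
    have h1 : (fun _ : Fin n => (1 : ℝ)) ∈ gam Finset.univ n :=
      mem_gam_of_pos (by simp) (fun _ => one_pos)
    exact div_pos (h1 _ hm) (h1 _ (by omega))
  set M := ((m + 1 : ℕ) : ℝ) * Ψ + 1 with hM
  refine ⟨hessConst n (jetConst n B b μ + n * (M * (d₁ + d₂) / cn)) κ μ, ?_⟩
  intro G A w t x φ s ρ h hw hw0 hw1 ht hdiag hx hs hφ hρ heq hmax
  have hw2 : ContDiffAt ℝ 2 w 0 := hw.of_le (by norm_num)
  have hb : 0 ≤ b := (abs_nonneg _).trans hw0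
  have hD : 0 ≤ D := (abs_nonneg _).trans hρ.2.1
  have hE0 : 0 < E := Real.exp_pos _
  have hY := one_le_hessSize w
  have hS2 : |(2 : ℝ)| ≤ S := by rwa [abs_two]
  have hd₁0 : 0 ≤ d₁ := by positivity
  have he₂0 : 0 ≤ e₂ := by positivity
  have hd₂0 : 0 ≤ d₂ := by positivity
  have hΨ0 : 0 ≤ Ψ := by
    have : 0 < min 1 (δ * Real.exp (-(S * b)) / (1 + D * E)) := lt_min one_pos (by positivity)
    positivity
  have hM0 : 0 ≤ M := by positivity
  set W : Euc n → Fin n → Fin n → ℝ := fun z => endoMat G A κ μ t w z with hW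
  have hW0 : ∀ i j, W 0 i j = Matrix.diagonal x i j := fun i j => congrFun (congrFun hdiag i) j
  have hsym : ∀ a i j, pd a (fun z => W z i j) 0 = pd a (fun z => W z j i) 0 := by
    intro a i j
    have h1 : (fun z => coreMat G A t w z i j) =ᶠ[nhds 0] fun z => coreMat G A t w z j i := by
      filter_upwards [h.core_symm hw t] with z hz
      exact hz.apply j i
    simp only [hW]
    rw [h.pd_endo hw, h.pd_endo hw, pd_congr h1]
    simp only [eq_comm]
  have hes : ∀ j ≤ n, charSigma j (endoMat G A κ μ t w 0) = es Finset.univ j x := fun j hj => by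
    rw [hdiag, charSigma_diagonal hj]
  have heq0 := heq.self_of_nhds
  have hsum0 : ∑ l ∈ Finset.range (m + 1), φ l 0 * Real.exp (s l * w 0)
      * charSigma l (endoMat G A κ μ t w 0)
      = ∑ l ∈ Finset.range (m + 1), φ l 0 * Real.exp (s l * w 0) * es Finset.univ l x :=
    Finset.sum_congr rfl fun l hl => by
      rw [hes l (by have := Finset.mem_range.1 hl; omega)]
  rw [hsum0, hes _ hm, hes _ (by omega)] at heq0
  have hΨx : ∀ l < m + 1, es Finset.univ l x / es Finset.univ (m + 1) x ≤ Ψ := by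
    intro l hl
    refine es_div_le_of_eq hx (β := fun l => φ l 0 * Real.exp (s l * w 0))
      (b₀ := δ * Real.exp (-(S * b))) (by positivity) (fun l hl => ?_)
      (ρ := ρ 0 * Real.exp (2 * w 0)) (ρ₀ := D * E) ?_ (by positivity) heq0 hl
    · refine mul_le_mul (hφ l hl).2.1 (Real.exp_le_exp.2 ?_) (Real.exp_pos _).le
        (hδ.le.trans (hφ l hl).2.1)
      have : |s l * w 0| ≤ S * b := by
        rw [abs_mul]
        exact mul_le_mul (hs l hl) hw0 (abs_nonneg _) (by linarith)
      exact (abs_le.1 this).1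
    · exact mul_le_mul ((le_abs_self _).trans hρ.2.1) (exp_mul_le hS2 hw0) (Real.exp_pos _).le hD
  have hexp : ∀ c : ℝ, ContDiffAt ℝ 2 (fun z => Real.exp (c * w z)) 0 := fun c =>
    (contDiffAt_const.mul hw2).exp
  obtain ⟨p, hp0, hpT, hp1, hp2⟩ := exists_linearization hm hW0 hx
    (h.contDiffAt_endo hw κ μ t) hsym (β := fun l z => φ l z * Real.exp (s l * w z))
    (ρ := fun z => ρ z * Real.exp (2 * w z)) (fun l hl => (hφ l hl).1.mul (hexp _))
    (fun l hl => mul_pos (hδ.trans_le (hφ l hl).2.1) (Real.exp_pos _)) (hρ.1.mul (hexp _)) heq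
    (Ψ := Ψ) (d₁ := d₁) (d₂ := d₂ * hessSize w) hΨx
    (fun l hl a => abs_pd_mul_exp_le (hφ l hl).1 hw2 (hφ l hl).2.2.1 ((hφ l hl).2.2.2.1 a)
      (hs l hl) hw0 (hw1 a))
    (fun l hl a => by
      have h1 := sq_pd_mul_exp_div_le (hφ l hl).1 hw2 (hφ l hl).2.2.1 ((hφ l hl).2.2.2.1 a)
        (hs l hl) hw0 (hw1 a) hδ (hφ l hl).2.1
      have h2 := abs_le.1 (abs_pd2_mul_exp_le (hφ l hl).1 hw2 (hφ l hl).2.2.1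
        ((hφ l hl).2.2.2.1 a) (hs l hl) hw0 (hw1 a) ((hφ l hl).2.2.2.2 a) hY
        (abs_pd_pd_le_hessSize w a a))
      have h3 : E * ((D + S * D * b) ^ 2 / δ) ≤ E * ((D + S * D * b) ^ 2 / δ) * hessSize w :=
        le_mul_of_one_le_right (by positivity) hY
      rw [hd₂, add_mul]
      linarith [h2.1])
    (by positivity)
    (fun a => abs_pd_mul_exp_le hρ.1 hw2 hρ.2.1 (hρ.2.2.1 a) hS2 hw0 (hw1 a))
    (fun a => by
      have h2 := abs_le.1 (abs_pd2_mul_exp_le hρ.1 hw2 hρ.2.1 (hρ.2.2.1 a) hS2 hw0 (hw1 a)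
        (hρ.2.2.2 a) hY (abs_pd_pd_le_hessSize w a a))
      have h3 : 0 ≤ E * ((D + S * D * b) ^ 2 / δ) * hessSize w := by positivity
      rw [hd₂, add_mul]
      linarith [h2.2])
  have hT0 : 0 < ∑ i, p i := hcn0.trans_le hpT
  have hTn : ∀ d : ℝ, 0 ≤ d → d ≤ d / cn * ∑ i, p i := fun d hd => by
    rw [div_mul_eq_mul_div, le_div_iff₀ hcn0]
    exact mul_le_mul_of_nonneg_left hpT hd
  refine h.hessSize_le hw hw1 hκ hμ ht (by positivity) hp0 hT0 (fun a => (hp1 a).trans ?_)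
    (fun a => le_trans ?_ (hp2 a)) hmax
  · refine le_trans ?_ (hTn (M * (d₁ + d₂)) (by positivity))
    exact mul_le_mul_of_nonneg_left (by linarith) hM0
  · have h1 := mul_le_mul_of_nonneg_right (hTn (M * (d₁ + d₂)) (by positivity))
      (zero_le_one.trans hY)
    have h2 : M * d₂ * hessSize w ≤ M * (d₁ + d₂) * hessSize w :=
      mul_le_mul_of_nonneg_right (mul_le_mul_of_nonneg_left (by linarith) hM0)
        (zero_le_one.trans hY)
    rw [← hM] at *
    linarith

end LocalEstimate

/-! ### Invariance under changes of coordinates -/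

section Pullback

variable {n : ℕ} {G G' A A' : Euc n → Matrix (Fin n) (Fin n) ℝ} {y z : Euc n} {ψ : Euc n → Euc n}
  {w : Euc n → ℝ}

theorem pdMat_inv (h : ContDiffMat 1 G y) (hd : (G y).det ≠ 0) (a : Fin n) :
    pdMat a (fun z => (G z)⁻¹) y = -((G y)⁻¹ * pdMat a G y * (G y)⁻¹) := by
  have hu : IsUnit (G y).det := isUnit_iff_ne_zero.2 hd
  have h1 : pdMat a (fun z => G z * (G z)⁻¹) y = 0 := by
    have : (fun z => G z * (G z)⁻¹) =ᶠ[nhds y] fun _ => 1 := by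
      filter_upwards [h.det_ne_zero hd] with z hz
      exact Matrix.mul_nonsing_inv _ (isUnit_iff_ne_zero.2 hz)
    rw [pdMat_congr this]
    ext i j
    simp [pdMat]
  rw [pdMat_mul h (h.inv hd)] at h1
  have h2 := congrArg (fun X => (G y)⁻¹ * X) h1
  simp only [Matrix.mul_add, Matrix.mul_zero] at h2
  rw [← Matrix.mul_assoc (G y)⁻¹ (G y), Matrix.nonsing_inv_mul _ hu, Matrix.one_mul] at h2
  rw [Matrix.mul_assoc]
  exact eq_neg_of_add_eq_zero_right h2

theorem pd_trace (h : ContDiffMat 1 G y) (a : Fin n) :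
    pd a (fun z => (G z).trace) y = (pdMat a G y).trace := by
  simp only [Matrix.trace, Matrix.diag]
  rw [pd_sum fun i _ => h.diff le_rfl i i]
  rfl

/-- The contracted Christoffel symbol `Γ^k_ik` is half the logarithmic derivative of `det G`. -/
theorem sum_lchr (hs : ∀ᶠ z in nhds y, (G z).IsSymm) (hd : (G y).det ≠ 0) (i : Fin n) :
    ∑ k, lchr G k i k y = (1 / 2) * ((G y)⁻¹ * pdMat i G y).trace := by
  have hu : IsUnit (G y).det := isUnit_iff_ne_zero.2 hd
  have e : ∑ k, lchr G k i k y = (connMat G i y).trace := rfl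
  rw [pdMat_metric hs hd, Matrix.mul_add, Matrix.trace_add, ← Matrix.mul_assoc (G y)⁻¹ (G y),
    Matrix.nonsing_inv_mul _ hu, Matrix.one_mul, Matrix.trace_mul_comm, Matrix.mul_assoc,
    Matrix.mul_nonsing_inv _ hu, Matrix.mul_one, Matrix.trace_transpose, e]
  ring

/-- The Ricci tensor is symmetric. The only term that is not visibly so is `∂_j Γ^k_ik`, a second
derivative of `½ log det G`. -/
theorem lric_symm (hG : ContDiffMat 2 G y) (hs : ∀ᶠ z in nhds y, (G z).IsSymm)
    (hd : (G y).det ≠ 0) : (lric G y).IsSymm := by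
  have hG1 : ContDiffMat 1 G y := hG.of_le (by norm_num)
  have hΓ : ∀ k i j, DifferentiableAt ℝ (lchr G k i j) y := fun k i j =>
    (contDiffAt_lchr hG hd (m' := 1) (by norm_num) k i j).differentiableAt one_ne_zero
  have h1 : ∀ i j, ∑ k, pd j (lchr G k i k) y = ∑ k, pd i (lchr G k j k) y := by
    have h2 : ∀ i j, ∑ k, pd j (lchr G k i k) y = (1 / 2) *
        ((-((G y)⁻¹ * pdMat j G y * (G y)⁻¹) * pdMat i G y).trace
          + ((G y)⁻¹ * pdMat j (pdMat i G) y).trace) := by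
      intro i j
      have e : (fun z => ∑ k, lchr G k i k z) =ᶠ[nhds y]
          fun z => (1 / 2) * ((G z)⁻¹ * pdMat i G z).trace := by
        filter_upwards [eventually_eventually_nhds.2 hs, hG1.det_ne_zero hd] with z h1 h2
        exact sum_lchr h1 h2 i
      have hP : ContDiffMat 1 (pdMat i G) y := contDiffMat_pdMat hG (by norm_num) i
      have hM := (hG1.inv hd).mul hP
      have hMd : DifferentiableAt ℝ (fun z => ((G z)⁻¹ * pdMat i G z).trace) y :=
        DifferentiableAt.fun_sum fun k _ => hM.diff le_rfl k k
      rw [← pd_sum (f := fun k => lchr G k i k) fun k _ => hΓ k i k, pd_congr e, pd_const_mul hMd,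
        pd_trace hM, pdMat_mul (hG1.inv hd) hP, pdMat_inv hG1 hd, Matrix.trace_add]
    intro i j
    rw [h2, h2, pdMat_comm hG j i]
    congr 2
    rw [Matrix.neg_mul, Matrix.neg_mul, Matrix.trace_neg, Matrix.trace_neg, Matrix.mul_assoc,
      Matrix.trace_mul_comm, Matrix.mul_assoc, Matrix.mul_assoc, Matrix.mul_assoc]
  have hsym : ∀ k i j, lchr G k i j =ᶠ[nhds y] lchr G k j i := fun k i j => by
    filter_upwards [eventually_eventually_nhds.2 hs] with z hz
    exact lchr_symm hz k i j
  ext i j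
  simp only [Matrix.transpose_apply, lric, Matrix.of_apply, Finset.sum_sub_distrib]
  rw [h1 j i]
  simp only [fun k => pd_congr (hsym k j i) k]
  congr 2
  · refine Finset.sum_congr rfl fun k _ => Finset.sum_congr rfl fun l _ => ?_
    rw [lchr_symm hs l j i]
  · rw [Finset.sum_comm]
    exact Finset.sum_congr rfl fun k _ => Finset.sum_congr rfl fun l _ => mul_comm _ _

/-- The modified Schouten tensor of the metric `G`. -/
def lschouten (τ : ℝ) (G : Euc n → Matrix (Fin n) (Fin n) ℝ) (y : Euc n) :
    Matrix (Fin n) (Fin n) ℝ :=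
  (1 / ((n : ℝ) - 2)) • (lric G y - (τ * ltr G y (lric G y) / (2 * ((n : ℝ) - 1))) • G y)

theorem lschouten_symm (τ : ℝ) (hG : ContDiffMat 2 G y) (hs : ∀ᶠ z in nhds y, (G z).IsSymm)
    (hd : (G y).det ≠ 0) : (lschouten τ G y).IsSymm :=
  ((lric_symm hG hs hd).sub (hs.self_of_nhds.smul _)).smul _

/-- The squared length of the Hessian for the metric `G`. -/
def lhessSq (G : Euc n → Matrix (Fin n) (Fin n) ℝ) (w : Euc n → ℝ) (y : Euc n) : ℝ :=
  ∑ i, ∑ j, ∑ a, ∑ b, (G y)⁻¹ i j * (G y)⁻¹ a b * lhess G w y i a * lhess G w y j b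

theorem ltr_eq_trace (G : Euc n → Matrix (Fin n) (Fin n) ℝ) (y : Euc n)
    (T : Matrix (Fin n) (Fin n) ℝ) : ltr G y T = ((G y)⁻¹ * T.transpose).trace := by
  simp [ltr, Matrix.trace, Matrix.mul_apply]

theorem lgradSq_eq_ltr (G : Euc n → Matrix (Fin n) (Fin n) ℝ) (w : Euc n → ℝ) (y : Euc n) :
    lgradSq G w y = ltr G y (Matrix.vecMulVec (fun i => pd i w y) (fun i => pd i w y)) := by
  simp [lgradSq, ltr, Matrix.vecMulVec_apply, mul_assoc]

theorem lhessSq_eq_trace (G : Euc n → Matrix (Fin n) (Fin n) ℝ) (w : Euc n → ℝ) (y : Euc n) :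
    lhessSq G w y =
      ((lhess G w y).transpose * ((G y)⁻¹ * lhess G w y * (G y)⁻¹.transpose)).trace := by
  simp only [lhessSq, Matrix.trace, Matrix.diag, Matrix.mul_apply, Matrix.transpose_apply,
    Finset.mul_sum, Finset.sum_mul]
  have : ∀ i, ∑ j, ∑ a, ∑ b, (G y)⁻¹ i j * (G y)⁻¹ a b * lhess G w y i a * lhess G w y j b
      = ∑ a, ∑ b, ∑ j, lhess G w y i a * ((G y)⁻¹ i j * lhess G w y j b * (G y)⁻¹ a b) := by
    intro i
    rw [Finset.sum_comm]
    refine Finset.sum_congr rfl fun a _ => ?_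
    rw [Finset.sum_comm]
    exact Finset.sum_congr rfl fun b _ => Finset.sum_congr rfl fun j _ => by ring
  simp only [this]
  rw [Finset.sum_comm]

/-- Near `z` the matrix field `G'` is the pullback under `ψ` of the matrix field `G` of symmetric
nondegenerate forms. -/
structure IsPullback (G' G : Euc n → Matrix (Fin n) (Fin n) ℝ) (ψ : Euc n → Euc n) (z : Euc n) :
    Prop where
  map : ContDiffAt ℝ 3 ψ z
  metric : ContDiffMat 2 G (ψ z)
  symm : ∀ᶠ x in nhds (ψ z), (G x).IsSymm
  det : (G (ψ z)).det ≠ 0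
  jac_det : (jac ψ z).det ≠ 0
  eq : ∀ᶠ x in nhds z, G' x = (jac ψ x).transpose * G (ψ x) * jac ψ x

namespace IsPullback

variable (h : IsPullback G' G ψ z)
include h

theorem inv_eq : (G' z)⁻¹ = (jac ψ z)⁻¹ * (G (ψ z))⁻¹ * (jac ψ z)⁻¹.transpose := by
  rw [h.eq.self_of_nhds, Matrix.mul_inv_rev, Matrix.mul_inv_rev, Matrix.transpose_nonsing_inv,
    Matrix.mul_assoc]

theorem jac_inv_mul : (jac ψ z)⁻¹ * jac ψ z = 1 :=
  Matrix.nonsing_inv_mul _ (isUnit_iff_ne_zero.2 h.jac_det)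

theorem jac_mul_inv : jac ψ z * (jac ψ z)⁻¹ = 1 :=
  Matrix.mul_nonsing_inv _ (isUnit_iff_ne_zero.2 h.jac_det)

theorem transpose_mul : (jac ψ z)⁻¹.transpose * (jac ψ z).transpose = 1 := by
  rw [← Matrix.transpose_mul, h.jac_mul_inv, Matrix.transpose_one]

theorem mul_transpose : (jac ψ z).transpose * (jac ψ z)⁻¹.transpose = 1 := by
  rw [← Matrix.transpose_mul, h.jac_inv_mul, Matrix.transpose_one]

theorem inv_mul_conj (T : Matrix (Fin n) (Fin n) ℝ) :
    (G' z)⁻¹ * ((jac ψ z).transpose * T * jac ψ z)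
      = (jac ψ z)⁻¹ * ((G (ψ z))⁻¹ * T) * jac ψ z := by
  rw [h.inv_eq]
  calc _ = (jac ψ z)⁻¹ * (G (ψ z))⁻¹ * ((jac ψ z)⁻¹.transpose * (jac ψ z).transpose)
        * T * jac ψ z := by noncomm_ring
    _ = _ := by rw [h.transpose_mul]; noncomm_ring

theorem trace_conj (T : Matrix (Fin n) (Fin n) ℝ) :
    ((jac ψ z)⁻¹ * T * jac ψ z).trace = T.trace := by
  rw [Matrix.trace_mul_comm, ← Matrix.mul_assoc, h.jac_mul_inv, Matrix.one_mul]

theorem ltr_eq (T : Matrix (Fin n) (Fin n) ℝ) :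
    ltr G' z ((jac ψ z).transpose * T * jac ψ z) = ltr G (ψ z) T := by
  rw [ltr_eq_trace, ltr_eq_trace, Matrix.transpose_mul, Matrix.transpose_mul,
    Matrix.transpose_transpose, ← Matrix.mul_assoc (jac ψ z).transpose, h.inv_mul_conj,
    h.trace_conj]

theorem schouten_eq (τ : ℝ) :
    lschouten τ G' z = (jac ψ z).transpose * lschouten τ G (ψ z) * jac ψ z := by
  rw [lschouten, lric_pullback h.map h.metric h.symm h.det h.jac_det h.eq, h.ltr_eq,
    h.eq.self_of_nhds, lschouten]
  simp only [Matrix.mul_smul, Matrix.smul_mul, Matrix.mul_sub, Matrix.sub_mul]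

theorem pd_eq (hw : DifferentiableAt ℝ w (ψ z)) (b : Fin n) :
    pd b (fun x => w (ψ x)) z = ∑ i, jac ψ z i b * pd i w (ψ z) :=
  pd_comp hw (h.map.differentiableAt (by norm_num)) b

theorem vecMulVec_eq (hw : DifferentiableAt ℝ w (ψ z)) :
    Matrix.vecMulVec (fun i => pd i (fun x => w (ψ x)) z) (fun i => pd i (fun x => w (ψ x)) z)
      = (jac ψ z).transpose * Matrix.vecMulVec (fun i => pd i w (ψ z)) (fun i => pd i w (ψ z))
        * jac ψ z := by
  ext a b
  simp only [h.pd_eq hw, Matrix.vecMulVec_apply, Matrix.mul_apply, Matrix.transpose_apply,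
    Finset.sum_mul_sum]
  simp only [Finset.sum_mul]
  rw [Finset.sum_comm]
  exact Finset.sum_congr rfl fun j _ => Finset.sum_congr rfl fun i _ => by ring

theorem gradSq_eq (hw : DifferentiableAt ℝ w (ψ z)) :
    lgradSq G' (fun x => w (ψ x)) z = lgradSq G w (ψ z) := by
  rw [lgradSq_eq_ltr, h.vecMulVec_eq hw, h.ltr_eq, ← lgradSq_eq_ltr]

variable (hw : ContDiffAt ℝ 2 w (ψ z))
include hw

theorem hess_eq : lhess G' (fun x => w (ψ x)) z
    = (jac ψ z).transpose * lhess G w (ψ z) * jac ψ z :=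
  lhess_pullback hw (h.map.of_le (by norm_num)) (h.metric.of_le (by norm_num)) h.symm h.det
    h.jac_det h.eq

theorem lapl_eq : lapl G' (fun x => w (ψ x)) z = lapl G w (ψ z) := by
  rw [lapl, h.hess_eq hw, h.ltr_eq, lapl]

theorem hessSq_eq : lhessSq G' (fun x => w (ψ x)) z = lhessSq G w (ψ z) := by
  rw [lhessSq_eq_trace, lhessSq_eq_trace, h.hess_eq hw, h.inv_mul_conj, h.inv_eq,
    Matrix.transpose_mul, Matrix.transpose_mul, Matrix.transpose_mul, Matrix.transpose_mul,
    Matrix.transpose_transpose, Matrix.transpose_transpose]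
  generalize (lhess G w (ψ z)) = H
  generalize (G (ψ z))⁻¹ = P
  have h1 := h.jac_mul_inv
  have h2 := h.mul_transpose
  generalize jac ψ z = J at *
  generalize J⁻¹ = K at *
  calc _ = (J.transpose * (H.transpose * (J * K) * (P * H) * (J * K) * P.transpose)
        * K.transpose).trace := by congr 1; noncomm_ring
    _ = _ := by
      rw [h1, Matrix.mul_assoc, Matrix.trace_mul_comm, Matrix.mul_assoc]
      have h3 : K.transpose * J.transpose = 1 := by
        rw [← Matrix.transpose_mul, h1, Matrix.transpose_one]
      rw [h3]
      congr 1; noncomm_ring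

theorem core_eq (t : ℝ) (hA : A' z = (jac ψ z).transpose * A (ψ z) * jac ψ z) :
    coreMat G' A' t (fun x => w (ψ x)) z
      = (jac ψ z).transpose * coreMat G A t w (ψ z) * jac ψ z := by
  rw [coreMat, h.hess_eq hw, h.vecMulVec_eq (hw.differentiableAt two_ne_zero), hA, coreMat]
  simp only [Matrix.mul_smul, Matrix.smul_mul, Matrix.mul_sub, Matrix.sub_mul]

theorem endo_eq (κ μ t : ℝ) (hA : A' z = (jac ψ z).transpose * A (ψ z) * jac ψ z) :
    endoMat G' A' κ μ t (fun x => w (ψ x)) z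
      = (jac ψ z)⁻¹ * endoMat G A κ μ t w (ψ z) * jac ψ z := by
  rw [endoMat, h.core_eq hw t hA, h.inv_mul_conj, h.lapl_eq hw,
    h.gradSq_eq (hw.differentiableAt two_ne_zero), endoMat, Matrix.mul_add, Matrix.add_mul,
    Matrix.mul_smul, Matrix.smul_mul, Matrix.mul_one, h.jac_inv_mul]

theorem charSigma_endo_eq (κ μ t : ℝ) (hA : A' z = (jac ψ z).transpose * A (ψ z) * jac ψ z)
    (j : ℕ) : charSigma j (endoMat G' A' κ μ t (fun x => w (ψ x)) z)
      = charSigma j (endoMat G A κ μ t w (ψ z)) := by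
  rw [charSigma, h.endo_eq hw κ μ t hA, charpoly_conj h.jac_mul_inv, charSigma]

end IsPullback

end Pullback

/-! ### Normal coordinates with uniform bounds -/

section ParameterDependence

variable {n : ℕ} {X : Type*} [NormedAddCommGroup X] [NormedSpace ℝ X] {O : Set (X × Euc n)}

theorem contDiffOn_pd_param (hO : IsOpen O) {f : X → Euc n → ℝ}
    (hf : ContDiffOn ℝ ∞ (fun q : X × Euc n => f q.1 q.2) O) (i : Fin n) :
    ContDiffOn ℝ ∞ (fun q : X × Euc n => pd i (f q.1) q.2) O := by
  have h1 : ContDiffOn ℝ ∞ (fun q => fderiv ℝ (fun q : X × Euc n => f q.1 q.2) q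
      (0, EuclideanSpace.single i 1)) O :=
    (hf.fderiv_of_isOpen hO (by simp)).clm_apply contDiffOn_const
  refine h1.congr fun q hq => ?_
  have hd : DifferentiableAt ℝ (fun q : X × Euc n => f q.1 q.2) q :=
    ((hf.contDiffAt (hO.mem_nhds hq)).differentiableAt (by simp))
  have h2 : HasFDerivAt (fun z : Euc n => (q.1, z)) (ContinuousLinearMap.inr ℝ X (Euc n)) q.2 :=
    hasFDerivAt_prodMk_right q.1 q.2
  have h3 := HasFDerivAt.comp q.2 (show HasFDerivAt (fun q : X × Euc n => f q.1 q.2) _ (q.1, q.2)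
    from hd.hasFDerivAt) h2
  have h4 : fderiv ℝ (f q.1) q.2
      = (fderiv ℝ (fun q : X × Euc n => f q.1 q.2) q).comp (ContinuousLinearMap.inr ℝ X (Euc n)) :=
    h3.fderiv
  rw [pd, h4]
  simp

variable {Gf : X → Euc n → Matrix (Fin n) (Fin n) ℝ}

/-- The parametrized matrix field `Gf` is jointly smooth on `O`. -/
def SmoothFamily (O : Set (X × Euc n)) (Gf : X → Euc n → Matrix (Fin n) (Fin n) ℝ) : Prop :=
  ∀ i j, ContDiffOn ℝ ∞ (fun q : X × Euc n => Gf q.1 q.2 i j) O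

theorem SmoothFamily.contDiffMat (hO : IsOpen O) (h : SmoothFamily O Gf) {q : X × Euc n}
    (hq : q ∈ O) : ContDiffMat ∞ (Gf q.1) q.2 := fun i j =>
  ContDiffAt.comp (g := fun q : X × Euc n => Gf q.1 q.2 i j) (f := fun z => (q.1, z)) q.2
    ((h i j).contDiffAt (hO.mem_nhds hq)) (contDiffAt_const.prodMk contDiffAt_id)

theorem SmoothFamily.inv (hO : IsOpen O) (h : SmoothFamily O Gf)
    (hd : ∀ q ∈ O, (Gf q.1 q.2).det ≠ 0) : SmoothFamily O fun p z => (Gf p z)⁻¹ :=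
  fun i j q hq => (contDiffAt_inv_apply (F := fun q : X × Euc n => Gf q.1 q.2)
    (fun i j => (h i j).contDiffAt (hO.mem_nhds hq)) (hd q hq) i j).contDiffWithinAt

theorem SmoothFamily.mul {Gf' : X → Euc n → Matrix (Fin n) (Fin n) ℝ} (h : SmoothFamily O Gf)
    (h' : SmoothFamily O Gf') : SmoothFamily O fun p z => Gf p z * Gf' p z := fun i j => by
  simp only [Matrix.mul_apply]
  exact ContDiffOn.sum fun k _ => (h i k).mul (h' k j)

theorem SmoothFamily.transpose (h : SmoothFamily O Gf) :
    SmoothFamily O fun p z => (Gf p z).transpose := fun i j => h j i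

theorem contDiffOn_lchr_param (hO : IsOpen O) (h : SmoothFamily O Gf)
    (hd : ∀ q ∈ O, (Gf q.1 q.2).det ≠ 0) (k i j : Fin n) :
    ContDiffOn ℝ ∞ (fun q : X × Euc n => lchr (Gf q.1) k i j q.2) O := by
  have hp : ∀ a i j, ContDiffOn ℝ ∞ (fun q : X × Euc n => pd a (fun z => Gf q.1 z i j) q.2) O :=
    fun a i j => contDiffOn_pd_param hO (f := fun p z => Gf p z i j) (h i j) a
  exact contDiffOn_const.mul (ContDiffOn.sum fun l _ =>
    (h.inv hO hd k l).mul (((hp i j l).add (hp j i l)).sub (hp l i j)))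

theorem SmoothFamily.lric (hO : IsOpen O) (h : SmoothFamily O Gf)
    (hd : ∀ q ∈ O, (Gf q.1 q.2).det ≠ 0) : SmoothFamily O fun p z => lric (Gf p) z := by
  intro i j
  have hΓ := contDiffOn_lchr_param hO h hd
  have hp : ∀ a k i j, ContDiffOn ℝ ∞ (fun q : X × Euc n => pd a (lchr (Gf q.1) k i j) q.2) O :=
    fun a k i j => contDiffOn_pd_param hO (f := fun p z => lchr (Gf p) k i j z) (hΓ k i j) a
  exact (ContDiffOn.sum fun k _ => (hp k k i j).sub (hp j k i k)).add
    (ContDiffOn.sum fun k _ => ContDiffOn.sum fun l _ =>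
      ((hΓ k k l).mul (hΓ l i j)).sub ((hΓ k j l).mul (hΓ l i k)))

theorem SmoothFamily.lschouten (hO : IsOpen O) (h : SmoothFamily O Gf)
    (hd : ∀ q ∈ O, (Gf q.1 q.2).det ≠ 0) (τ : ℝ) :
    SmoothFamily O fun p z => lschouten τ (Gf p) z := by
  intro i j
  have hR := h.lric hO hd
  have ht : ContDiffOn ℝ ∞ (fun q : X × Euc n => ltr (Gf q.1) q.2 (KrylovEq.lric (Gf q.1) q.2)) O :=
    ContDiffOn.sum fun i _ => ContDiffOn.sum fun j _ => (h.inv hO hd i j).mul (hR i j)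
  exact contDiffOn_const.mul ((hR i j).sub
    (((contDiffOn_const.mul ht).div_const _).mul (h i j)))

end ParameterDependence

section NormalMap

variable {n : ℕ}

/-- The linear map `L` applied to `z`. -/
def linCoord (L : Fin n → Fin n → ℝ) (a : Fin n) (z : Euc n) : ℝ := ∑ i, L a i * z i

/-- A point together with a frame, the columns of the matrix. -/
abbrev FrameData (n : ℕ) := Euc n × (Fin n → Fin n → ℝ)

/-- The second-order normal coordinates `z ↦ y₀ + L z - ½ Γ(y₀)(L z, L z)` for the metric `G`. -/
def normalMap (G : Euc n → Matrix (Fin n) (Fin n) ℝ) (p : FrameData n)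
    (z : Euc n) : Euc n :=
  WithLp.toLp 2 fun k => p.1 k + linCoord p.2 k z
    - (1 / 2) * ∑ a, ∑ b, lchr G k a b p.1 * (linCoord p.2 a z * linCoord p.2 b z)

/-- The pullback of the matrix field `G` under `ψ`. -/
def pullMat (G : Euc n → Matrix (Fin n) (Fin n) ℝ) (ψ : Euc n → Euc n) (z : Euc n) :
    Matrix (Fin n) (Fin n) ℝ := (jac ψ z).transpose * G (ψ z) * jac ψ z

variable {G : Euc n → Matrix (Fin n) (Fin n) ℝ} {y₀ : Euc n} {L : Fin n → Fin n → ℝ}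

theorem contDiff_linCoord (L : Fin n → Fin n → ℝ) (a : Fin n) :
    ContDiff ℝ ∞ (linCoord L a) := by
  unfold linCoord; fun_prop

theorem linCoord_zero (L : Fin n → Fin n → ℝ) (a : Fin n) : linCoord L a 0 = 0 := by
  simp [linCoord]

theorem pd_linCoord (L : Fin n → Fin n → ℝ) (a c : Fin n) (z : Euc n) :
    pd c (linCoord L a) z = L a c := by
  have : linCoord L a = fun z => ∑ i, L a i * z i := rfl
  have hz : ∀ i, DifferentiableAt ℝ (fun z : Euc n => z i) z := fun i => by fun_prop
  have h1 : ∀ i, pd c (fun z : Euc n => z i) z = if i = c then 1 else 0 := by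
    intro i
    have : (fun z : Euc n => z i) = EuclideanSpace.proj (𝕜 := ℝ) i := rfl
    rw [pd, this, ContinuousLinearMap.fderiv]
    simp
  rw [this, pd_sum fun i _ => (hz i).const_mul _]
  simp [pd_const_mul (hz _), h1]

@[simp] theorem normalMap_zero : normalMap G (y₀, L) 0 = y₀ := by
  ext k; simp [normalMap, linCoord_zero]

theorem contDiff_normalMap : ContDiff ℝ ∞ (normalMap G (y₀, L)) := by
  rw [contDiff_euclidean]
  intro k
  exact (contDiff_const.add (contDiff_linCoord L k)).sub (contDiff_const.mul
    (ContDiff.sum fun a _ => ContDiff.sum fun b _ => contDiff_const.mul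
      ((contDiff_linCoord L a).mul (contDiff_linCoord L b))))

theorem jac_normalMap (z : Euc n) (k c : Fin n) :
    jac (normalMap G (y₀, L)) z k c = L k c - (1 / 2) * ∑ a, ∑ b, lchr G k a b y₀ *
      (L a c * linCoord L b z + linCoord L a z * L b c) := by
  have hd : ∀ a, DifferentiableAt ℝ (linCoord L a) z := fun a =>
    (contDiff_linCoord L a).contDiffAt.differentiableAt (by simp)
  have hdd : ∀ a b, DifferentiableAt ℝ
      (fun z => lchr G k a b y₀ * (linCoord L a z * linCoord L b z)) z := fun a b =>
    ((hd a).fun_mul (hd b)).const_mul _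
  have hs : ∀ a, DifferentiableAt ℝ
      (fun z => ∑ b, lchr G k a b y₀ * (linCoord L a z * linCoord L b z)) z := fun a =>
    DifferentiableAt.fun_sum fun b _ => hdd a b
  have e : (fun z => normalMap G (y₀, L) z k) = fun z => (y₀ k + linCoord L k z)
      - (1 / 2) * ∑ a, ∑ b, lchr G k a b y₀ * (linCoord L a z * linCoord L b z) := rfl
  rw [jac, Matrix.of_apply, e, pd_sub ((hd k).const_add _)
    ((DifferentiableAt.fun_sum fun a _ => hs a).const_mul _),
    pd_add (f := fun _ => y₀ k) (differentiableAt_const _) (hd k),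
    pd_const_mul (DifferentiableAt.fun_sum fun a _ => hs a), pd_sum fun a _ => hs a]
  simp only [pd_const, zero_add, pd_linCoord]
  congr 2
  refine Finset.sum_congr rfl fun a _ => ?_
  rw [pd_sum fun b _ => hdd a b]
  refine Finset.sum_congr rfl fun b _ => ?_
  rw [pd_const_mul ((hd a).fun_mul (hd b)), pd_mul (hd a) (hd b), pd_linCoord, pd_linCoord]

theorem jac_normalMap_zero : jac (normalMap G (y₀, L)) 0 = Matrix.of L := by
  ext k c; simp [jac_normalMap, linCoord_zero]

/-- The quadratic term of the normal map makes the Jacobian parallel at the centre, so that the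
Christoffel symbols of the pulled back metric vanish there. -/
theorem pdMat_jac_normalMap (hs : ∀ᶠ z in nhds y₀, (G z).IsSymm) (c : Fin n) :
    pdMat c (jac (normalMap G (y₀, L))) 0
      = -(connPull G (normalMap G (y₀, L)) c 0 * jac (normalMap G (y₀, L)) 0) := by
  ext k i
  have hd : ∀ a, DifferentiableAt ℝ (linCoord L a) 0 := fun a =>
    (contDiff_linCoord L a).contDiffAt.differentiableAt (by simp)
  have hdd : ∀ a b, DifferentiableAt ℝ (fun z => lchr G k a b y₀ *
      (L a i * linCoord L b z + linCoord L a z * L b i)) 0 := fun a b =>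
    (((hd b).const_mul _).fun_add ((hd a).mul_const _)).const_mul _
  have hss : ∀ a, DifferentiableAt ℝ (fun z => ∑ b, lchr G k a b y₀ *
      (L a i * linCoord L b z + linCoord L a z * L b i)) 0 := fun a =>
    DifferentiableAt.fun_sum fun b _ => hdd a b
  have e1 : pdMat c (jac (normalMap G (y₀, L))) 0 k i
      = -((1 / 2) * ∑ a, ∑ b, lchr G k a b y₀ * (L a i * L b c + L a c * L b i)) := by
    rw [pdMat, Matrix.of_apply]
    simp only [jac_normalMap]
    rw [pd_sub (differentiableAt_const _)
      ((DifferentiableAt.fun_sum fun a _ => hss a).const_mul _),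
      pd_const_mul (DifferentiableAt.fun_sum fun a _ => hss a), pd_sum fun a _ => hss a]
    simp only [pd_const, zero_sub]
    congr 2
    refine Finset.sum_congr rfl fun a _ => ?_
    rw [pd_sum fun b _ => hdd a b]
    refine Finset.sum_congr rfl fun b _ => ?_
    have e : (fun z => L a i * linCoord L b z + linCoord L a z * L b i)
        = fun z => L a i * linCoord L b z + L b i * linCoord L a z := by ext z; ring
    rw [pd_const_mul (((hd b).const_mul _).fun_add ((hd a).mul_const _)), e,
      pd_add ((hd b).const_mul _) ((hd a).const_mul _), pd_const_mul (hd b), pd_const_mul (hd a),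
      pd_linCoord, pd_linCoord]
    ring
  have e2 : ∑ a, ∑ b, lchr G k a b y₀ * (L a i * L b c)
      = ∑ a, ∑ b, lchr G k a b y₀ * (L a c * L b i) := by
    rw [Finset.sum_comm]
    refine Finset.sum_congr rfl fun a _ => Finset.sum_congr rfl fun b _ => ?_
    rw [lchr_symm hs k b a]; ring
  have e3 : (connPull G (normalMap G (y₀, L)) c 0 * jac (normalMap G (y₀, L)) 0) k i
      = ∑ a, ∑ b, lchr G k a b y₀ * (L a c * L b i) := by
    simp only [connPull, jac_normalMap_zero, normalMap_zero, Matrix.mul_apply, Matrix.sum_apply,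
      Matrix.smul_apply, smul_eq_mul, connMat, Matrix.of_apply, Finset.sum_mul]
    rw [Finset.sum_comm]
    exact Finset.sum_congr rfl fun a _ => Finset.sum_congr rfl fun b _ => by ring
  rw [e1, Matrix.neg_apply, e3]
  simp only [mul_add, Finset.sum_add_distrib]
  rw [e2]; ring

theorem contDiffOn_normalMap {V : Set (Euc n)} (hV : IsOpen V)
    (hG : ∀ i j, ContDiffOn ℝ ∞ (fun y => G y i j) V) (hd : ∀ y ∈ V, (G y).det ≠ 0) :
    ContDiffOn ℝ ∞ (fun q : FrameData n × Euc n => normalMap G q.1 q.2)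
      {q | q.1.1 ∈ V} := by
  rw [contDiffOn_euclidean]
  intro k
  have hL : ∀ a, ContDiff ℝ ∞
      (fun q : FrameData n × Euc n => linCoord q.1.2 a q.2) := by
    intro a
    unfold linCoord; fun_prop
  have hΓ : ∀ a b, ContDiffOn ℝ ∞
      (fun q : FrameData n × Euc n => lchr G k a b q.1.1) {q | q.1.1 ∈ V} := by
    intro a b
    have h1 : ContDiffOn ℝ ∞ (lchr G k a b) V := fun y hy =>
      (contDiffAt_lchr (m := ∞) (m' := ∞) (fun i j => (hG i j).contDiffAt (hV.mem_nhds hy))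
        (hd y hy) (by simp) k a b).contDiffWithinAt
    exact h1.comp (contDiff_fst.comp contDiff_fst).contDiffOn fun q hq => hq
  have hk : ContDiff ℝ ∞ (fun q : FrameData n × Euc n => q.1.1 k) := by fun_prop
  exact (hk.contDiffOn.add (hL k).contDiffOn).sub (contDiffOn_const.mul
    (ContDiffOn.sum fun a _ => ContDiffOn.sum fun b _ => (hΓ a b).mul
      ((hL a).contDiffOn.mul (hL b).contDiffOn)))

theorem exists_abs_le_of_isCompact {Y ι : Type*} [TopologicalSpace Y] [Finite ι] {C : Set Y}
    (hC : IsCompact C) {f : ι → Y → ℝ} (hf : ∀ i, ContinuousOn (f i) C) :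
    ∃ B, ∀ i, ∀ y ∈ C, |f i y| ≤ B := by
  cases nonempty_fintype ι
  choose b hb using fun i => hC.exists_bound_of_continuousOn (hf i)
  refine ⟨∑ i, |b i|, fun i y hy => ((hb i y hy).trans (le_abs_self _)).trans ?_⟩
  exact Finset.single_le_sum (f := fun i => |b i|) (fun _ _ => abs_nonneg _) (Finset.mem_univ i)

/-- Uniformly for `y₀` in a compact set, second-order normal coordinates at `y₀` have bounded
jets: the orthonormal frames `L` at points of a compact set form a compact set. -/
theorem exists_normalAt {V K : Set (Euc n)} (hV : IsOpen V) (hK : IsCompact K) (hKV : K ⊆ V)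
    (hG : ∀ i j, ContDiffOn ℝ ∞ (fun y => G y i j) V) (hs : ∀ y ∈ V, (G y).IsSymm)
    (hd : ∀ y ∈ V, (G y).det ≠ 0) (τ : ℝ) :
    ∃ B, ∀ y₀ ∈ K, ∀ L : Fin n → Fin n → ℝ,
      (Matrix.of L).transpose * G y₀ * Matrix.of L = 1 →
      NormalAt (pullMat G (normalMap G (y₀, L))) (lschouten τ (pullMat G (normalMap G (y₀, L)))) B ∧
      ∀ᶠ z in nhds 0, IsPullback (pullMat G (normalMap G (y₀, L))) G (normalMap G (y₀, L)) z := by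
  set O₁ : Set (FrameData n × Euc n) := {q | q.1.1 ∈ V} with hO₁def
  have hO₁ : IsOpen O₁ := hV.preimage (continuous_fst.comp continuous_fst)
  have hF : ContDiffOn ℝ ∞ (fun q : FrameData n × Euc n => normalMap G q.1 q.2) O₁ :=
    contDiffOn_normalMap hV hG hd
  have hJ₁ : SmoothFamily O₁ fun (p : FrameData n) z => jac (normalMap G p) z := fun k a =>
    contDiffOn_pd_param hO₁ (f := fun p z => normalMap G p z k) (contDiffOn_euclidean.1 hF k) a
  set O₂ : Set (FrameData n × Euc n) :=
    O₁ ∩ (fun q : FrameData n × Euc n => normalMap G q.1 q.2) ⁻¹' V with hO₂def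
  have hO₂ : IsOpen O₂ := hF.continuousOn.isOpen_inter_preimage hO₁ hV
  have hJ₂ : SmoothFamily O₂ fun (p : FrameData n) z => jac (normalMap G p) z := fun k a =>
    (hJ₁ k a).mono Set.inter_subset_left
  have hdet : ContinuousOn
      (fun q : FrameData n × Euc n => (jac (normalMap G q.1) q.2).det) O₂ := fun q hq =>
    ((contDiffAt_det (m := ∞) fun i j =>
      (hJ₂ i j).contDiffAt (hO₂.mem_nhds hq)).continuousAt).continuousWithinAt
  set O : Set (FrameData n × Euc n) :=
    O₂ ∩ (fun q : FrameData n × Euc n => (jac (normalMap G q.1) q.2).det) ⁻¹' {0}ᶜ with hOdef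
  have hO : IsOpen O := hdet.isOpen_inter_preimage hO₂ isOpen_compl_singleton
  have hJ : SmoothFamily O fun (p : FrameData n) z => jac (normalMap G p) z := fun k a =>
    (hJ₂ k a).mono Set.inter_subset_left
  have hGψ : SmoothFamily O fun (p : FrameData n) z => G (normalMap G p z) := fun i j =>
    (hG i j).comp (hF.mono fun q hq => hq.1.1) fun q hq => hq.1.2
  have hG' : SmoothFamily O fun (p : FrameData n) z => pullMat G (normalMap G p) z :=
    (hJ.transpose.mul hGψ).mul hJ
  have hd' : ∀ q ∈ O, (pullMat G (normalMap G q.1) q.2).det ≠ 0 := by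
    intro q hq
    rw [pullMat, Matrix.det_mul, Matrix.det_mul, Matrix.det_transpose]
    exact mul_ne_zero (mul_ne_zero hq.2 (hd _ hq.1.2)) hq.2
  have hs' : ∀ q ∈ O, (pullMat G (normalMap G q.1) q.2).IsSymm := by
    intro q hq
    rw [pullMat, Matrix.IsSymm, Matrix.transpose_mul, Matrix.transpose_mul,
      Matrix.transpose_transpose, (hs _ hq.1.2).eq, Matrix.mul_assoc]
  have hA' : SmoothFamily O fun (p : FrameData n) z => lschouten τ (pullMat G (normalMap G p)) z :=
    hG'.lschouten hO hd' τ
  have hΓ' := contDiffOn_lchr_param hO hG' hd'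
  have hΓ1 : ∀ a k i j, ContDiffOn ℝ ∞ (fun q : FrameData n × Euc n =>
      pd a (lchr (pullMat G (normalMap G q.1)) k i j) q.2) O := fun a k i j =>
    contDiffOn_pd_param hO (f := fun p => lchr (pullMat G (normalMap G p)) k i j) (hΓ' k i j) a
  have hΓ2 : ∀ a k i j, ContDiffOn ℝ ∞ (fun q : FrameData n × Euc n =>
      pd2 a (lchr (pullMat G (normalMap G q.1)) k i j) q.2) O := fun a k i j =>
    contDiffOn_pd_param hO (f := fun p => pd a (lchr (pullMat G (normalMap G p)) k i j))
      (hΓ1 a k i j) a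
  have hI2 : ∀ a i j, ContDiffOn ℝ ∞ (fun q : FrameData n × Euc n =>
      pd2 a (fun z => (pullMat G (normalMap G q.1) z)⁻¹ i j) q.2) O := fun a i j =>
    contDiffOn_pd_param hO (f := fun p => pd a (fun z => (pullMat G (normalMap G p) z)⁻¹ i j))
      (contDiffOn_pd_param hO (f := fun p z => (pullMat G (normalMap G p) z)⁻¹ i j)
        (hG'.inv hO hd' i j) a) a
  have hA1 : ∀ a i j, ContDiffOn ℝ ∞ (fun q : FrameData n × Euc n =>
      pd a (fun z => lschouten τ (pullMat G (normalMap G q.1)) z i j) q.2) O := fun a i j =>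
    contDiffOn_pd_param hO (f := fun p z => lschouten τ (pullMat G (normalMap G p)) z i j)
      (hA' i j) a
  have hA2 : ∀ a i j, ContDiffOn ℝ ∞ (fun q : FrameData n × Euc n =>
      pd2 a (fun z => lschouten τ (pullMat G (normalMap G q.1)) z i j) q.2) O := fun a i j =>
    contDiffOn_pd_param hO
      (f := fun p => pd a (fun z => lschouten τ (pullMat G (normalMap G p)) z i j)) (hA1 a i j) a
  -- the compact set of orthonormal frames at points of `K`
  have hKinv : ∀ i : Fin n, ContinuousOn (fun y => (G y)⁻¹ i i) K := fun i y hy =>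
    ((contDiffAt_inv_apply (m := ∞) (fun i j => (hG i j).contDiffAt (hV.mem_nhds (hKV hy)))
      (hd y (hKV hy)) i i).continuousAt).continuousWithinAt
  obtain ⟨R, hR⟩ := exists_abs_le_of_isCompact hK hKinv
  set orth : FrameData n → Fin n → Fin n → ℝ := fun p =>
    ((Matrix.of p.2).transpose * G p.1 * Matrix.of p.2 : Matrix (Fin n) (Fin n) ℝ) with horth
  set C₀ : Set (FrameData n) := (K ×ˢ Metric.closedBall 0 (1 + |R|)) ∩
    orth ⁻¹' {((1 : Matrix (Fin n) (Fin n) ℝ) : Fin n → Fin n → ℝ)} with hC₀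
  have horthc : ContinuousOn orth (K ×ˢ Metric.closedBall 0 (1 + |R|)) := by
    refine continuousOn_pi.2 fun i => continuousOn_pi.2 fun j => ?_
    simp only [horth, Matrix.mul_apply, Matrix.transpose_apply, Matrix.of_apply]
    have hGc : ∀ k l, ContinuousOn (fun p : FrameData n => G p.1 k l)
        (K ×ˢ Metric.closedBall 0 (1 + |R|)) := fun k l =>
      ((hG k l).continuousOn.mono hKV).comp continuousOn_fst fun p hp => hp.1
    have hLc : ∀ k l, ContinuousOn (fun p : FrameData n => p.2 k l)
        (K ×ˢ Metric.closedBall 0 (1 + |R|)) := fun k l => by fun_prop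
    exact continuousOn_finsetSum _ fun k _ => (continuousOn_finsetSum _ fun l _ =>
      (hLc l i).mul (hGc l k)).mul (hLc k j)
  have hprod : IsCompact (K ×ˢ Metric.closedBall (0 : Fin n → Fin n → ℝ) (1 + |R|)) :=
    hK.prod (isCompact_closedBall _ _)
  have hC₀c : IsCompact C₀ := hprod.of_isClosed_subset
    (horthc.preimage_isClosed_of_isClosed hprod.isClosed isClosed_singleton) Set.inter_subset_left
  have hmem : ∀ y₀ ∈ K, ∀ L : Fin n → Fin n → ℝ,
      (Matrix.of L).transpose * G y₀ * Matrix.of L = 1 → (y₀, L) ∈ C₀ := by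
    intro y₀ hy L hL
    refine ⟨⟨hy, ?_⟩, hL⟩
    have h1 : Matrix.of L * (Matrix.of L).transpose = (G y₀)⁻¹ := by
      have h2 : Matrix.of L * ((Matrix.of L).transpose * G y₀) = 1 := mul_eq_one_comm.1 hL
      rw [← Matrix.mul_assoc] at h2
      exact (Matrix.inv_eq_left_inv h2).symm
    rw [mem_closedBall_zero_iff, pi_norm_le_iff_of_nonneg (by positivity)]
    intro i
    rw [pi_norm_le_iff_of_nonneg (by positivity)]
    intro j
    have h3 : ∑ j, L i j * L i j = (G y₀)⁻¹ i i := by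
      rw [← h1]; simp [Matrix.mul_apply]
    have h4 : L i j * L i j ≤ ∑ j, L i j * L i j :=
      Finset.single_le_sum (f := fun j => L i j * L i j) (fun _ _ => mul_self_nonneg _)
        (Finset.mem_univ j)
    have h5 : L i j * L i j ≤ |R| := by
      rw [h3] at h4
      exact h4.trans ((le_abs_self _).trans ((hR i y₀ hy).trans (le_abs_self _)))
    rw [Real.norm_eq_abs]
    exact abs_le_of_sq_le_sq (by nlinarith [abs_nonneg R]) (by positivity)
  set C : Set (FrameData n × Euc n) := C₀ ×ˢ {0} with hCdef
  have hC : IsCompact C := hC₀c.prod isCompact_singleton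
  have hCO : C ⊆ O := by
    rintro ⟨⟨y₀, L⟩, z⟩ ⟨⟨hp, hL⟩, hz⟩
    obtain rfl : z = 0 := hz
    have hyV : y₀ ∈ V := hKV hp.1
    refine ⟨⟨hyV, ?_⟩, ?_⟩
    · show normalMap G (y₀, L) 0 ∈ V
      rw [normalMap_zero]; exact hyV
    · show (jac (normalMap G (y₀, L)) 0).det ≠ 0
      rw [jac_normalMap_zero]
      intro h0
      have hL' : (Matrix.of L).transpose * G y₀ * Matrix.of L = 1 := hL
      have := congrArg Matrix.det hL'
      rw [Matrix.det_mul, h0, mul_zero, Matrix.det_one] at this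
      exact zero_ne_one this
  have bd : ∀ {ι : Type} [Finite ι] {f : ι → FrameData n × Euc n → ℝ},
      (∀ i, ContDiffOn ℝ ∞ (f i) O) → ∃ B, ∀ i, ∀ q ∈ C, |f i q| ≤ B := fun hf =>
    exists_abs_le_of_isCompact hC fun i => (hf i).continuousOn.mono hCO
  obtain ⟨B₁, hB₁⟩ := bd (f := fun (s : Fin n × Fin n × Fin n × Fin n) q =>
    pd s.1 (lchr (pullMat G (normalMap G q.1)) s.2.1 s.2.2.1 s.2.2.2) q.2) fun s => hΓ1 _ _ _ _
  obtain ⟨B₂, hB₂⟩ := bd (f := fun (s : Fin n × Fin n × Fin n × Fin n) q =>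
    pd2 s.1 (lchr (pullMat G (normalMap G q.1)) s.2.1 s.2.2.1 s.2.2.2) q.2) fun s => hΓ2 _ _ _ _
  obtain ⟨B₃, hB₃⟩ := bd (f := fun (s : Fin n × Fin n × Fin n) q =>
    pd2 s.1 (fun z => (pullMat G (normalMap G q.1) z)⁻¹ s.2.1 s.2.2) q.2) fun s => hI2 _ _ _
  obtain ⟨B₄, hB₄⟩ := bd (f := fun (s : Fin n × Fin n) q =>
    lschouten τ (pullMat G (normalMap G q.1)) q.2 s.1 s.2) fun s => hA' _ _
  obtain ⟨B₅, hB₅⟩ := bd (f := fun (s : Fin n × Fin n × Fin n) q =>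
    pd s.1 (fun z => lschouten τ (pullMat G (normalMap G q.1)) z s.2.1 s.2.2) q.2)
    fun s => hA1 _ _ _
  obtain ⟨B₆, hB₆⟩ := bd (f := fun (s : Fin n × Fin n × Fin n) q =>
    pd2 s.1 (fun z => lschouten τ (pullMat G (normalMap G q.1)) z s.2.1 s.2.2) q.2)
    fun s => hA2 _ _ _
  refine ⟨|B₁| + |B₂| + |B₃| + |B₄| + |B₅| + |B₆|, fun y₀ hy L hL => ?_⟩
  have hqC : ((y₀, L), (0 : Euc n)) ∈ C := ⟨hmem y₀ hy L hL, rfl⟩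
  have hqO := hCO hqC
  have hev : ∀ᶠ z in nhds (0 : Euc n), ((y₀, L), z) ∈ O :=
    (Continuous.prodMk_right (y₀, L)).continuousAt.preimage_mem_nhds (hO.mem_nhds hqO)
  have hpull : ∀ z, ((y₀, L), z) ∈ O →
      IsPullback (pullMat G (normalMap G (y₀, L))) G (normalMap G (y₀, L)) z := fun z hz =>
    { map := contDiff_normalMap.contDiffAt.of_le ENat.LEInfty.out
      metric := fun i j => ((hG i j).contDiffAt (hV.mem_nhds hz.1.2)).of_le ENat.LEInfty.out
      symm := by filter_upwards [hV.mem_nhds hz.1.2] with x hx using hs x hx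
      det := hd _ hz.1.2
      jac_det := hz.2
      eq := Filter.Eventually.of_forall fun _ => rfl }
  have hsm : ∀ᶠ z in nhds 0, (pullMat G (normalMap G (y₀, L)) z).IsSymm := by
    filter_upwards [hev] with z hz using hs' ((y₀, L), z) hz
  have hB : ∀ x : ℝ, (|x| ≤ B₁ ∨ |x| ≤ B₂ ∨ |x| ≤ B₃ ∨ |x| ≤ B₄ ∨ |x| ≤ B₅ ∨ |x| ≤ B₆) →
      |x| ≤ |B₁| + |B₂| + |B₃| + |B₄| + |B₅| + |B₆| := by
    intro x hx
    have a1 := abs_nonneg B₁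
    have a2 := abs_nonneg B₂
    have a3 := abs_nonneg B₃
    have a4 := abs_nonneg B₄
    have a5 := abs_nonneg B₅
    have a6 := abs_nonneg B₆
    rcases hx with h | h | h | h | h | h <;> have := h.trans (le_abs_self _) <;> linarith
  refine ⟨?_, hev.mono hpull⟩
  exact
  { smooth := (hG'.contDiffMat (q := ((y₀, L), 0)) hO hqO).of_le ENat.LEInfty.out
    symm := hsm
    one := by
      rw [pullMat, normalMap_zero, jac_normalMap_zero]; exact hL
    chr := by
      intro k i j
      have h0 := hpull 0 hqO
      have h1 := jac_mul_connMat (h0.map.of_le (by norm_num)) (h0.metric.of_le (by norm_num))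
        h0.symm h0.det h0.jac_det h0.eq i
      rw [pdMat_jac_normalMap (by have := h0.symm; rwa [normalMap_zero] at this),
        neg_add_cancel] at h1
      have h2 := congrArg (fun X => (jac (normalMap G (y₀, L)) 0)⁻¹ * X) h1
      simp only [Matrix.mul_zero] at h2
      rw [← Matrix.mul_assoc, h0.jac_inv_mul, Matrix.one_mul] at h2
      exact congrFun (congrFun h2 k) j
    smoothA := (hA'.contDiffMat (q := ((y₀, L), 0)) hO hqO).of_le ENat.LEInfty.out
    symmA := by
      filter_upwards [hev, eventually_eventually_nhds.2 hsm] with z hz hz'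
      exact lschouten_symm τ
        ((hG'.contDiffMat (q := ((y₀, L), z)) hO hz).of_le ENat.LEInfty.out) hz'
        (hd' ((y₀, L), z) hz)
    chr1 := fun a k i j => hB _ (Or.inl (hB₁ (a, k, i, j) ((y₀, L), 0) hqC))
    chr2 := fun a k i j => hB _ (Or.inr (Or.inl (hB₂ (a, k, i, j) ((y₀, L), 0) hqC)))
    inv2 := fun a i j => hB _ (Or.inr (Or.inr (Or.inl (hB₃ (a, i, j) ((y₀, L), 0) hqC))))
    bdA := fun i j => hB _ (Or.inr (Or.inr (Or.inr (Or.inl (hB₄ (i, j) ((y₀, L), 0) hqC)))))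
    bdA1 := fun a i j =>
      hB _ (Or.inr (Or.inr (Or.inr (Or.inr (Or.inl (hB₅ (a, i, j) ((y₀, L), 0) hqC))))))
    bdA2 := fun a i j =>
      hB _ (Or.inr (Or.inr (Or.inr (Or.inr (Or.inr (hB₆ (a, i, j) ((y₀, L), 0) hqC)))))) }

end NormalMap

/-! ### The metric in charts -/

section Charts

variable {n : ℕ} {M : Type*} [TopologicalSpace M] [ChartedSpace (EuclideanSpace ℝ (Fin n)) M]
  [IsManifold (𝓡 n) ∞ M]
  {e e' : OpenPartialHomeomorph M (EuclideanSpace ℝ (Fin n))} {y : Euc n}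

omit [IsManifold (𝓡 n) ∞ M] in
theorem eq_sum_smul_single (v : Euc n) : v = ∑ k, v k • EuclideanSpace.single k (1 : ℝ) := by
  ext i
  simp [Pi.single_apply]

theorem contMDiffOn_frame (he : e ∈ atlas (EuclideanSpace ℝ (Fin n)) M) (i : Fin n) :
    ContMDiffOn (𝓡 n) (𝓡 n).tangent ∞
      (fun y => (⟨e.symm y, frame e i y⟩ : TangentBundle (𝓡 n) M)) e.target := by
  have h1 : ContMDiffOn (𝓡 n) (𝓡 n) ∞ e.symm e.target :=
    contMDiffOn_symm_of_mem_maximalAtlas (IsManifold.subset_maximalAtlas he)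
  have h2 := h1.contMDiffOn_tangentMapWithin (m := ∞) (by simp) e.open_target.uniqueMDiffOn
  have h3 : ContMDiff (𝓡 n) (𝓡 n).tangent ∞ (fun y : Euc n =>
      (⟨y, (EuclideanSpace.single i (1 : ℝ) : Euc n)⟩ : TangentBundle (𝓡 n) (Euc n))) :=
    contMDiff_vectorSpace_iff_contDiff.2 contDiff_const
  have h4 := h2.comp (s := e.target) h3.contMDiffOn fun y hy => hy
  refine h4.congr fun y hy => ?_
  simp only [Function.comp, tangentMapWithin, frame]
  rw [mfderivWithin_of_isOpen e.open_target hy]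

theorem contDiffOn_gMat (g : Metric n M) (he : e ∈ atlas (EuclideanSpace ℝ (Fin n)) M)
    (i j : Fin n) : ContDiffOn ℝ ∞ (fun y => gMat g e y i j) e.target := by
  have h1 : ContMDiffOn (𝓡 n) (𝓡 n) ∞ e.symm e.target :=
    contMDiffOn_symm_of_mem_maximalAtlas (IsManifold.subset_maximalAtlas he)
  have h2 := g.contMDiff.comp_contMDiffOn h1
  have h3 : ContMDiffOn (𝓡 n) ((𝓡 n).prod 𝓘(ℝ)) ∞
      (fun y => Bundle.TotalSpace.mk' ℝ (E := Bundle.Trivial M ℝ) (e.symm y)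
        (g.inner (e.symm y) (frame e i y) (frame e j y))) e.target :=
    ContMDiffOn.clm_bundle_apply₂ (F₁ := Euc n) (F₂ := Euc n) h2 (contMDiffOn_frame he i)
      (contMDiffOn_frame he j)
  rw [← contMDiffOn_iff_contDiffOn]
  intro y hy
  exact (Bundle.contMDiffWithinAt_totalSpace.1 (h3 y hy)).2

theorem gMat_symm (g : Metric n M) (e : OpenPartialHomeomorph M (EuclideanSpace ℝ (Fin n)))
    (y : Euc n) : (gMat g e y).IsSymm := by
  ext i j
  exact g.symm _ _ _

theorem gMat_pos (g : Metric n M) (he : e ∈ atlas (EuclideanSpace ℝ (Fin n)) M)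
    (hy : y ∈ e.target) {v : Fin n → ℝ} (hv : v ≠ 0) :
    0 < ∑ i, ∑ j, v i * v j * gMat g e y i j := by
  set D : Euc n →L[ℝ] TangentSpace (𝓡 n) (e.symm y) := mfderiv (𝓡 n) (𝓡 n) e.symm y with hD
  have hinj : Function.Injective D :=
    (mdifferentiable_of_mem_atlas (I := 𝓡 n) he).symm.mfderiv_injective hy
  set V : Euc n := ∑ k, v k • EuclideanSpace.single k (1 : ℝ) with hV
  have hVk : ∀ k, V k = v k := fun k => by simp [hV, Pi.single_apply]
  have hV0 : V ≠ 0 := by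
    intro h0
    apply hv
    ext k
    rw [← hVk, h0]; rfl
  have hDV : D V ≠ 0 := fun h => hV0 (hinj (by rw [h, map_zero]))
  have h1 := g.pos (e.symm y) (D V) hDV
  have h2 : D V = ∑ k, v k • frame e k y := by
    rw [hV, map_sum]
    exact Finset.sum_congr rfl fun k _ => map_smul _ _ _
  rw [h2] at h1
  simp only [map_sum, map_smul, sum_apply, smul_apply,
    smul_eq_mul, Finset.mul_sum] at h1
  rw [Finset.sum_comm] at h1
  refine h1.trans_le (le_of_eq ?_)
  exact Finset.sum_congr rfl fun i _ => Finset.sum_congr rfl fun j _ => by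
    rw [mul_assoc, gMat, Matrix.of_apply]
    ring

theorem contDiffOn_transition (he : e ∈ atlas (EuclideanSpace ℝ (Fin n)) M)
    (he' : e' ∈ atlas (EuclideanSpace ℝ (Fin n)) M) :
    ContDiffOn ℝ ∞ (e' ∘ e.symm) (e.target ∩ e.symm ⁻¹' e'.source) := by
  have h1 : ContMDiffOn (𝓡 n) (𝓡 n) ∞ e.symm e.target :=
    contMDiffOn_symm_of_mem_maximalAtlas (IsManifold.subset_maximalAtlas he)
  have h2 : ContMDiffOn (𝓡 n) (𝓡 n) ∞ e' e'.source :=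
    contMDiffOn_of_mem_maximalAtlas (IsManifold.subset_maximalAtlas he')
  exact contMDiffOn_iff_contDiffOn.1
    (h2.comp (h1.mono Set.inter_subset_left) Set.inter_subset_right)

omit [ChartedSpace (EuclideanSpace ℝ (Fin n)) M] [IsManifold (𝓡 n) ∞ M] in
theorem isOpen_transition : IsOpen (e.target ∩ e.symm ⁻¹' e'.source) :=
  e.isOpen_inter_preimage_symm e'.open_source

theorem frame_transition (he : e ∈ atlas (EuclideanSpace ℝ (Fin n)) M)
    (he' : e' ∈ atlas (EuclideanSpace ℝ (Fin n)) M)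
    (hy : y ∈ e.target ∩ e.symm ⁻¹' e'.source) (i : Fin n) :
    (frame e i y : Euc n)
      = ∑ k, jac (e' ∘ e.symm) y k i • (frame e' k ((e' ∘ e.symm) y) : Euc n) := by
  set ψ := e' ∘ e.symm with hψ
  have hψd : DifferentiableAt ℝ ψ y :=
    ((contDiffOn_transition he he').contDiffAt (isOpen_transition.mem_nhds hy)).differentiableAt
      (by simp)
  have hy' : ψ y ∈ e'.target := e'.map_source hy.2
  have h1 : e.symm =ᶠ[nhds y] e'.symm ∘ ψ := by
    filter_upwards [(isOpen_transition (e := e) (e' := e')).mem_nhds hy] with x hx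
    exact (e'.left_inv hx.2).symm
  have h2 : mfderiv (𝓡 n) (𝓡 n) e.symm y = mfderiv (𝓡 n) (𝓡 n) (e'.symm ∘ ψ) y :=
    h1.mfderiv_eq
  have h3 := mfderiv_comp y ((mdifferentiableAt_atlas_symm (I := 𝓡 n) he' hy') :
    MDifferentiableAt (𝓡 n) (𝓡 n) e'.symm (ψ y)) hψd.mdifferentiableAt
  have h4 : (frame e i y : Euc n) = mfderiv (𝓡 n) (𝓡 n) e'.symm (ψ y)
      (fderiv ℝ ψ y (EuclideanSpace.single i (1 : ℝ))) := by
    rw [frame, h2, h3, mfderiv_eq_fderiv]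
    rfl
  have h5 : fderiv ℝ ψ y (EuclideanSpace.single i (1 : ℝ))
      = ∑ k, jac ψ y k i • EuclideanSpace.single k (1 : ℝ) := by
    rw [eq_sum_smul_single (fderiv ℝ ψ y (EuclideanSpace.single i (1 : ℝ)))]
    refine Finset.sum_congr rfl fun k _ => ?_
    congr 1
    exact (pd_eq_fderiv ψ (EuclideanSpace.proj (𝕜 := ℝ) k) hψd i).symm
  rw [h4, h5]
  exact (map_sum (mfderiv (𝓡 n) (𝓡 n) e'.symm (ψ y)) _ _).trans
    (Finset.sum_congr rfl fun k _ => map_smul _ _ _)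

theorem gMat_transition (g : Metric n M) (he : e ∈ atlas (EuclideanSpace ℝ (Fin n)) M)
    (he' : e' ∈ atlas (EuclideanSpace ℝ (Fin n)) M)
    (hy : y ∈ e.target ∩ e.symm ⁻¹' e'.source) :
    gMat g e y = pullMat (gMat g e') (e' ∘ e.symm) y := by
  have hp : e'.symm ((e' ∘ e.symm) y) = e.symm y := e'.left_inv hy.2
  have hin : ∀ (p p' : M) (_ : p = p') (v w : Euc n),
      g.inner p (v : TangentSpace (𝓡 n) p) (w : TangentSpace (𝓡 n) p)
        = g.inner p' (v : TangentSpace (𝓡 n) p') (w : TangentSpace (𝓡 n) p') := by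
    rintro p _ rfl v w; rfl
  have h1 : ∀ i j, gMat g e y i j = ∑ k, ∑ l, jac (e' ∘ e.symm) y k i * (jac (e' ∘ e.symm) y l j
      * gMat g e' ((e' ∘ e.symm) y) k l) := by
    intro i j
    have h2 : gMat g e y i j = g.inner (e'.symm ((e' ∘ e.symm) y))
        (∑ k, jac (e' ∘ e.symm) y k i • frame e' k ((e' ∘ e.symm) y))
        (∑ l, jac (e' ∘ e.symm) y l j • frame e' l ((e' ∘ e.symm) y)) :=
      (hin _ _ hp.symm _ _).trans (congrArg₂
        (fun v w : TangentSpace (𝓡 n) (e'.symm ((e' ∘ e.symm) y)) => g.inner _ v w)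
        (frame_transition he he' hy i) (frame_transition he he' hy j))
    rw [h2]
    simp only [map_sum, map_smul, sum_apply, smul_apply,
      smul_eq_mul, Finset.mul_sum]
    rw [Finset.sum_comm]
    exact Finset.sum_congr rfl fun k _ => Finset.sum_congr rfl fun l _ => by
      rw [gMat, Matrix.of_apply]; ring
  ext i j
  simp only [h1, pullMat, Matrix.mul_apply, Matrix.transpose_apply, Finset.sum_mul]
  rw [Finset.sum_comm]
  exact Finset.sum_congr rfl fun k _ => Finset.sum_congr rfl fun l _ => by ring

end Charts

/-! ### Normal parametrizations of a compact manifold -/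

section SimultaneousDiagonalization

variable {n : ℕ}

theorem det_ne_zero_of_pos {G : Matrix (Fin n) (Fin n) ℝ}
    (hG : ∀ v : Fin n → ℝ, v ≠ 0 → 0 < ∑ i, ∑ j, v i * v j * G i j) : G.det ≠ 0 := by
  intro h
  obtain ⟨v, hv, h0⟩ := Matrix.exists_mulVec_eq_zero_iff.2 h
  have h1 : ∑ i, ∑ j, v i * v j * G i j = ∑ i, v i * (G.mulVec v) i := by
    simp only [Matrix.mulVec, dotProduct, Finset.mul_sum]
    exact Finset.sum_congr rfl fun i _ => Finset.sum_congr rfl fun j _ => by ring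
  have := hG v hv
  rw [h1, h0] at this
  simp at this

/-- A positive definite form and a symmetric form can be diagonalized simultaneously. -/
theorem exists_simultaneous_diagonalization {G U : Matrix (Fin n) (Fin n) ℝ} (hGs : G.IsSymm)
    (hG : ∀ v : Fin n → ℝ, v ≠ 0 → 0 < ∑ i, ∑ j, v i * v j * G i j) (hU : U.IsSymm) :
    ∃ (L : Matrix (Fin n) (Fin n) ℝ) (x : Fin n → ℝ),
      L.transpose * G * L = 1 ∧ L.transpose * U * L = Matrix.diagonal x := by
  obtain ⟨V, d, hV1, hV2, hGV⟩ := exists_orthogonal_diagonalization hGs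
  have hd : ∀ i, 0 < d i := by
    intro i
    have h1 : (V.transpose * G * V) i i = d i := by
      have : V.transpose * G * V = Matrix.diagonal d := by
        rw [hGV]
        calc _ = (V.transpose * V) * Matrix.diagonal d * (V.transpose * V) := by noncomm_ring
          _ = _ := by rw [hV2]; simp
      rw [this]; simp
    have h2 : (fun a => V a i) ≠ 0 := by
      intro h0
      have h3 := congrFun (congrFun hV2 i) i
      rw [Matrix.mul_apply] at h3
      have h4 : ∀ a, V a i = 0 := fun a => congrFun h0 a
      simp [h4] at h3
    refine (hG _ h2).trans_le (le_of_eq ?_)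
    rw [← h1]
    simp only [Matrix.mul_apply, Matrix.transpose_apply, Finset.sum_mul]
    rw [Finset.sum_comm]
    exact Finset.sum_congr rfl fun a _ => Finset.sum_congr rfl fun b _ => by ring
  set D : Matrix (Fin n) (Fin n) ℝ := Matrix.diagonal fun i => (√(d i))⁻¹ with hD
  have hDt : D.transpose = D := Matrix.diagonal_transpose _
  have hDd : D * Matrix.diagonal d * D = 1 := by
    rw [hD, Matrix.diagonal_mul_diagonal, Matrix.diagonal_mul_diagonal, ← Matrix.diagonal_one]
    congr 1
    ext i
    have h1 := Real.sqrt_pos.2 (hd i)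
    have h2 := Real.mul_self_sqrt (hd i).le
    field_simp
    nlinarith
  have h0 : (V * D).transpose * G * (V * D) = 1 := by
    rw [hGV, Matrix.transpose_mul, hDt]
    calc _ = D * (V.transpose * V) * Matrix.diagonal d * (V.transpose * V) * D := by noncomm_ring
      _ = _ := by rw [hV2, Matrix.mul_one, Matrix.mul_one, hDd]
  obtain ⟨V', x, hV1', hV2', hUV⟩ := exists_orthogonal_diagonalization
    (A := (V * D).transpose * U * (V * D)) (by
      rw [Matrix.IsSymm, Matrix.transpose_mul _ (V * D), Matrix.transpose_mul _ U,
        Matrix.transpose_transpose, hU.eq, Matrix.mul_assoc])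
  refine ⟨V * D * V', x, ?_, ?_⟩
  · rw [Matrix.transpose_mul]
    calc _ = V'.transpose * ((V * D).transpose * G * (V * D)) * V' := by noncomm_ring
      _ = _ := by rw [h0, Matrix.mul_one, hV2']
  · rw [Matrix.transpose_mul]
    calc _ = V'.transpose * ((V * D).transpose * U * (V * D)) * V' := by noncomm_ring
      _ = (V'.transpose * V') * Matrix.diagonal x * (V'.transpose * V') := by
        rw [hUV]; noncomm_ring
      _ = _ := by rw [hV2', Matrix.one_mul, Matrix.mul_one]

theorem splits_charpoly_inv_mul {G U : Matrix (Fin n) (Fin n) ℝ} (hGs : G.IsSymm)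
    (hG : ∀ v : Fin n → ℝ, v ≠ 0 → 0 < ∑ i, ∑ j, v i * v j * G i j) (hU : U.IsSymm) :
    (G⁻¹ * U).charpoly.Splits := by
  obtain ⟨L, x, h1, h2⟩ := exists_simultaneous_diagonalization hGs hG hU
  have h3 : L * (L.transpose * G) = 1 := mul_eq_one_comm.1 h1
  have h4 : G⁻¹ = L * L.transpose := Matrix.inv_eq_left_inv (by rw [Matrix.mul_assoc, h3])
  have h5 : G⁻¹ * U = L * Matrix.diagonal x * (L.transpose * G) := by
    rw [← h2, h4]
    calc _ = L * L.transpose * U * 1 := by noncomm_ring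
      _ = _ := by rw [← h3]; noncomm_ring
  rw [h5, charpoly_conj h1, Matrix.charpoly_diagonal]
  exact Polynomial.Splits.prod fun i _ => Polynomial.Splits.X_sub_C _

end SimultaneousDiagonalization

section LocalSymmetry

variable {n : ℕ} {G A : Euc n → Matrix (Fin n) (Fin n) ℝ} {w w' : Euc n → ℝ} {y : Euc n}

theorem coreMat_symm (hw : ContDiffAt ℝ 2 w y) (hs : ∀ᶠ z in nhds y, (G z).IsSymm)
    (hA : (A y).IsSymm) (t : ℝ) : (coreMat G A t w y).IsSymm := by
  ext i j
  simp only [coreMat, Matrix.transpose_apply, Matrix.sub_apply, Matrix.smul_apply, lhess,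
    Matrix.of_apply, Matrix.vecMulVec_apply, hA.apply i j, pd_comm hw j i,
    fun k => lchr_symm hs k j i]
  ring

theorem lhess_congr (h : w =ᶠ[nhds y] w') : lhess G w y = lhess G w' y := by
  ext i j
  simp only [lhess, Matrix.of_apply, pd_congr (pd_eventuallyEq h j) i, pd_congr h]

theorem lapl_congr (h : w =ᶠ[nhds y] w') : lapl G w y = lapl G w' y := by
  rw [lapl, lapl, lhess_congr h]

theorem lgradSq_congr (h : w =ᶠ[nhds y] w') : lgradSq G w y = lgradSq G w' y := by
  simp only [lgradSq, pd_congr h]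

theorem lhessSq_congr (h : w =ᶠ[nhds y] w') : lhessSq G w y = lhessSq G w' y := by
  simp only [lhessSq, lhess_congr h]

theorem endoMat_congr (κ μ t : ℝ) (h : w =ᶠ[nhds y] w') :
    endoMat G A κ μ t w y = endoMat G A κ μ t w' y := by
  simp only [endoMat, coreMat, lhess_congr h, lapl_congr h, lgradSq_congr h, pd_congr h]

theorem NormalAt.mono {B B' : ℝ} (h : NormalAt G A B) (hB : B ≤ B') : NormalAt G A B' :=
  { h with
    chr1 := fun a k i j => (h.chr1 a k i j).trans hB
    chr2 := fun a k i j => (h.chr2 a k i j).trans hB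
    inv2 := fun a i j => (h.inv2 a i j).trans hB
    bdA := fun i j => (h.bdA i j).trans hB
    bdA1 := fun a i j => (h.bdA1 a i j).trans hB
    bdA2 := fun a i j => (h.bdA2 a i j).trans hB }

theorem jac_comp {θ ψ : Euc n → Euc n} {z : Euc n} (hθ : DifferentiableAt ℝ θ (ψ z))
    (hψ : DifferentiableAt ℝ ψ z) : jac (θ ∘ ψ) z = jac θ (ψ z) * jac ψ z := by
  ext k a
  have hk : DifferentiableAt ℝ (fun x => θ x k) (ψ z) :=
    (differentiableAt_piLp 2).1 hθ k
  rw [Matrix.mul_apply]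
  refine (pd_comp (f := fun x => θ x k) hk hψ a).trans ?_
  exact Finset.sum_congr rfl fun i _ => mul_comm _ _

end LocalSymmetry

section NormalParametrization

variable {n : ℕ} {M : Type*} [TopologicalSpace M] [ChartedSpace (EuclideanSpace ℝ (Fin n)) M]
  [IsManifold (𝓡 n) ∞ M]
  {e : OpenPartialHomeomorph M (EuclideanSpace ℝ (Fin n))} {y : Euc n}

theorem gMat_det (g : Metric n M) (he : e ∈ atlas (EuclideanSpace ℝ (Fin n)) M)
    (hy : y ∈ e.target) : (gMat g e y).det ≠ 0 :=
  det_ne_zero_of_pos fun _ hv => gMat_pos g he hy hv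

theorem gradSq_eq_lgradSq (g : Metric n M) (u : M → ℝ) :
    gradSq g e u y = lgradSq (gMat g e) (u ∘ e.symm) y := rfl

theorem inv_mul_UMat (g : Metric n M) (he : e ∈ atlas (EuclideanSpace ℝ (Fin n)) M)
    (hy : y ∈ e.target) (τ t : ℝ) (u : M → ℝ) :
    (gMat g e y)⁻¹ * UMat g τ t e u y = endoMat (gMat g e) (lschouten τ (gMat g e))
      ((1 - τ) / ((n : ℝ) - 2)) ((2 - τ) / 2) t (u ∘ e.symm) y := by
  have hu : IsUnit (gMat g e y).det := isUnit_iff_ne_zero.2 (gMat_det g he hy)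
  have h1 : UMat g τ t e u y = coreMat (gMat g e) (lschouten τ (gMat g e)) t (u ∘ e.symm) y
      + ((1 - τ) / ((n : ℝ) - 2) * lapl (gMat g e) (u ∘ e.symm) y
        + (2 - τ) / 2 * lgradSq (gMat g e) (u ∘ e.symm) y + (1 - t)) • gMat g e y := by
    have e1 : hessMat g e u y = lhess (gMat g e) (u ∘ e.symm) y := rfl
    have e2 : schoutenMat g τ e y = lschouten τ (gMat g e) y := rfl
    have e3 : gradVec e u y = fun i => pd i (u ∘ e.symm) y := rfl
    have e4 : trg g e y (lhess (gMat g e) (u ∘ e.symm) y) = lapl (gMat g e) (u ∘ e.symm) y := rfl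
    rw [UMat, e1, e2, e3, e4, gradSq_eq_lgradSq, coreMat]
    simp only [add_smul]
    abel
  rw [h1, Matrix.mul_add, Matrix.mul_smul, Matrix.nonsing_inv_mul _ hu, endoMat]

theorem contDiffAt_comp_chart_symm {m : WithTop ℕ∞} (hm : m ≤ (∞ : WithTop ℕ∞)) {u : M → ℝ}
    (hu : ContMDiff (𝓡 n) 𝓘(ℝ) m u) (he : e ∈ atlas (EuclideanSpace ℝ (Fin n)) M)
    (hy : y ∈ e.target) : ContDiffAt ℝ m (u ∘ e.symm) y := by
  have h1 : ContMDiffAt (𝓡 n) (𝓡 n) m e.symm y :=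
    (contMDiffAt_symm_of_mem_maximalAtlas (I := 𝓡 n) (n := ∞)
      (IsManifold.subset_maximalAtlas he) hy).of_le hm
  exact (hu.contMDiffAt.comp y h1).contDiffAt

/-- The elementary symmetric functions of the eigenvalues of `g⁻¹ U` are the coefficients of its
characteristic polynomial, which splits since `U` is symmetric and `g` positive definite. -/
theorem sigma_lamU (g : Metric n M) (τ t : ℝ) {u : M → ℝ} (hu : ContMDiff (𝓡 n) 𝓘(ℝ) 4 u) (p : M)
    {j : ℕ} (hj : j ≤ n) : sigma j (lamU g τ t u p)
      = charSigma j (endoMat (gMat g (chartAt (Euc n) p)) (lschouten τ (gMat g (chartAt (Euc n) p)))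
          ((1 - τ) / ((n : ℝ) - 2)) ((2 - τ) / 2) t (u ∘ (chartAt (Euc n) p).symm)
          (chartAt (Euc n) p p)) := by
  set e := chartAt (Euc n) p with he
  have hea : e ∈ atlas (Euc n) M := chart_mem_atlas _ p
  have hp : e p ∈ e.target := mem_chart_target _ p
  have hG : ∀ i j, ContDiffAt ℝ ∞ (fun y => gMat g e y i j) (e p) := fun i j =>
    (contDiffOn_gMat g hea i j).contDiffAt (e.open_target.mem_nhds hp)
  have hs : ∀ᶠ z in nhds (e p), (gMat g e z).IsSymm := Filter.Eventually.of_forall (gMat_symm g e)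
  have hw : ContDiffAt ℝ 2 (u ∘ e.symm) (e p) :=
    (contDiffAt_comp_chart_symm (ENat.LEInfty.out : (4 : WithTop ℕ∞) ≤ (∞ : WithTop ℕ∞)) hu hea
      hp).of_le (by norm_num)
  have hA : (lschouten τ (gMat g e) (e p)).IsSymm :=
    lschouten_symm τ (fun i j => (hG i j).of_le ENat.LEInfty.out) hs (gMat_det g hea hp)
  rw [← inv_mul_UMat g hea hp, ← sigma_eigenvals ?_ hj]
  · rfl
  · refine splits_charpoly_inv_mul (gMat_symm g e _) (fun v hv => gMat_pos g hea hp hv) ?_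
    have h1 : UMat g τ t e u (e p) = coreMat (gMat g e) (lschouten τ (gMat g e)) t (u ∘ e.symm)
        (e p) + ((1 - τ) / ((n : ℝ) - 2) * lapl (gMat g e) (u ∘ e.symm) (e p)
        + (2 - τ) / 2 * lgradSq (gMat g e) (u ∘ e.symm) (e p) + (1 - t)) • gMat g e (e p) := by
      have h2 := congrArg (fun X => gMat g e (e p) * X) (inv_mul_UMat g hea hp τ t u)
      have hu : IsUnit (gMat g e (e p)).det := isUnit_iff_ne_zero.2 (gMat_det g hea hp)
      simp only [endoMat, Matrix.mul_add, ← Matrix.mul_assoc, Matrix.mul_nonsing_inv _ hu,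
        Matrix.one_mul, Matrix.mul_smul, Matrix.mul_one] at h2
      exact h2
    rw [h1]
    exact (coreMat_symm hw hs hA t).add ((gMat_symm g e _).smul _)

/-- `Ψ` parametrizes a neighbourhood of `Ψ 0` by normal coordinates, in which the metric is given
by the matrix field `G` and the jets of the metric and of `A^τ` are bounded by `B`. The field
`chart` compares, at each nearby point `Ψ z`, these coordinates with the preferred chart. -/
structure IsNormalParam (g : Metric n M) (τ B : ℝ) (Ψ : Euc n → M)
    (G : Euc n → Matrix (Fin n) (Fin n) ℝ) : Prop where
  normal : NormalAt G (lschouten τ G) B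
  smooth : ∀ {m : WithTop ℕ∞}, m ≤ (∞ : WithTop ℕ∞) → ∀ {f : M → ℝ}, ContMDiff (𝓡 n) 𝓘(ℝ) m f →
    ContDiffAt ℝ m (fun z => f (Ψ z)) 0
  chart : ∀ᶠ z in nhds 0,
    IsPullback G (gMat g (chartAt (Euc n) (Ψ z))) (chartAt (Euc n) (Ψ z) ∘ Ψ) z ∧
      ∀ᶠ x in nhds z, Ψ x ∈ (chartAt (Euc n) (Ψ z)).source

/-- A compact manifold has normal parametrizations at all points with uniformly bounded jets, and
they may be chosen to diagonalize the endomorphism `g⁻¹ U` of a given function at the centre. -/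
theorem exists_isNormalParam [CompactSpace M] (g : Metric n M) (τ κ μ : ℝ) :
    ∃ B, ∀ (p : M) (t : ℝ) (u : M → ℝ), ContMDiff (𝓡 n) 𝓘(ℝ) 4 u →
      ∃ (Ψ : Euc n → M) (G : Euc n → Matrix (Fin n) (Fin n) ℝ) (x : Fin n → ℝ), Ψ 0 = p ∧
        IsNormalParam g τ B Ψ G ∧
        endoMat G (lschouten τ G) κ μ t (fun z => u (Ψ z)) 0 = Matrix.diagonal x := by
  have hK : ∀ q : M, ∃ r > 0, Metric.closedBall (chartAt (Euc n) q q) r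
      ⊆ (chartAt (Euc n) q).target := fun q =>
    Metric.nhds_basis_closedBall.mem_iff.1
      ((chartAt (Euc n) q).open_target.mem_nhds (mem_chart_target _ q))
  choose r hr hrt using hK
  have hB : ∀ q : M, ∃ B, ∀ y₀ ∈ Metric.closedBall (chartAt (Euc n) q q) (r q),
      ∀ L : Fin n → Fin n → ℝ,
      (Matrix.of L).transpose * gMat g (chartAt (Euc n) q) y₀ * Matrix.of L = 1 →
      NormalAt (pullMat (gMat g (chartAt (Euc n) q))
          (normalMap (gMat g (chartAt (Euc n) q)) (y₀, L)))
        (lschouten τ (pullMat (gMat g (chartAt (Euc n) q))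
          (normalMap (gMat g (chartAt (Euc n) q)) (y₀, L)))) B ∧
      ∀ᶠ z in nhds 0, IsPullback (pullMat (gMat g (chartAt (Euc n) q))
        (normalMap (gMat g (chartAt (Euc n) q)) (y₀, L))) (gMat g (chartAt (Euc n) q))
          (normalMap (gMat g (chartAt (Euc n) q)) (y₀, L)) z := fun q =>
    exists_normalAt (chartAt (Euc n) q).open_target (isCompact_closedBall _ _) (hrt q)
      (contDiffOn_gMat g (chart_mem_atlas _ q)) (fun y _ => gMat_symm g _ y)
      (fun y hy => gMat_det g (chart_mem_atlas _ q) hy) τ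
  choose B hB using hB
  -- Finitely many of the compact coordinate balls cover `M`, so that one bound serves all points.
  have hN : ∀ q : M, (chartAt (Euc n) q).source ∩
      (chartAt (Euc n) q) ⁻¹' Metric.closedBall (chartAt (Euc n) q q) (r q) ∈ nhds q := fun q =>
    Filter.inter_mem ((chartAt (Euc n) q).open_source.mem_nhds (mem_chart_source _ q))
      (((chartAt (Euc n) q).continuousAt (mem_chart_source _ q)).preimage_mem_nhds
        (Metric.closedBall_mem_nhds _ (hr q)))
  obtain ⟨s, hs⟩ := CompactSpace.elim_nhds_subcover _ hN
  refine ⟨∑ q ∈ s, |B q|, fun p t u hu => ?_⟩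
  obtain ⟨q, hqs, hpe, hpK⟩ : ∃ q ∈ s, p ∈ (chartAt (Euc n) q).source ∧
      chartAt (Euc n) q p ∈ Metric.closedBall (chartAt (Euc n) q q) (r q) := by
    have : p ∈ ⋃ q ∈ s, (chartAt (Euc n) q).source ∩
      (chartAt (Euc n) q) ⁻¹' Metric.closedBall (chartAt (Euc n) q q) (r q) := by rw [hs]; trivial
    simpa only [Set.mem_iUnion, exists_prop, Set.mem_inter_iff, Set.mem_preimage] using this
  set e := chartAt (Euc n) q with he
  have hea : e ∈ atlas (Euc n) M := chart_mem_atlas _ q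
  set y₀ := e p with hy₀
  have hy : y₀ ∈ e.target := e.map_source hpe
  set w := u ∘ e.symm with hw
  have hw4 : ContDiffAt ℝ 4 w y₀ :=
    contDiffAt_comp_chart_symm (ENat.LEInfty.out : (4 : WithTop ℕ∞) ≤ (∞ : WithTop ℕ∞)) hu hea hy
  have hw2 : ContDiffAt ℝ 2 w y₀ := hw4.of_le (by norm_num)
  have hGc : ∀ i j, ContDiffAt ℝ ∞ (fun y => gMat g e y i j) y₀ := fun i j =>
    (contDiffOn_gMat g hea i j).contDiffAt (e.open_target.mem_nhds hy)
  have hsy : ∀ᶠ z in nhds y₀, (gMat g e z).IsSymm := Filter.Eventually.of_forall (gMat_symm g e)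
  have hA : (lschouten τ (gMat g e) y₀).IsSymm :=
    lschouten_symm τ (fun i j => (hGc i j).of_le ENat.LEInfty.out) hsy (gMat_det g hea hy)
  obtain ⟨L, x, hL, hLx⟩ := exists_simultaneous_diagonalization (gMat_symm g e y₀)
    (fun v hv => gMat_pos g hea hy hv) (coreMat_symm hw2 hsy hA t)
  set ψ := normalMap (gMat g e) (y₀, L) with hψ
  set G' := pullMat (gMat g e) ψ with hG'
  obtain ⟨hnorm, hpull⟩ := hB q y₀ hpK L hL
  have hψ0 : ψ 0 = y₀ := normalMap_zero
  have hψc : ContDiff ℝ ∞ ψ := contDiff_normalMap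
  have hψt : ∀ᶠ z in nhds 0, ψ z ∈ e.target :=
    hψc.continuous.continuousAt.preimage_mem_nhds (by rw [hψ0]; exact e.open_target.mem_nhds hy)
  have hJ0 : jac ψ 0 = L := jac_normalMap_zero
  refine ⟨fun z => e.symm (ψ z), G', fun i => x i + (κ * lapl G' (fun z => w (ψ z)) 0
    + μ * lgradSq G' (fun z => w (ψ z)) 0 + (1 - t)), ?_, ?_, ?_⟩
  · show e.symm (ψ 0) = p
    rw [hψ0]; exact e.left_inv hpe
  · refine ⟨hnorm.mono ?_, fun {m} hm {f} hf => ?_, ?_⟩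
    · exact (le_abs_self _).trans
        (Finset.single_le_sum (f := fun q => |B q|) (fun _ _ => abs_nonneg _) hqs)
    · refine ContDiffAt.comp (0 : Euc n) (g := f ∘ e.symm) ?_ (hψc.contDiffAt.of_le hm)
      rw [hψ0]; exact contDiffAt_comp_chart_symm hm hf hea hy
    · filter_upwards [hψt, hpull] with z hz hpz
      set e' := chartAt (Euc n) (e.symm (ψ z)) with he'
      have hea' : e' ∈ atlas (Euc n) M := chart_mem_atlas _ _
      have hsrc : ψ z ∈ e.target ∩ e.symm ⁻¹' e'.source := ⟨hz, mem_chart_source _ _⟩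
      have hopen : ∀ᶠ x in nhds z, ψ x ∈ e.target ∩ e.symm ⁻¹' e'.source :=
        hψc.continuous.continuousAt.preimage_mem_nhds (isOpen_transition.mem_nhds hsrc)
      have hθ : ∀ x, ψ x ∈ e.target ∩ e.symm ⁻¹' e'.source → ContDiffAt ℝ ∞ (e' ∘ e.symm) (ψ x) :=
        fun x hx => (contDiffOn_transition hea hea').contDiffAt (isOpen_transition.mem_nhds hx)
      have hjac : ∀ x, ψ x ∈ e.target ∩ e.symm ⁻¹' e'.source →
          jac ((e' ∘ e.symm) ∘ ψ) x = jac (e' ∘ e.symm) (ψ x) * jac ψ x := fun x hx =>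
        jac_comp ((hθ x hx).differentiableAt (by simp))
          (hψc.contDiffAt.differentiableAt (by simp))
      have ht' : (e' ∘ e.symm) (ψ z) ∈ e'.target := e'.map_source hsrc.2
      refine ⟨?_, hopen.mono fun x hx => hx.2⟩
      exact
      { map := ((hθ z hsrc).comp z hψc.contDiffAt).of_le ENat.LEInfty.out
        metric := fun i j => ((contDiffOn_gMat g hea' i j).contDiffAt
          (e'.open_target.mem_nhds ht')).of_le ENat.LEInfty.out
        symm := Filter.Eventually.of_forall (gMat_symm g e')
        det := gMat_det g hea' ht'
        jac_det := by
          have h1 := hjac z hsrc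
          have h2 : jac (e' ∘ fun z => e.symm (ψ z)) z = jac ((e' ∘ e.symm) ∘ ψ) z := rfl
          rw [h2, h1, Matrix.det_mul]
          refine mul_ne_zero (fun h0 => gMat_det g hea hz ?_) hpz.jac_det
          rw [gMat_transition g hea hea' hsrc, pullMat, Matrix.det_mul, h0, mul_zero]
        eq := by
          filter_upwards [hopen] with x hx
          have h2 : jac (e' ∘ fun z => e.symm (ψ z)) x = jac ((e' ∘ e.symm) ∘ ψ) x := rfl
          rw [h2, hjac x hx, hG', pullMat, gMat_transition g hea hea' hx, pullMat,
            Matrix.transpose_mul]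
          simp only [Matrix.mul_assoc, Function.comp] }
  · have h0 := hpull.self_of_nhds
    have hw2' : ContDiffAt ℝ 2 w (ψ 0) := by rw [hψ0]; exact hw2
    have h1 : coreMat G' (lschouten τ G') t (fun z => w (ψ z)) 0 = Matrix.diagonal x := by
      have := h0.core_eq hw2' (A := lschouten τ (gMat g e)) t (h0.schouten_eq τ)
      rw [← hψ, hJ0, hψ0] at this
      exact this.trans hLx
    show endoMat G' (lschouten τ G') κ μ t (fun z => w (ψ z)) 0 = _
    have hone : G' 0 = 1 := hnorm.one
    rw [endoMat, h1, hone, inv_one, Matrix.one_mul, ← Matrix.diagonal_one,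
      ← Matrix.diagonal_smul, Matrix.diagonal_add]
    congr 1
    ext i
    simp

namespace IsNormalParam

variable {g : Metric n M} {τ B : ℝ} {Ψ : Euc n → M} {G : Euc n → Matrix (Fin n) (Fin n) ℝ}
  (h : IsNormalParam g τ B Ψ G) {f : M → ℝ}
include h

/-- Near the centre, scalar quantities computed in the preferred charts agree with those computed
in normal coordinates. -/
theorem eventually_invariance (hf : ContMDiff (𝓡 n) 𝓘(ℝ) 4 f) : ∀ᶠ z in nhds 0,
    lapl G (fun x => f (Ψ x)) z = lapl (gMat g (chartAt (Euc n) (Ψ z)))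
        (f ∘ (chartAt (Euc n) (Ψ z)).symm) (chartAt (Euc n) (Ψ z) (Ψ z)) ∧
      lgradSq G (fun x => f (Ψ x)) z = gradSq g (chartAt (Euc n) (Ψ z)) f
        (chartAt (Euc n) (Ψ z) (Ψ z)) ∧
      lhessSq G (fun x => f (Ψ x)) z = hessSq g (chartAt (Euc n) (Ψ z)) f
        (chartAt (Euc n) (Ψ z) (Ψ z)) ∧
      ∀ t, ∀ j ≤ n, sigma j (lamU g τ t f (Ψ z)) = charSigma j (endoMat G (lschouten τ G)
        ((1 - τ) / ((n : ℝ) - 2)) ((2 - τ) / 2) t (fun x => f (Ψ x)) z) := by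
  filter_upwards [h.chart] with z hz
  obtain ⟨hp, hsrc⟩ := hz
  set e := chartAt (Euc n) (Ψ z) with he
  have hw : ContDiffAt ℝ 2 (f ∘ e.symm) ((e ∘ Ψ) z) :=
    (contDiffAt_comp_chart_symm (ENat.LEInfty.out : (4 : WithTop ℕ∞) ≤ (∞ : WithTop ℕ∞)) hf
      (chart_mem_atlas _ _) (mem_chart_target _ _)).of_le (by norm_num)
  have hc : (fun x => f (Ψ x)) =ᶠ[nhds z] fun x => (f ∘ e.symm) ((e ∘ Ψ) x) := by
    filter_upwards [hsrc] with x hx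
    simp only [Function.comp]
    rw [e.left_inv hx]
  refine ⟨?_, ?_, ?_, fun t j hj => ?_⟩
  · rw [lapl_congr hc, hp.lapl_eq hw]; rfl
  · rw [lgradSq_congr hc, hp.gradSq_eq (hw.differentiableAt two_ne_zero)]; rfl
  · rw [lhessSq_congr hc, hp.hessSq_eq hw]; rfl
  · rw [endoMat_congr _ _ _ hc, hp.charSigma_endo_eq hw _ _ _ (hp.schouten_eq τ),
      sigma_lamU g τ t hf _ hj]
    rfl

end IsNormalParam

end NormalParametrization

/-! ### The estimate on a compact manifold -/

section TraceBound

variable {n : ℕ} {G A : Euc n → Matrix (Fin n) (Fin n) ℝ} {w : Euc n → ℝ}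

theorem es_one (s : Finset (Fin n)) (x : Fin n → ℝ) : es s 1 x = ∑ i ∈ s, x i := by
  simp [es, Finset.powersetCard_one]

/-- On `Γ_2` every eigenvalue is controlled by the trace. -/
theorem abs_le_of_mem_gam {x : Fin n → ℝ} (hx : x ∈ gam Finset.univ 2) (i : Fin n) :
    |x i| ≤ n * ∑ j, x j := by
  set s := ∑ j, x j with hs
  have hle : ∀ j, x j ≤ s := by
    intro j
    have h1 := mem_gam_erase (Finset.mem_univ j) hx 1 le_rfl
    rw [es_one] at h1
    have := Finset.add_sum_erase Finset.univ x (Finset.mem_univ j)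
    linarith
  have hs0 : 0 < s := by
    have := hx 1 (by norm_num)
    rwa [es_one] at this
  have hn : (1 : ℝ) ≤ n := by
    have : 0 < n := i.pos
    exact_mod_cast this
  have h2 : ∑ j ∈ Finset.univ.erase i, x j ≤ n * s := by
    refine (Finset.sum_le_sum fun j _ => hle j).trans ?_
    rw [Finset.sum_const, nsmul_eq_mul]
    refine mul_le_mul_of_nonneg_right ?_ hs0.le
    exact_mod_cast (Finset.card_le_univ _).trans (by simp)
  have h3 := Finset.add_sum_erase Finset.univ x (Finset.mem_univ i)
  have h4 : s ≤ n * s := le_mul_of_one_le_left hs0.le hn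
  exact abs_le.2 ⟨by linarith, (hle i).trans h4⟩

theorem NormalAt.hessSq_zero {B : ℝ} (h : NormalAt G A B) :
    lhessSq G w 0 = ∑ i, ∑ j, pd i (pd j w) 0 ^ 2 := by
  simp only [lhessSq, h.inv_zero, h.hess_zero]
  refine Finset.sum_congr rfl fun i _ => ?_
  simp [sq]

/-- The bound for the Hessian in terms of the bound `C` for the Laplacian. -/
def traceConst (n : ℕ) (B b κ μ C : ℝ) : ℝ :=
  b * b + B + (κ * (C + (n * B + n * (μ * (n * b ^ 2) + 1))) + μ * (n * b ^ 2) + 1)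
    + n * (C + n * B + n * (κ * C + μ * (n * b ^ 2) + 1))

/-- On `Γ_2` the full Hessian is controlled by an upper bound for the Laplacian. -/
theorem NormalAt.hess_le_of_lapl_le [NeZero n] {B b κ μ t C : ℝ} (h : NormalAt G A B)
    (hb : ∀ i, |pd i w 0| ≤ b) (hκ : 0 ≤ κ) (hμ : 0 ≤ μ)
    (ht : t ∈ Set.Icc (0 : ℝ) 1) {x : Fin n → ℝ}
    (hx : endoMat G A κ μ t w 0 = Matrix.diagonal x) (hx2 : x ∈ gam Finset.univ 2)
    (hC : 0 ≤ C) (hΔ : lapl G w 0 ≤ C) (i j : Fin n) :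
    |pd i (pd j w) 0| ≤ traceConst n B b κ μ C := by
  have hB : 0 ≤ B := h.abs_le_bound_nonneg
  have hb0 : 0 ≤ b := (abs_nonneg _).trans (hb 0)
  set f := κ * lapl G w 0 + μ * lgradSq G w 0 + (1 - t) with hf
  set Δ := lapl G w 0 with hΔdef
  set N := lgradSq G w 0 with hN
  have hN0 : 0 ≤ N := by
    rw [hN, h.gradSq_zero]; exact Finset.sum_nonneg fun _ _ => sq_nonneg _
  have hNb : N ≤ n * b ^ 2 := by
    rw [hN, h.gradSq_zero]
    refine (Finset.sum_le_sum fun i _ => sq_le_sq' (abs_le.1 (hb i)).1 (abs_le.1 (hb i)).2).trans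
      (le_of_eq ?_)
    simp
  have htA : ∀ i j, |t * A 0 i j| ≤ B := fun i j => by
    rw [abs_mul, abs_of_nonneg ht.1]
    exact (mul_le_mul ht.2 (h.bdA i j) (abs_nonneg _) zero_le_one).trans (one_mul B).le
  have hent : ∀ i j, pd i (pd j w) 0 - pd i w 0 * pd j w 0 - t * A 0 i j
      + f * (if i = j then 1 else 0) = if i = j then x i else 0 := by
    intro i j
    have h1 := hx
    rw [endoMat, h.one, _root_.inv_one, Matrix.one_mul] at h1
    replace h1 := congrFun (congrFun h1 i) j
    simp only [Matrix.diagonal_apply, Matrix.add_apply, Matrix.smul_apply, smul_eq_mul, coreMat,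
      Matrix.sub_apply, Matrix.vecMulVec_apply, h.hess_zero, Matrix.one_apply] at h1
    exact h1
  set s := ∑ i, x i with hs
  have hs0 : 0 < s := by
    have := hx2 1 (by norm_num)
    rwa [es_one] at this
  have htr : s = Δ - N - ∑ i, t * A 0 i i + n * f := by
    have h1 : ∀ i, x i = pd i (pd i w) 0 - pd i w 0 ^ 2 - t * A 0 i i + f := by
      intro i
      have := hent i i
      simp only [if_true] at this
      rw [← this]; ring
    rw [hs, Finset.sum_congr rfl fun i _ => h1 i, hΔdef, hN, h.lapl_zero, h.gradSq_zero]
    simp only [Finset.sum_add_distrib, Finset.sum_sub_distrib, Finset.sum_const, Finset.card_univ,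
      Fintype.card_fin, nsmul_eq_mul]
  have htrA := abs_le.1 (abs_sum_le_mul fun i => htA i i)
  have hn0 : (0 : ℝ) ≤ n := Nat.cast_nonneg n
  have hμN : μ * N ≤ μ * (n * b ^ 2) := mul_le_mul_of_nonneg_left hNb hμ
  have hμN0 : 0 ≤ μ * N := mul_nonneg hμ hN0
  have hκΔ : κ * Δ ≤ κ * C := mul_le_mul_of_nonneg_left hΔ hκ
  have hsC : s ≤ C + n * B + n * (κ * C + μ * (n * b ^ 2) + 1) := by
    have : n * f ≤ n * (κ * C + μ * (n * b ^ 2) + 1) :=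
      mul_le_mul_of_nonneg_left (by rw [hf]; linarith [ht.1]) hn0
    linarith
  set C₂ := n * B + n * (μ * (n * b ^ 2) + 1) with hC₂
  have hC₂0 : 0 ≤ C₂ := by positivity
  -- Positivity of the trace `s` gives `(1 + n κ) Δ > -C₂`.
  have hΔl : -C₂ ≤ Δ := by
    rcases le_or_gt 0 Δ with h0 | h0
    · linarith
    · have h1 : n * f ≤ n * (μ * (n * b ^ 2) + 1) :=
        mul_le_mul_of_nonneg_left (by
          rw [hf]; linarith [ht.1, mul_nonpos_of_nonneg_of_nonpos hκ h0.le]) hn0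
      linarith
  have hfb : |f| ≤ κ * (C + C₂) + μ * (n * b ^ 2) + 1 := by
    have h1 : |Δ| ≤ C + C₂ := abs_le.2 ⟨by linarith, by linarith⟩
    have h2 := mul_le_mul_of_nonneg_left (abs_le.1 h1).2 hκ
    have h3 := mul_le_mul_of_nonneg_left (abs_le.1 h1).1 hκ
    have h4 : 0 ≤ μ * (n * b ^ 2) := by positivity
    rw [hf]
    exact abs_le.2 ⟨by linarith [ht.2], by linarith [ht.1]⟩
  have hww : |pd i w 0 * pd j w 0| ≤ b * b := by
    rw [abs_mul]; exact mul_le_mul (hb i) (hb j) (abs_nonneg _) hb0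
  have hxi : |if i = j then x i else 0| ≤ n * (C + n * B + n * (κ * C + μ * (n * b ^ 2) + 1)) := by
    have h1 : |x i| ≤ n * (C + n * B + n * (κ * C + μ * (n * b ^ 2) + 1)) :=
      (abs_le_of_mem_gam hx2 i).trans (mul_le_mul_of_nonneg_left hsC hn0)
    split_ifs
    · exact h1
    · rw [abs_zero]; exact (abs_nonneg _).trans h1
  have hfi : |f * (if i = j then 1 else 0)| ≤ κ * (C + C₂) + μ * (n * b ^ 2) + 1 := by
    split_ifs
    · rwa [mul_one]
    · rw [mul_zero, abs_zero]; exact (abs_nonneg _).trans hfb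
  have e : pd i (pd j w) 0 = pd i w 0 * pd j w 0 + t * A 0 i j
      - f * (if i = j then 1 else 0) + (if i = j then x i else 0) := by
    rw [← hent i j]; ring
  have h1 := abs_le.1 hww
  have h2 := abs_le.1 (htA i j)
  have h3 := abs_le.1 hfi
  have h4 := abs_le.1 hxi
  rw [e, traceConst]
  exact abs_le.2 ⟨by linarith, by linarith⟩

end TraceBound

section Global

variable {n : ℕ} {M : Type*} [TopologicalSpace M] [ChartedSpace (EuclideanSpace ℝ (Fin n)) M]
  [IsManifold (𝓡 n) ∞ M]

theorem isPullback_transition (g : Metric n M)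
    {e e' : OpenPartialHomeomorph M (EuclideanSpace ℝ (Fin n))} {y : Euc n}
    (he : e ∈ atlas (EuclideanSpace ℝ (Fin n)) M) (he' : e' ∈ atlas (EuclideanSpace ℝ (Fin n)) M)
    (hy : y ∈ e.target ∩ e.symm ⁻¹' e'.source) :
    IsPullback (gMat g e) (gMat g e') (e' ∘ e.symm) y :=
  { map := ((contDiffOn_transition he he').contDiffAt (isOpen_transition.mem_nhds hy)).of_le
      ENat.LEInfty.out
    metric := fun i j => ((contDiffOn_gMat g he' i j).contDiffAt
      (e'.open_target.mem_nhds (e'.map_source hy.2))).of_le ENat.LEInfty.out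
    symm := Filter.Eventually.of_forall (gMat_symm g e')
    det := gMat_det g he' (e'.map_source hy.2)
    jac_det := fun h0 => gMat_det g he hy.1 (by
      rw [gMat_transition g he he' hy, pullMat, Matrix.det_mul, h0, mul_zero])
    eq := by
      filter_upwards [isOpen_transition.mem_nhds hy] with x hx
      exact gMat_transition g he he' hx }

/-- The test function `Δu + K |∇u|²` of the maximum principle, computed at `p` in the preferred
chart at `p`. -/
def testFun (g : Metric n M) (K : ℝ) (u : M → ℝ) (p : M) : ℝ :=
  lapl (gMat g (chartAt (Euc n) p)) (u ∘ (chartAt (Euc n) p).symm) (chartAt (Euc n) p p)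
    + K * gradSq g (chartAt (Euc n) p) u (chartAt (Euc n) p p)

/-- The test function is continuous although it is defined by a chart varying with the point: near
`p` it equals its expression in the chart at `p`, by invariance. -/
theorem continuous_testFun (g : Metric n M) (K : ℝ) {u : M → ℝ}
    (hu : ContMDiff (𝓡 n) 𝓘(ℝ) 4 u) : Continuous (testFun g K u) := by
  rw [continuous_iff_continuousAt]
  intro p
  set e := chartAt (Euc n) p with he
  have hea : e ∈ atlas (Euc n) M := chart_mem_atlas _ p
  have hp : p ∈ e.source := mem_chart_source _ p
  have hy : e p ∈ e.target := e.map_source hp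
  set w := u ∘ e.symm with hw
  have hw4 : ContDiffAt ℝ 4 w (e p) := contDiffAt_comp_chart_symm
    (ENat.LEInfty.out : (4 : WithTop ℕ∞) ≤ (∞ : WithTop ℕ∞)) hu hea hy
  have hev : testFun g K u =ᶠ[nhds p]
      (fun y => lapl (gMat g e) w y + K * lgradSq (gMat g e) w y) ∘ e := by
    filter_upwards [e.open_source.mem_nhds hp] with p' hp'
    set e' := chartAt (Euc n) p' with he'
    have hleft : e.symm (e p') = p' := e.left_inv hp'
    have hmem : e p' ∈ e.target ∩ e.symm ⁻¹' e'.source :=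
      ⟨e.map_source hp', by
        show e.symm (e p') ∈ e'.source
        rw [hleft]; exact mem_chart_source _ p'⟩
    have hpb := isPullback_transition g hea (chart_mem_atlas (Euc n) p') hmem
    have hθ : (e' ∘ e.symm) (e p') = e' p' := congrArg e' hleft
    have hw' : ContDiffAt ℝ 2 (u ∘ e'.symm) ((e' ∘ e.symm) (e p')) := by
      rw [hθ]
      exact (contDiffAt_comp_chart_symm (ENat.LEInfty.out : (4 : WithTop ℕ∞) ≤ (∞ : WithTop ℕ∞))
        hu (chart_mem_atlas (Euc n) p') (mem_chart_target _ p')).of_le (by norm_num)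
    have hc : w =ᶠ[nhds (e p')] fun x => (u ∘ e'.symm) ((e' ∘ e.symm) x) := by
      filter_upwards [(isOpen_transition (e := e) (e' := e')).mem_nhds hmem] with x hx
      simp only [hw, Function.comp]
      rw [e'.left_inv hx.2]
    simp only [Function.comp_apply, testFun]
    rw [lapl_congr hc, lgradSq_congr hc, hpb.lapl_eq hw',
      hpb.gradSq_eq (hw'.differentiableAt two_ne_zero), hθ]
    rfl
  have hG : ContDiffMat 1 (gMat g e) (e p) := fun i j => ((contDiffOn_gMat g hea i j).contDiffAt
    (e.open_target.mem_nhds hy)).of_le ENat.LEInfty.out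
  have hd := gMat_det g hea hy
  have hinv : ∀ i j, ContinuousAt (fun y => (gMat g e y)⁻¹ i j) (e p) := fun i j =>
    (hG.inv hd i j).continuousAt
  have hpd : ∀ i, ContDiffAt ℝ 3 (pd i w) (e p) := fun i => contDiffAt_pd hw4 (by norm_num) i
  have hpdc : ∀ i, ContinuousAt (pd i w) (e p) := fun i => (hpd i).continuousAt
  have hpd2 : ∀ i j, ContinuousAt (pd i (pd j w)) (e p) := fun i j =>
    (contDiffAt_pd (hpd j) (m' := 2) (by norm_num) i).continuousAt
  have hΓ : ∀ k i j, ContinuousAt (lchr (gMat g e) k i j) (e p) := fun k i j =>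
    (contDiffAt_lchr hG hd (m' := 0) (by norm_num) k i j).continuousAt
  have hcont : ContinuousAt (fun y => lapl (gMat g e) w y + K * lgradSq (gMat g e) w y) (e p) := by
    have h1 : ContinuousAt (fun y => ∑ i, ∑ j, (gMat g e y)⁻¹ i j *
        (pd i (pd j w) y - ∑ k, lchr (gMat g e) k i j y * pd k w y)) (e p) :=
      tendsto_finsetSum _ fun i _ => tendsto_finsetSum _ fun j _ => (hinv i j).mul
        ((hpd2 i j).sub (tendsto_finsetSum _ fun k _ => (hΓ k i j).mul (hpdc k)))
    have h2 : ContinuousAt (fun y => ∑ i, ∑ j, (gMat g e y)⁻¹ i j * pd i w y * pd j w y) (e p) :=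
      tendsto_finsetSum _ fun i _ => tendsto_finsetSum _ fun j _ =>
        ((hinv i j).mul (hpdc i)).mul (hpdc j)
    exact ContinuousAt.add h1 (continuousAt_const.mul h2)
  exact (ContinuousAt.comp hcont (e.continuousAt hp)).congr hev.symm

theorem le_of_ofReal_le {x : ℝ} {a : ℝ≥0} (h : ENNReal.ofReal x ≤ a) : x ≤ a := by
  have h1 := ENNReal.toReal_mono ENNReal.coe_ne_top h
  rw [ENNReal.coe_toReal] at h1
  by_contra hx
  push Not at hx
  have hx0 : 0 ≤ x := a.2.trans hx.le
  rw [ENNReal.toReal_ofReal hx0] at h1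
  linarith

theorem bounds_of_c1Norm_le {g : Metric n M} {u : M → ℝ} {a : ℝ≥0} (h : c1Norm g u ≤ a) (p : M) :
    |u p| ≤ a ∧ gradNorm g u p ≤ a := by
  refine ⟨le_of_ofReal_le ?_, le_of_ofReal_le ?_⟩
  · exact (le_iSup (fun p => ENNReal.ofReal |u p|) p).trans (le_self_add.trans h)
  · exact (le_iSup (fun p => ENNReal.ofReal (gradNorm g u p)) p).trans (le_add_self.trans h)

theorem bounds_of_c2Norm_le {g : Metric n M} {u : M → ℝ} {a : ℝ≥0} (h : c2Norm g u ≤ a) (p : M) :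
    |u p| ≤ a ∧ gradNorm g u p ≤ a ∧ hessNorm g u p ≤ a := by
  obtain ⟨h1, h2⟩ := bounds_of_c1Norm_le (le_self_add.trans h) p
  refine ⟨h1, h2, le_of_ofReal_le ?_⟩
  exact (le_iSup (fun p => ENNReal.ofReal (hessNorm g u p)) p).trans (le_add_self.trans h)

theorem abs_le_of_sqrt_sum_le {ι : Type*} {s : Finset ι} {f : ι → ℝ} {a : ℝ}
    (h : √(∑ i ∈ s, f i ^ 2) ≤ a) {i : ι} (hi : i ∈ s) : |f i| ≤ a := by
  refine le_trans ?_ h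
  rw [← Real.sqrt_sq_eq_abs]
  exact Real.sqrt_le_sqrt (Finset.single_le_sum (f := fun i => f i ^ 2) (fun _ _ => sq_nonneg _) hi)

namespace IsNormalParam

variable {g : Metric n M} {τ B : ℝ} {Ψ : Euc n → M} {G : Euc n → Matrix (Fin n) (Fin n) ℝ}
  (h : IsNormalParam g τ B Ψ G) {f : M → ℝ} (hf : ContMDiff (𝓡 n) 𝓘(ℝ) 4 f)
include h hf

theorem contDiffAt_four : ContDiffAt ℝ 4 (fun z => f (Ψ z)) 0 := h.smooth ENat.LEInfty.out hf

theorem gradNorm_eq : gradNorm g f (Ψ 0) = √(∑ i, pd i (fun z => f (Ψ z)) 0 ^ 2) := by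
  rw [gradNorm, ← h.normal.gradSq_zero]
  exact congrArg _ (h.eventually_invariance hf).self_of_nhds.2.1.symm

theorem hessNorm_eq :
    hessNorm g f (Ψ 0) = √(∑ i, ∑ j, pd i (pd j fun z => f (Ψ z)) 0 ^ 2) := by
  rw [hessNorm, ← h.normal.hessSq_zero]
  exact congrArg _ (h.eventually_invariance hf).self_of_nhds.2.2.1.symm

theorem abs_pd_le {a : ℝ} (ha : gradNorm g f (Ψ 0) ≤ a) (i : Fin n) :
    |pd i (fun z => f (Ψ z)) 0| ≤ a := by
  rw [h.gradNorm_eq hf] at ha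
  exact abs_le_of_sqrt_sum_le ha (Finset.mem_univ i)

theorem abs_pd_pd_le {a : ℝ} (ha : hessNorm g f (Ψ 0) ≤ a) (i j : Fin n) :
    |pd i (pd j fun z => f (Ψ z)) 0| ≤ a := by
  rw [h.hessNorm_eq hf, ← Fintype.sum_prod_type' fun i j => pd i (pd j fun z => f (Ψ z)) 0 ^ 2]
    at ha
  exact abs_le_of_sqrt_sum_le (f := fun q : Fin n × Fin n => pd q.1 (pd q.2 fun z => f (Ψ z)) 0) ha
    (Finset.mem_univ (i, j))

theorem eventually_testFun_eq (K : ℝ) : ∀ᶠ z in nhds 0, testFun g K f (Ψ z)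
    = lapl G (fun z => f (Ψ z)) z + K * lgradSq G (fun z => f (Ψ z)) z := by
  filter_upwards [h.eventually_invariance hf] with z hz
  rw [hz.1, hz.2.1, testFun]

/-- Membership of the eigenvalues in `Γ_m`, read off from the diagonalized endomorphism. -/
theorem mem_gam_of_inGamma {t : ℝ} {x : Fin n → ℝ} {m : ℕ} (hm : m ≤ n)
    (hx : endoMat G (lschouten τ G) ((1 - τ) / ((n : ℝ) - 2)) ((2 - τ) / 2) t (fun z => f (Ψ z)) 0
      = Matrix.diagonal x) (hΓ : InGamma m (lamU g τ t f (Ψ 0))) : x ∈ gam Finset.univ m := by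
  intro j hj
  rcases Nat.eq_zero_or_pos j with rfl | hj0
  · rw [es_zero]; exact one_pos
  · have h1 := hΓ j hj0 hj
    rwa [(h.eventually_invariance hf).self_of_nhds.2.2.2 t j (hj.trans hm), hx,
      charSigma_diagonal (hj.trans hm)] at h1

end IsNormalParam

theorem cConst_pos {k : ℕ} (hk : 3 ≤ k) (hkn : k ≤ n) : 0 < cConst n k := by
  have h1 : ∀ j ≤ n, 0 < sigma j (Multiset.replicate n 1) := by
    intro j hj
    have e : Multiset.replicate n (1 : ℝ)
        = (Finset.univ : Finset (Fin n)).val.map fun _ => (1 : ℝ) := by simp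
    rw [e, sigma_map_eq_es]
    exact mem_gam_of_pos (s := Finset.univ) (m := n) (by simp) (fun _ => one_pos) j hj
  refine div_pos (h1 k hkn) (Finset.sum_pos (fun l hl => h1 l ?_) ⟨0, by simp; omega⟩)
  have := Finset.mem_range.1 hl
  omega

theorem exists_pos_le (δ : ℕ → ℝ) (N : ℕ) (hδ : ∀ l < N, 0 < δ l) :
    ∃ d > 0, ∀ l < N, d ≤ δ l := by
  induction N with
  | zero => exact ⟨1, one_pos, fun l hl => absurd hl (by omega)⟩
  | succ N ih =>
    obtain ⟨d, hd, h⟩ := ih fun l hl => hδ l (by omega)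
    refine ⟨min d (δ N), lt_min hd (hδ N (by omega)), fun l hl => ?_⟩
    rcases Nat.lt_succ_iff_lt_or_eq.1 hl with h' | rfl
    · exact (min_le_left _ _).trans (h l h')
    · exact min_le_right _ _

end Global

/-! ### The maximum principle on the manifold -/

section Maximum

variable {n : ℕ} {M : Type*} [TopologicalSpace M] [ChartedSpace (EuclideanSpace ℝ (Fin n)) M]
  [IsManifold (𝓡 n) ∞ M]

/-- The bounds of `c + t f` up to second order in a normal parametrization, for `0 ≤ t ≤ 1`. -/
theorem IsNormalParam.bounds_const_add_mul {g : Metric n M} {τ B : ℝ} {Ψ : Euc n → M}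
    {G : Euc n → Matrix (Fin n) (Fin n) ℝ} (h : IsNormalParam g τ B Ψ G) {f : M → ℝ}
    (hf : ContMDiff (𝓡 n) 𝓘(ℝ) 4 f) {a : ℝ≥0} (ha : c2Norm g f ≤ a) {c t D : ℝ}
    (ht : t ∈ Set.Icc (0 : ℝ) 1) (hD : |c| + a ≤ D) :
    ContDiffAt ℝ 2 (fun z => c + t * f (Ψ z)) 0 ∧ |c + t * f (Ψ 0)| ≤ D ∧
      (∀ i, |pd i (fun z => c + t * f (Ψ z)) 0| ≤ D) ∧
      ∀ i, |pd2 i (fun z => c + t * f (Ψ z)) 0| ≤ D := by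
  have hf2 : ContDiffAt ℝ 2 (fun z => f (Ψ z)) 0 :=
    (h.contDiffAt_four hf).of_le (by norm_num)
  have htf : ContDiffAt ℝ 2 (fun z => t * f (Ψ z)) 0 := contDiffAt_const.mul hf2
  obtain ⟨h0, h1, h2⟩ := bounds_of_c2Norm_le ha (Ψ 0)
  have hmul : ∀ {x : ℝ}, |x| ≤ a → |t * x| ≤ a := fun {x} hx => by
    rw [abs_mul, abs_of_nonneg ht.1]
    exact (mul_le_of_le_one_left (abs_nonneg x) ht.2).trans hx
  have haD : (a : ℝ) ≤ D := (le_add_of_nonneg_left (abs_nonneg c)).trans hD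
  refine ⟨contDiffAt_const.add htf, ?_, fun i => ?_, fun i => ?_⟩
  · exact (abs_add_le _ _).trans ((add_le_add_right (hmul h0) _).trans hD)
  · rw [pd_add (differentiableAt_const c) (htf.differentiableAt two_ne_zero),
      pd_const_mul (hf2.differentiableAt two_ne_zero), pd_const, zero_add]
    exact (hmul (h.abs_pd_le hf h1 i)).trans haD
  · rw [pd2_add contDiffAt_const htf, pd2_const_mul hf2, pd2_const, zero_add]
    exact (hmul (h.abs_pd_pd_le hf h2 i i)).trans haD

variable [CompactSpace M]

/-- At a maximum point of the test function, its value is bounded in terms of the data. -/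
theorem exists_testFun_bound [NeZero n] {m : ℕ} (hm1 : 1 ≤ m) (hm : m + 2 ≤ n) (g : Metric n M)
    {τ : ℝ} (hκ : 0 < (1 - τ) / ((n : ℝ) - 2)) (hμ : 0 ≤ (2 - τ) / 2) (a b : ℝ≥0) (A : ℕ → ℝ≥0)
    {δ : ℝ} (hδ : 0 < δ) :
    ∃ C : ℝ, 0 ≤ C ∧ ∀ (t : ℝ) (α : M → ℝ) (αs : ℕ → M → ℝ) (u : M → ℝ),
      t ∈ Set.Icc (0 : ℝ) 1 → ContMDiff (𝓡 n) 𝓘(ℝ) 4 α →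
      (∀ l < m + 1, ContMDiff (𝓡 n) 𝓘(ℝ) 4 (αs l)) → ContMDiff (𝓡 n) 𝓘(ℝ) 4 u →
      (∀ p, InGamma (m + 1) (lamU g τ t u p)) → Solves g (m + 2) τ t α αs u →
      c2Norm g α ≤ a → c1Norm g u ≤ b → (∀ l < m + 1, c2Norm g (αs l) ≤ A l) →
      (∀ l < m + 1, ∀ p, δ ≤ αs l p) →
      ∀ p, testFun g (((2 - τ) / 2 + 1) / ((1 - τ) / ((n : ℝ) - 2))) u p ≤ C := by
  set κ := (1 - τ) / ((n : ℝ) - 2) with hκdef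
  set μ := (2 - τ) / 2 with hμdef
  set K := (μ + 1) / κ with hK
  have hK0 : 0 ≤ K := by positivity
  have hc : 0 < cConst n (m + 2) := cConst_pos (by omega) hm
  obtain ⟨B, hB⟩ := exists_isNormalParam (M := M) g τ κ μ
  set D : ℝ := cConst n (m + 2) + a + ∑ l ∈ Finset.range (m + 1), (A l : ℝ) with hD
  have hA0 : (0 : ℝ) ≤ ∑ l ∈ Finset.range (m + 1), (A l : ℝ) :=
    Finset.sum_nonneg fun l _ => (A l).2
  have haD : (a : ℝ) ≤ D := by linarith
  have hAD : ∀ l < m + 1, cConst n (m + 2) + A l ≤ D := fun l hl => by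
    have := Finset.single_le_sum (f := fun l => (A l : ℝ)) (fun l _ => (A l).2)
      (Finset.mem_range.2 hl)
    have ha0 : (0 : ℝ) ≤ a := a.2
    linarith
  obtain ⟨C₀, hC₀⟩ := exists_hessSize_bound hm B b κ μ D (min (cConst n (m + 2)) δ)
    (2 * ((m : ℝ) + 2)) hκ hμ (lt_min hc hδ) (by have : (0 : ℝ) ≤ m := Nat.cast_nonneg m; linarith)
  refine ⟨n * |C₀| + K * (n * (b : ℝ) ^ 2), by positivity, ?_⟩
  intro t α αs u ht hα hαs hu hΓ hsol hαa hub hαsA hαδ p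
  have hne : (Set.univ : Set M).Nonempty := ⟨p, Set.mem_univ p⟩
  obtain ⟨p₀, -, hmax⟩ := isCompact_univ.exists_isMaxOn hne (continuous_testFun g K hu).continuousOn
  refine (hmax (Set.mem_univ p)).trans ?_
  obtain ⟨Ψ, G, x, rfl, hΨ, hx⟩ := hB p₀ t u hu
  have hw := hΨ.contDiffAt_four hu
  obtain ⟨hu0, hu1⟩ := bounds_of_c1Norm_le hub (Ψ 0)
  have hub1 : ∀ i, |pd i (fun z => u (Ψ z)) 0| ≤ b := hΨ.abs_pd_le hu hu1
  have hφ : ∀ l < m + 1, ContDiffAt ℝ 2 (fun z => (1 - t) * cConst n (m + 2) + t * αs l (Ψ z)) 0 ∧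
      min (cConst n (m + 2)) δ ≤ (1 - t) * cConst n (m + 2) + t * αs l (Ψ 0) ∧
      |(1 - t) * cConst n (m + 2) + t * αs l (Ψ 0)| ≤ D ∧
      (∀ i, |pd i (fun z => (1 - t) * cConst n (m + 2) + t * αs l (Ψ z)) 0| ≤ D) ∧
      ∀ i, |pd2 i (fun z => (1 - t) * cConst n (m + 2) + t * αs l (Ψ z)) 0| ≤ D := by
    intro l hl
    have h1 : 0 ≤ 1 - t := sub_nonneg.2 ht.2
    have hcD : |(1 - t) * cConst n (m + 2)| + A l ≤ D := by
      rw [abs_of_nonneg (mul_nonneg h1 hc.le)]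
      have := mul_le_of_le_one_left hc.le (show 1 - t ≤ 1 by linarith [ht.1])
      linarith [hAD l hl]
    obtain ⟨e1, e2, e3, e4⟩ := hΨ.bounds_const_add_mul (hαs l hl) (hαsA l hl) ht hcD
    refine ⟨e1, ?_, e2, e3, e4⟩
    -- a convex combination of `cConst` and `αs l`
    have h2 := mul_le_mul_of_nonneg_left (min_le_left (cConst n (m + 2)) δ) h1
    have h3 := mul_le_mul_of_nonneg_left
      ((min_le_right (cConst n (m + 2)) δ).trans (hαδ l hl (Ψ 0))) ht.1
    linarith
  have hρ : ContDiffAt ℝ 2 (fun z => t * α (Ψ z)) 0 ∧ |t * α (Ψ 0)| ≤ D ∧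
      (∀ i, |pd i (fun z => t * α (Ψ z)) 0| ≤ D) ∧
      ∀ i, |pd2 i (fun z => t * α (Ψ z)) 0| ≤ D := by
    simpa only [zero_add] using hΨ.bounds_const_add_mul hα hαa (c := 0) ht (by simpa using haD)
  have hbound := hC₀ G (lschouten τ G) (fun z => u (Ψ z)) t x
    (fun l z => (1 - t) * cConst n (m + 2) + t * αs l (Ψ z))
    (fun l => 2 * (((m + 2 : ℕ) : ℝ) - l)) (fun z => t * α (Ψ z)) hΨ.normal hw hu0 hub1
    (by rw [abs_of_nonneg ht.1]; exact ht.2) hx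
    (hΨ.mem_gam_of_inGamma hu (by omega) hx (hΓ (Ψ 0)))
    (fun l hl => by
      have h1 : (l : ℝ) ≤ m := by exact_mod_cast Nat.lt_succ_iff.1 hl
      have h2 : (0 : ℝ) ≤ l := Nat.cast_nonneg l
      push_cast
      exact abs_le.2 ⟨by linarith, by linarith⟩) hφ hρ
    (by
      filter_upwards [hΨ.eventually_invariance hu] with z hz
      have hs := fun j hj => hz.2.2.2 t j hj
      have h1 := hsol (Ψ z)
      have e : m + 2 - 1 = m + 1 := rfl
      rw [e, hs _ hm, hs _ (by omega), Finset.sum_congr rfl fun l hl => by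
        rw [hs l (by have := Finset.mem_range.1 hl; omega)]] at h1
      rw [h1]; ring)
    (by
      filter_upwards [hΨ.eventually_testFun_eq hu K] with z hz
      rw [← hz, ← (hΨ.eventually_testFun_eq hu K).self_of_nhds]
      exact hmax (Set.mem_univ _))
  rw [(hΨ.eventually_testFun_eq hu K).self_of_nhds, hΨ.normal.lapl_zero,
    hΨ.normal.gradSq_zero]
  refine add_le_add ((le_abs_self _).trans (abs_sum_le_mul fun i =>
    (abs_pd_pd_le_hessSize _ i i).trans (hbound.trans (le_abs_self _))))
    (mul_le_mul_of_nonneg_left ?_ hK0)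
  refine (Finset.sum_le_sum fun i _ =>
    sq_le_sq' (abs_le.1 (hub1 i)).1 (abs_le.1 (hub1 i)).2).trans (le_of_eq ?_)
  simp

/-- On `Γ_2`, a bound for the test function gives a bound for the Hessian. -/
theorem exists_hessNorm_bound_of_testFun [NeZero n] (hn : 2 ≤ n) (g : Metric n M) {τ : ℝ}
    (hκ : 0 < (1 - τ) / ((n : ℝ) - 2)) (hμ : 0 ≤ (2 - τ) / 2) {K C : ℝ} (hK : 0 ≤ K)
    (hC : 0 ≤ C) (b : ℝ≥0) :
    ∃ C' : ℝ, ∀ (t : ℝ) (u : M → ℝ), t ∈ Set.Icc (0 : ℝ) 1 → ContMDiff (𝓡 n) 𝓘(ℝ) 4 u →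
      (∀ p, InGamma 2 (lamU g τ t u p)) → c1Norm g u ≤ b → (∀ p, testFun g K u p ≤ C) →
      ∀ p, hessNorm g u p ≤ C' := by
  set κ := (1 - τ) / ((n : ℝ) - 2) with hκdef
  set μ := (2 - τ) / 2 with hμdef
  obtain ⟨B, hB⟩ := exists_isNormalParam (M := M) g τ κ μ
  refine ⟨√(n * (n * traceConst n B b κ μ C ^ 2)), ?_⟩
  intro t u ht hu hΓ hub htest p
  obtain ⟨Ψ, G, x, rfl, hΨ, hx⟩ := hB p t u hu
  have hub1 : ∀ i, |pd i (fun z => u (Ψ z)) 0| ≤ b :=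
    hΨ.abs_pd_le hu (bounds_of_c1Norm_le hub (Ψ 0)).2
  have hlap : lapl G (fun z => u (Ψ z)) 0 ≤ C := by
    have h1 := htest (Ψ 0)
    have h2 : 0 ≤ lgradSq G (fun z => u (Ψ z)) 0 := by
      rw [hΨ.normal.gradSq_zero]
      exact Finset.sum_nonneg fun _ _ => sq_nonneg _
    rw [(hΨ.eventually_testFun_eq hu K).self_of_nhds] at h1
    linarith [mul_nonneg hK h2]
  have hx2 := hΨ.mem_gam_of_inGamma hu hn hx (hΓ (Ψ 0))
  rw [hΨ.hessNorm_eq hu]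
  have hsq : ∀ i j, pd i (pd j fun z => u (Ψ z)) 0 ^ 2 ≤ traceConst n B b κ μ C ^ 2 := fun i j => by
    have h1 := hΨ.normal.hess_le_of_lapl_le hub1 hκ.le hμ ht hx hx2 hC hlap i j
    exact sq_le_sq' (abs_le.1 h1).1 (abs_le.1 h1).2
  refine Real.sqrt_le_sqrt ((Finset.sum_le_sum fun i _ => Finset.sum_le_sum fun j _ =>
    hsq i j).trans (le_of_eq ?_))
  simp

end Maximum

end KrylovEq

end

theorem lemma3p7 {n k : ℕ} (hk : 3 ≤ k) (hkn : k ≤ n)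
    {M : Type*} [TopologicalSpace M] [ChartedSpace (EuclideanSpace ℝ (Fin n)) M]
    [IsManifold (𝓡 n) ∞ M] [CompactSpace M] [T2Space M]
    (g : KrylovEq.Metric n M) (τ : ℝ) (hτ : τ < 1)
    (a b : ℝ≥0) (A : ℕ → ℝ≥0) (δ : ℕ → ℝ) (hδ : ∀ l ≤ k - 2, 0 < δ l) :
    ∃ C : ℝ, ∀ (t : ℝ) (α : M → ℝ) (αs : ℕ → M → ℝ) (u : M → ℝ),
      t ∈ Set.Icc (0 : ℝ) 1 →
      ContMDiff (𝓡 n) 𝓘(ℝ) ∞ α →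
      (∀ l ≤ k - 2, ContMDiff (𝓡 n) 𝓘(ℝ) ∞ (αs l)) →
      (∀ l ≤ k - 2, ∀ p, 0 < αs l p) →
      ContMDiff (𝓡 n) 𝓘(ℝ) 4 u →
      (∀ p, KrylovEq.InGamma (k - 1) (KrylovEq.lamU g τ t u p)) →
      KrylovEq.Solves g k τ t α αs u →
      KrylovEq.c2Norm g α ≤ a →
      KrylovEq.c1Norm g u ≤ b →
      (∀ l ≤ k - 2, KrylovEq.c2Norm g (αs l) ≤ A l) →
      (∀ l ≤ k - 2, δ l ≤ ⨅ p, αs l p) →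
      ∀ p, KrylovEq.hessNorm g u p ≤ C := by
  have hn : (2 : ℝ) < n := by exact_mod_cast (show 2 < n by omega)
  have : NeZero n := ⟨by omega⟩
  have hκ : 0 < (1 - τ) / ((n : ℝ) - 2) := div_pos (by linarith) (by linarith)
  have hμ : 0 ≤ (2 - τ) / 2 := by linarith
  obtain ⟨m, rfl⟩ : ∃ m, k = m + 2 := ⟨k - 2, by omega⟩
  have hle : ∀ {l}, l < m + 1 → l ≤ m + 2 - 2 := fun hl => by omega
  obtain ⟨d, hd0, hd⟩ := KrylovEq.exists_pos_le δ (m + 1) fun l hl => hδ l (hle hl)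
  obtain ⟨C, hC0, hC⟩ := KrylovEq.exists_testFun_bound (m := m) (by omega) hkn g hκ hμ a b A hd0
  obtain ⟨C', hC'⟩ := KrylovEq.exists_hessNorm_bound_of_testFun (by omega) g hκ hμ
    (K := ((2 - τ) / 2 + 1) / ((1 - τ) / ((n : ℝ) - 2))) (by positivity) hC0 b
  refine ⟨C', fun t α αs u ht hα hαs hpos hu hΓ hsol ha hb hA hinf => ?_⟩
  have h4 : (4 : WithTop ℕ∞) ≤ (∞ : WithTop ℕ∞) := ENat.LEInfty.out
  refine hC' t u ht hu (fun p j h1 h2 => hΓ p j h1 (by omega)) hb ?_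
  refine hC t α αs u ht (hα.of_le h4) (fun l hl => (hαs l (hle hl)).of_le h4) hu hΓ hsol ha hb
    (fun l hl => hA l (hle hl)) fun l hl p => ?_
  -- Positivity makes the range bounded below, so `⨅` is a true infimum here.
  have hbdd : BddBelow (Set.range (αs l)) := ⟨0, by rintro _ ⟨q, rfl⟩; exact (hpos l (hle hl) q).le⟩
  exact ((hd l hl).trans (hinf l (hle hl))).trans (ciInf_le hbdd p)
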